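/- **Setting (code and circuit).** Let $d\ge 3$ be odd, $T\ge 1$ and $b\in\{X,Z\}$. Consider the distance-$d$ rotated surface code on $d\times d$ data qubits (weight-2 $X$-plaquettes on the north and south boundaries, weight-2 $Z$-plaquettes on the west and east boundaries; logical $Z$ horizontal, logical $X$ vertical) and the memory experiment in basis $b$: all data atoms are reset in basis $b$, $T$ rounds of Mid-SWAP syndrome extraction are performed, and all data atoms are measured in basis $b$. In a round, fresh ancilla atoms are reset (in basis $X$ or $Z$ according to the stabilizer type), four CNOT layers are performed ($X$-ancillas are controls, $Z$-ancillas are targets), and the ancilla sites are measured; directly after the first CNOT layer every ancilla atom exchanges places with the data atom it has just interacted with. In even rounds the order of the corners is NW, SW, NE, SE for $Z$-plaquettes and NW, NE, SW, SE for $X$-plaquettes; in odd rounds it is reversed, so that all data atoms are replenished. Detectors are the parities of consecutive outcomes of the same stabilizer; stabilizers of type $b$ are also compared with their initial value and with the final data measurement. The observable is the logical operator of type $b$. **Noise.** Independently: every reset, CNOT, measurement and idling location suffers, with probability $p_{\mathrm{pauli}}$, a uniformly random nontrivial (one- or two-qubit) Pauli error, before a measurement and after any other operation; after each reset, idling or CNOT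 operation each participating atom is lost with probability $p_{\mathrm{loss}}$; and each bit of the loss-resolving readout (one per measured atom $m$; $r_m=1$ means "reported as lost") is wrong with probability $p_{\mathrm{loss}}$, both for present atoms (false positives) and for lost atoms (false negatives, in which case the atom yields a random $0/1$ outcome; this is covered by the envelope below). **Pauli envelope.** The envelope of a single loss consists of all space-time Pauli errors supported on the loss location, the places after it where the lost atom changes its role (role $Z$: control of a CNOT, $Z$-basis reset or measurement; role $X$: target of a CNOT, $X$-basis reset or measurement), and the place just before its measurement. The envelope $E_m$ of an atom $m$ is the union over the possible locations of its loss; the envelope $E(R)$ of a set $R$ of atoms is the set of all products of elements of $E_m$, $m\in R$. Let $(\mathcal D_{m,j},\mathcal O_{m,j})_j$ be the distinct detector-observable pairs produced by elements of $E_m$ in the lossless circuit, and let $(\mathcal D_i,\mathcal O_i)$ be those of the elementary Pauli error mechanisms $i$ (a nontrivial Pauli at a Pauli error location). **Decoder.** Fix $w>0$. Given detector values $s$ and a readout $r$, the Envelope-MLE decoder modified for faulty readout takes an optimal solution (ties broken arbitrarily) of $$\min_{x,y\in\{0,1\}}\ \ w\sum_i y_i+w\sum_{m:\,r_m=0}\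 \sum_j x_{m,j}$$ subject to $\bigoplus_i y_i\mathcal D_i\oplus\bigoplus_{m,j}x_{m,j}\mathcal D_{m,j}=s$, $\ \sum_j x_{m,j}=1$ if $r_m=1$, and $\sum_j x_{m,j}\le 1$ if $r_m=0$ (relaxed exclusivity with penalty), and predicts $\bigoplus_i y_i\mathcal O_i\oplus\bigoplus_{m,j}x_{m,j}\mathcal O_{m,j}$. **Failure.** For Pauli faults $p$, losses $l$ and reported readout $r$, let $R$ be the set of atoms that are lost in $l$ or reported as lost in $r$. The decoder *fails* if for some $e\in E(R)$ its prediction for the detectors of the Pauli error $p\oplus e$ (and readout $r$) differs from the observable of $p\oplus e$. $P_{\mathrm{fail}}$ is the probability of failure under the noise above. **Theorem.** 1. *(Failure condition.)* For all $d,T,b,w$ as above, every such decoder and all $p,l,r$: if the decoder fails, then $2n_p+n_l+2n_f\ge d$, where $n_p$ is the number of Pauli faults, $n_l$ the number of atoms reported as lost (false positives included), and $n_f$ the number of false negatives, i.e. atoms that are lost but not reported as lost. 2. *(Failure probability.)* $P_{\mathrm{fail}}=O\big(p_{\mathrm{th}}^{-d}(p_{\mathrm{loss}}^{d}+p_{\mathrm{pauli}}^{d/2})\big)$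 with a threshold independent of $d$. Precisely, there are absolute constants $p_{\mathrm{th}}>0$ and $K>0$ such that for all odd $d\ge 3$, all $T\ge 1$, $b\in\{X,Z\}$, $w>0$, every such decoder and all $p_{\mathrm{loss}},p_{\mathrm{pauli}}\in[0,1]$, $$P_{\mathrm{fail}}\ \le\ K\,T\,p_{\mathrm{th}}^{-d}\big(p_{\mathrm{loss}}^{d}+p_{\mathrm{pauli}}^{d/2}\big).$$ -/

import Mathlib

namespace AtomLoss

/-! ## Circuits, Pauli errors and the detector-observable pair -/

inductive Basis
  | X
  | Z
  deriving DecidableEq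

/-- A single-qubit Pauli operator up to phase: `(x, z)` stands for `X ^ x * Z ^ z`, and
addition is composition. -/
abbrev Pauli := ZMod 2 × ZMod 2

/-- What a circuit layer does at a site.  `ctrl t` (`targ c`) says that the atom is the control
(target) of a CNOT with target at `t` (control at `c`).  `swap s` is atom shuttling: the atom is
moved to `s`, and the atom of `s` comes here.  `idle` is a noisy waiting location; `nop` is a site
without an atom, or an atom that is not involved in a shuttling step. -/
inductive Op (S : Type)
  | nop
  | idle
  | reset (b : Basis)
  | meas (b : Basis)
  | ctrl (t : S)
  | targ (c : S)
  | swap (s : S)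

namespace Op

variable {S : Type}

def isMeas : Op S → Bool
  | meas _ => true
  | _ => false

/-- Locations of Pauli faults.  A CNOT is one location, attached to the control. -/
def isPauliLoc : Op S → Bool
  | idle => true
  | reset _ => true
  | meas _ => true
  | ctrl _ => true
  | _ => false

/-- Locations of atom loss: every atom after each operation (for a CNOT, both atoms). -/
def isLossLoc : Op S → Bool
  | idle => true
  | reset _ => true
  | ctrl _ => true
  | targ _ => true
  | _ => false

/-- When circuits are compiled into `CZ`, `H` and `Z`-basis reset and measurement, with adjacent
pairs of `H` cancelled, an atom undergoes an `H` between two consecutive operations exactly if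
their roles differ: role `Z` for controls and `Z`-basis reset and measurement, role `X` for targets
and `X`-basis reset and measurement. -/
def role : Op S → Option Basis
  | reset b => some b
  | meas b => some b
  | ctrl _ => some Basis.Z
  | targ _ => some Basis.X
  | _ => none

/-- Propagation of a Pauli operator `F` through a layer `o`, read off at the site `s`. -/
def propagate (o : S → Op S) (F : S → Pauli) (s : S) : Pauli :=
  match o s with
  | nop => F s
  | idle => F s
  | reset _ => 0
  | meas _ => 0
  | ctrl t => ((F s).1, (F s).2 + (F t).2)
  | targ c => ((F s).1 + (F c).1, (F s).2)
  | swap s' => F s'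

/-- Which values a fault may take: two-qubit Paulis at a CNOT, single-qubit Paulis (first
component) elsewhere, the identity excluded. -/
def IsFault (o : Op S) (v : Pauli × Pauli) : Prop :=
  v ≠ 0 ∧ match o with
    | ctrl _ => True
    | _ => v.2 = 0

/-- Depolarizing noise of strength `p`: the fault value is the identity with probability `1 - p`,
and otherwise uniform among the nontrivial Paulis of the location. -/
noncomputable def faultProb (p : ℝ) (o : Op S) (v : Pauli × Pauli) : ℝ :=
  match o with
  | ctrl _ => if v = 0 then 1 - p else p / 15
  | _ => if v.2 ≠ 0 then 0 else if v.1 = 0 then 1 - p else p / 3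

end Op

/-- A Clifford circuit on the sites `S`, with layers `op 0, …, op (depth - 1)`, together with
detectors and a logical observable, each the parity of a set of measurements.  A measurement is
named by its layer and its site. -/
structure Experiment (S D : Type) where
  depth : ℕ
  op : ℕ → S → Op S
  det : D → Finset (ℕ × S)
  obs : Finset (ℕ × S)

namespace Experiment

variable {S D : Type} (C : Experiment S D)

/-- Space-time Pauli error configurations: `e τ s` acts on the site `s` right before layer `τ`. -/
abbrev Config (S : Type) := ℕ → S → Pauli

/-- The accumulated Pauli error right before layer `τ`. -/
def frame (e : Config S) : ℕ → S → Pauli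
  | 0 => e 0
  | τ + 1 => fun s => Op.propagate (C.op τ) (frame e τ) s + e (τ + 1) s

/-- Whether the outcome of the measurement at layer `τ` and site `s` is flipped. -/
def flip (e : Config S) (τ : ℕ) (s : S) : ZMod 2 :=
  match C.op τ s with
  | Op.meas Basis.Z => (C.frame e τ s).1
  | Op.meas Basis.X => (C.frame e τ s).2
  | _ => 0

def syndrome (e : Config S) (i : D) : ZMod 2 := ∑ m ∈ C.det i, C.flip e m.1 m.2

def observable (e : Config S) : ZMod 2 := ∑ m ∈ C.obs, C.flip e m.1 m.2

abbrev Outcome (D : Type) := (D → ZMod 2) × ZMod 2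

/-- The detector-observable pair of the lossless circuit with Pauli error `e`, relative to the
noiseless execution. -/
def outcome (e : Config S) : Outcome D := (C.syndrome e, C.observable e)

/-! ## Fault locations -/

abbrev PauliLoc := {ℓ : Fin C.depth × S // (C.op ℓ.1 ℓ.2).isPauliLoc = true}

abbrev LossLoc := {ℓ : Fin C.depth × S // (C.op ℓ.1 ℓ.2).isLossLoc = true}

/-- Measurements.  Every atom is measured at the end of its life, so that these also index the
atoms and the bits of the loss-resolving readout. -/
abbrev Meas := {m : Fin C.depth × S // (C.op m.1 m.2).isMeas = true}

section Faults

variable [DecidableEq S]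

/-- The fault `v` at the location `ℓ`: before a measurement, after every other operation. -/
def faultConfig (ℓ : C.PauliLoc) (v : Pauli × Pauli) : Config S := fun σ s =>
  match C.op ℓ.1.1 ℓ.1.2 with
  | Op.meas _ => if σ = ℓ.1.1 ∧ s = ℓ.1.2 then v.1 else 0
  | Op.ctrl t =>
      (if σ = ℓ.1.1 + 1 ∧ s = ℓ.1.2 then v.1 else 0) + (if σ = ℓ.1.1 + 1 ∧ s = t then v.2 else 0)
  | _ => if σ = ℓ.1.1 + 1 ∧ s = ℓ.1.2 then v.1 else 0

/-- Elementary Pauli error mechanisms. -/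
abbrev Mechanism := {i : C.PauliLoc × (Pauli × Pauli) // (C.op i.1.1.1 i.1.1.2).IsFault i.2}

/-- The space-time Pauli error of a list of fault values. -/
def pauliConfig [Fintype S] (p : C.PauliLoc → Pauli × Pauli) : Config S :=
  ∑ ℓ, C.faultConfig ℓ (p ℓ)

end Faults

/-! ## Atoms and Pauli envelopes -/

/-- The site, right before layer `τ + n`, of the atom that is at `s` right before layer `τ`
(`none` if its life is over). -/
def wire (τ : ℕ) (s : S) : ℕ → Option S
  | 0 => some s
  | n + 1 =>
    match C.op τ s with
    | Op.meas _ => none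
    | Op.reset _ => none
    | Op.swap s' => wire (τ + 1) s' n
    | _ => wire (τ + 1) s n

/-- The atom at `s` right before layer `τ` is at `s'` right before layer `σ`, with `τ ≤ σ`. -/
def OnWire (τ : ℕ) (s : S) (σ : ℕ) (s' : S) : Prop := τ ≤ σ ∧ C.wire τ s (σ - τ) = some s'

/-- The role of the last operation before layer `σ` on the atom that is then at `s`. -/
def lastRole : ℕ → S → Option Basis
  | 0, _ => none
  | σ + 1, s =>
    match C.op σ s with
    | Op.swap s' => lastRole σ s'
    | Op.nop => lastRole σ s
    | Op.idle => lastRole σ s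
    | o => o.role

/-- The atom at `s` changes its role right before layer `σ`. -/
def RoleChange (σ : ℕ) (s : S) : Prop :=
  ∃ b b', (C.op σ s).role = some b ∧ C.lastRole σ s = some b' ∧ b ≠ b'

/-- The relevant locations of an atom loss: the loss location itself, each subsequent Hadamard
gate, i.e. change of role, of the lost atom, and just before its measurement. -/
def Relevant (ℓ : C.LossLoc) (σ : ℕ) (s : S) : Prop :=
  C.OnWire (ℓ.1.1 + 1) ℓ.1.2 σ s ∧
    (σ = ℓ.1.1 + 1 ∨ C.RoleChange σ s ∨ (C.op σ s).isMeas = true)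

/-- The Pauli envelope of a single atom loss: arbitrary Paulis at the relevant locations. -/
def lossEnvelope (ℓ : C.LossLoc) : Set (Config S) :=
  {e | ∀ σ s, e σ s ≠ 0 → C.Relevant ℓ σ s}

/-- The atom lost at `ℓ` is the one that the measurement `m` finds lost. -/
def Detects (ℓ : C.LossLoc) (m : C.Meas) : Prop :=
  C.OnWire (ℓ.1.1 + 1) ℓ.1.2 m.1.1 m.1.2

/-- The Pauli envelope of a single lost atom: the union over all locations of its loss. -/
def atomEnvelope (m : C.Meas) : Set (Config S) :=
  {e | ∃ ℓ, C.Detects ℓ m ∧ e ∈ C.lossEnvelope ℓ}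

/-- The Pauli envelope of a set of lost atoms: all compositions of single-atom envelopes. -/
def envelope (R : Finset C.Meas) : Set (Config S) :=
  {e | ∃ f : C.Meas → Config S, (∀ m ∈ R, f m ∈ C.atomEnvelope m) ∧ e = ∑ m ∈ R, f m}

/-- The detector-observable pairs that the loss of the atom `m` can trigger. -/
def patterns (m : C.Meas) : Set (Outcome D) := C.outcome '' C.atomEnvelope m

/-! ## The Envelope-MLE decoder for faulty loss-resolving readout -/

/-- A value of the binary variables of the integer program: `x m` is the set of patterns `j` of the
atom `m` with `x_{m,j} = 1`, and `y` is the set of Pauli mechanisms `i` with `y_i = 1`. -/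
structure Assignment where
  x : C.Meas → Finset (Outcome D)
  y : Finset C.Mechanism

section Decoder

variable {C} [Fintype S] [DecidableEq S]

/-- The detector-observable pair that an assignment explains. -/
def Assignment.outcome (a : C.Assignment) : Outcome D :=
  ∑ i ∈ a.y, C.outcome (C.faultConfig i.1.1 i.1.2) + ∑ m, ∑ j ∈ a.x m, j

/-- The constraints, for observed detector values `D₀` and loss-resolving readout `r` (the set of
the atoms reported as lost): exactly one pattern for an atom reported as lost, at most one
pattern (the relaxed constraint) for any other atom, and all detectors are explained. -/
def Assignment.Feasible (a : C.Assignment) (D₀ : D → ZMod 2) (r : Finset C.Meas) : Prop :=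
  (∀ m, (a.x m : Set (Outcome D)) ⊆ C.patterns m) ∧
  (∀ m ∈ r, (a.x m).card = 1) ∧
  (∀ m ∉ r, (a.x m).card ≤ 1) ∧
  a.outcome.1 = D₀

/-- The objective: weight `w` per Pauli error, and the penalty `w * ∑ j, x_{m,j}` for every atom
`m` that is not reported as lost. -/
def Assignment.cost (a : C.Assignment) (w : ℝ) (r : Finset C.Meas) : ℝ :=
  w * a.y.card + ∑ m ∈ rᶜ, w * (a.x m).card

variable (C)

/-- `Dec` is an Envelope-MLE decoder modified for faulty loss-resolving readout: it predicts the
observable of an optimal solution of the integer program. -/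
def IsEnvelopeMLE (w : ℝ) (Dec : (D → ZMod 2) → Finset C.Meas → ZMod 2) : Prop :=
  ∀ D₀ r, (∃ a : C.Assignment, a.Feasible D₀ r) →
    ∃ a : C.Assignment, a.Feasible D₀ r ∧
      (∀ a' : C.Assignment, a'.Feasible D₀ r → a.cost w r ≤ a'.cost w r) ∧
      Dec D₀ r = a.outcome.2

/-! ## Failure and failure probability -/

open Classical in
/-- The atoms lost in a loss configuration, i.e. its ideal loss-resolving readout. -/
noncomputable def lostAtoms (l : Finset C.LossLoc) : Finset C.Meas :=
  Finset.univ.filter fun m => ∃ ℓ ∈ l, C.Detects ℓ m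

/-- Failure for Pauli faults `p`, losses `l` and reported readout `r`: the prediction is wrong for
some error in the Pauli envelope of all atoms which are lost or reported as lost. -/
def Fails (Dec : (D → ZMod 2) → Finset C.Meas → ZMod 2) (p : C.PauliLoc → Pauli × Pauli)
    (l : Finset C.LossLoc) (r : Finset C.Meas) : Prop :=
  ∃ e ∈ C.envelope (C.lostAtoms l ∪ r),
    Dec (C.syndrome (C.pauliConfig p + e)) r ≠ C.observable (C.pauliConfig p + e)

/-- The number of Pauli faults. -/
def numPauli (p : C.PauliLoc → Pauli × Pauli) : ℕ := (Finset.univ.filter fun ℓ => p ℓ ≠ 0).card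

noncomputable def pauliProb (q : ℝ) (p : C.PauliLoc → Pauli × Pauli) : ℝ :=
  ∏ ℓ, (C.op ℓ.1.1 ℓ.1.2).faultProb q (p ℓ)

noncomputable def lossProb (q : ℝ) (l : Finset C.LossLoc) : ℝ :=
  ∏ ℓ, if ℓ ∈ l then q else 1 - q

/-- The probability of the readout `r` if the atoms `R` are lost: every readout bit, of a lost atom
(false negative) or of a present atom (false positive), is wrong with probability `q`. -/
noncomputable def readoutProb (q : ℝ) (R r : Finset C.Meas) : ℝ :=
  ∏ m, if (m ∈ R ↔ m ∈ r) then 1 - q else q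

open Classical in
/-- The failure probability with Pauli envelope, for independent depolarizing faults of rate
`ppauli`, independent losses of rate `ploss`, and readout errors of rate `ploss`. -/
noncomputable def failProb (Dec : (D → ZMod 2) → Finset C.Meas → ZMod 2) (ploss ppauli : ℝ) : ℝ :=
  ∑ p : C.PauliLoc → Pauli × Pauli, ∑ l : Finset C.LossLoc, ∑ r : Finset C.Meas,
    C.pauliProb ppauli p * C.lossProb ploss l * C.readoutProb ploss (C.lostAtoms l) r *
      if C.Fails Dec p l r then 1 else 0

end Decoder

end Experiment

/-! ## Mid-SWAP syndrome extraction for the rotated surface code -/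

/-- Data qubits, by row (from north to south) and column (from west to east). -/
abbrev Data (d : ℕ) := Fin d × Fin d

/-- Ancilla sites.  The plaquette `(i, j)` has the data qubits `(i - 1, j - 1)`, `(i - 1, j)`,
`(i, j - 1)` and `(i, j)`, as far as they exist. -/
abbrev Plaq (d : ℕ) := Fin (d + 1) × Fin (d + 1)

abbrev Site (d : ℕ) := Data d ⊕ Plaq d

/-- Corners of a plaquette: (is it south?, is it east?). -/
abbrev Corner := Bool × Bool

variable {d : ℕ}

/-- The plaquettes form a checkerboard of `X`- and `Z`-stabilizers. -/
def Plaq.type (P : Plaq d) : Basis :=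
  if (P.1.val + P.2.val) % 2 = 0 then Basis.Z else Basis.X

/-- The plaquettes which carry a stabilizer: all in the bulk, the `X`-type ones on the north and
south boundaries, and the `Z`-type ones on the west and east boundaries. -/
def Plaq.IsStab (P : Plaq d) : Prop :=
  (0 < P.1.val ∧ P.1.val < d ∧ 0 < P.2.val ∧ P.2.val < d) ∨
  ((P.1.val = 0 ∨ P.1.val = d) ∧ 0 < P.2.val ∧ P.2.val < d ∧ P.type = Basis.X) ∨
  ((P.2.val = 0 ∨ P.2.val = d) ∧ 0 < P.1.val ∧ P.1.val < d ∧ P.type = Basis.Z)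

instance (P : Plaq d) : Decidable P.IsStab := by
  unfold Plaq.IsStab
  infer_instance

def plaqCoord (a : Fin d) (far : Bool) : Fin (d + 1) := if far then a.castSucc else a.succ

/-- The plaquette of which `q` is the corner `c`. -/
def Data.plaq (q : Data d) (c : Corner) : Plaq d := (plaqCoord q.1 c.1, plaqCoord q.2 c.2)

def dataCoord (i : Fin (d + 1)) (far : Bool) : Option (Fin d) :=
  if far then
    if h : i.val < d then some ⟨i.val, h⟩ else none
  else
    if h : 0 < i.val then some ⟨i.val - 1, by omega⟩ else none

/-- The data qubit at the corner `c` of `P`, if it exists. -/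
def Plaq.corner (P : Plaq d) (c : Corner) : Option (Data d) :=
  (dataCoord P.1 c.1).bind fun a => (dataCoord P.2 c.2).map fun b => (a, b)

/-- The data qubits of a stabilizer. -/
def Plaq.support (P : Plaq d) : Finset (Data d) :=
  Finset.univ.filter fun q => ∃ c, q.plaq c = P

/-- The corner at which stabilizers of type `b` interact in CNOT layer `t ∈ {0, 1, 2, 3}` of round
`k`.  In even rounds: NW, SW, NE, SE for type `Z` and NW, NE, SW, SE for type `X`.  In odd rounds
the order is reversed, so that every boundary data atom is replenished too. -/
def order (k : ℕ) (b : Basis) (t : ℕ) : Corner :=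
  let lo : Bool := decide (t % 2 = 1) ^^ decide (k % 2 = 1)
  let hi : Bool := decide (t / 2 = 1) ^^ decide (k % 2 = 1)
  match b with
  | Basis.Z => (lo, hi)
  | Basis.X => (hi, lo)

/-- CNOT layer `t` of round `k`: the ancilla of an `X`-stabilizer is the control, and that of a
`Z`-stabilizer is the target. -/
def cnotLayer (k t : ℕ) : Site d → Op (Site d)
  | Sum.inl q =>
    if (q.plaq (order k Basis.X t)).IsStab ∧ (q.plaq (order k Basis.X t)).type = Basis.X then
      Op.targ (Sum.inr (q.plaq (order k Basis.X t)))
    else if (q.plaq (order k Basis.Z t)).IsStab ∧ (q.plaq (order k Basis.Z t)).type = Basis.Z then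
      Op.ctrl (Sum.inr (q.plaq (order k Basis.Z t)))
    else Op.idle
  | Sum.inr P =>
    if P.IsStab then
      match P.corner (order k P.type t) with
      | none => Op.idle
      | some q =>
        match P.type with
        | Basis.X => Op.ctrl (Sum.inl q)
        | Basis.Z => Op.targ (Sum.inl q)
    else Op.nop

/-- The shuttling step after the first CNOT layer of round `k`: every ancilla atom changes places
with the data atom that it has just interacted with. -/
def swapLayer (k : ℕ) : Site d → Op (Site d)
  | Sum.inl q =>
    if (q.plaq (order k Basis.X 0)).IsStab then Op.swap (Sum.inr (q.plaq (order k Basis.X 0)))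
    else Op.nop
  | Sum.inr P =>
    if P.IsStab then
      match P.corner (order k P.type 0) with
      | none => Op.nop
      | some q => Op.swap (Sum.inl q)
    else Op.nop

/-- An operation on all ancillas, by type of stabilizer, while the data qubits idle. -/
def ancillaLayer (f : Basis → Op (Site d)) : Site d → Op (Site d)
  | Sum.inl _ => Op.idle
  | Sum.inr P => if P.IsStab then f P.type else Op.nop

/-- An operation on all data qubits, when there are no ancilla atoms. -/
def dataLayer (o : Op (Site d)) : Site d → Op (Site d)
  | Sum.inl _ => o
  | Sum.inr _ => Op.nop

/-- Layer `i ∈ {0, …, 6}` of round `k`: ancilla reset, first CNOT layer, shuttling, the remaining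
three CNOT layers, ancilla measurement. -/
def roundLayer (k i : ℕ) : Site d → Op (Site d) :=
  match i with
  | 0 => ancillaLayer Op.reset
  | 1 => cnotLayer k 0
  | 2 => swapLayer k
  | 3 => cnotLayer k 1
  | 4 => cnotLayer k 2
  | 5 => cnotLayer k 3
  | _ => ancillaLayer Op.meas

/-- The northernmost row, which supports the logical `Z`, or the westernmost column, which supports
the logical `X`. -/
def logicalSupport (d : ℕ) : Basis → Finset (Data d)
  | Basis.Z => Finset.univ.filter fun q => q.1.val = 0
  | Basis.X => Finset.univ.filter fun q => q.2.val = 0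

/-- The layer in which round `k` measures the ancillas. -/
def measTime (k : ℕ) : ℕ := 7 * k + 7

/-- The memory experiment in basis `b` with `T` rounds of Mid-SWAP syndrome extraction: reset of all
data qubits, `T` rounds, measurement of all data qubits.  The detectors compare consecutive
measurements of a stabilizer; stabilizers of type `b` are moreover compared with their initial value
and with the final data measurement.  The observable is the logical
operator of type `b`. -/
def midSwap (d T : ℕ) (b : Basis) : Experiment (Site d) (Fin (T + 1) × Plaq d) where
  depth := 7 * T + 2
  op τ :=
    if τ = 0 then dataLayer (Op.reset b)
    else if τ ≤ 7 * T then roundLayer ((τ - 1) / 7) ((τ - 1) % 7)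
    else if τ = 7 * T + 1 then dataLayer (Op.meas b)
    else fun _ => Op.nop
  det i :=
    if i.2.IsStab then
      if i.1.val = 0 then
        if i.2.type = b then {(measTime 0, Sum.inr i.2)} else ∅
      else if i.1.val < T then
        {(measTime (i.1.val - 1), Sum.inr i.2), (measTime i.1.val, Sum.inr i.2)}
      else
        if i.2.type = b then
          insert (measTime (T - 1), Sum.inr i.2)
            (i.2.support.image fun q => (7 * T + 1, Sum.inl q))
        else ∅
    else ∅
  obs :=
    (logicalSupport d b).image fun q => (7 * T + 1, Sum.inl q)

end AtomLoss

namespace AtomLoss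

/-! ## Linearity of frames and outcomes -/

/-! Everything is linear over `ZMod 2`, so functionals of the final Pauli frame can be pulled back
through the circuit (`sum_frame`). A data operator `w` that commutes with all stabilizers of the
type other than `b` has an explicit pulled-back sensitivity at every space-time point (`pull_sens`),
which defines the functional `pairing`. For the logical operator, `pairing` is the observable; for a
stabilizer of type `b`, it is the sum over time of its detectors. So an undetected logical flip
pairs to 0 with the stabilizers of type `b` and to 1 with the logical operator.

Distance: against such `w`, every single Pauli fault acts as a `Narrow` data operator. The support
of such an operator may be arbitrary within one row, and in different rows it sits only on a
diagonal of a plaquette of the other type. The same holds for the sum of two errors from the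
envelope of one atom (`thin_atoms`). An atom that ends as an ancilla of the other type affects only
the first corner before the second CNOT, and later only the corners 2 and 3 together or corner 3
alone. Since its role does not change between these CNOTs, one loss sees only one of these three
possibilities, and the sum of any two is narrow up to the stabilizer relation. In `card_of_rowSum`,
prefix sums along the rows show that no narrow operator can account for the jumps chosen in two
different rows, so a logical flip needs `d` of them.

Decoder: a node is a Pauli location or an atom. The actual faults and the optimal solution together
produce an undetected logical flip. Take a minimal set `W` of nodes that does so. The solution may
be exchanged for the actual faults on `W`, so by optimality its cost on `W` is at most the actual
cost. Every node of `W` has actual cost, decoder cost or a loss report, hence `W.card` is at most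
twice the actual cost plus the number of reports (`card_le_weight`). With `d ≤ W.card` this is the
failure condition.

Probability: minimality makes `W` linked by common detectors. Detectors are local and atoms live for
a bounded time, so `W` is a connected set in a graph of bounded degree, and such sets are
exponentially few (`sum_linked_le`). For fixed `W`, the exponential moment `sum_pow_weight_le` with
base `1 / max ploss √ppauli` bounds the probability that the weight reaches `W.card`. A union bound
(`failProb_le_sum`) finishes the proof. -/

/-- The component of a Pauli operator that flips a measurement in the basis `β`. -/
def Basis.comp (β : Basis) : Pauli →+ ZMod 2 :=
  match β with
  | Basis.Z => AddMonoidHom.fst _ _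
  | Basis.X => AddMonoidHom.snd _ _

@[simp] theorem Basis.comp_Z (v : Pauli) : Basis.Z.comp v = v.1 := rfl
@[simp] theorem Basis.comp_X (v : Pauli) : Basis.X.comp v = v.2 := rfl

theorem zmod2_self_add (a : ZMod 2) : a + a = 0 := CharTwo.add_self_eq_zero a

theorem zmod2_cases (a : ZMod 2) : a = 0 ∨ a = 1 := by
  revert a; decide

namespace Op

variable {S : Type}

theorem propagate_add (o : S → Op S) (F G : S → Pauli) (s : S) :
    propagate o (F + G) s = propagate o F s + propagate o G s := by
  unfold propagate
  cases o s <;> simp [Prod.ext_iff] <;> ring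

theorem propagate_zero (o : S → Op S) (s : S) : propagate o 0 s = 0 := by
  unfold propagate
  cases o s <;> simp

end Op

namespace Experiment

variable {S D : Type} (C : Experiment S D)

theorem frame_add (e e' : Config S) (τ : ℕ) : C.frame (e + e') τ = C.frame e τ + C.frame e' τ := by
  induction τ with
  | zero => rfl
  | succ τ ih =>
    funext s
    simp only [frame, ih, Op.propagate_add, Pi.add_apply]
    abel

theorem frame_zero (τ : ℕ) : C.frame 0 τ = 0 := by
  induction τ with
  | zero => rfl
  | succ τ ih =>
    funext s
    simp [frame, ih, Op.propagate_zero]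

theorem flip_eq (e : Config S) (τ : ℕ) (s : S) (β : Basis) (h : C.op τ s = Op.meas β) :
    C.flip e τ s = β.comp (C.frame e τ s) := by
  unfold flip
  rw [h]
  cases β <;> rfl

theorem flip_add (e e' : Config S) (τ : ℕ) (s : S) :
    C.flip (e + e') τ s = C.flip e τ s + C.flip e' τ s := by
  unfold flip
  rw [frame_add]
  split <;> simp

theorem flip_zero (τ : ℕ) (s : S) : C.flip 0 τ s = 0 := by
  unfold flip
  rw [frame_zero]
  split <;> simp

/-- The outcome as a linear function of the Pauli error. -/
def outcomeHom : Config S →+ Outcome D where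
  toFun := C.outcome
  map_zero' := by
    simp only [outcome, Prod.ext_iff]
    constructor
    · funext i; simp [syndrome, flip_zero]
    · simp [observable, flip_zero]
  map_add' e e' := by
    simp only [outcome, Prod.ext_iff]
    constructor
    · funext i; simp [syndrome, flip_add, Finset.sum_add_distrib]
    · simp [observable, flip_add, Finset.sum_add_distrib]

theorem outcomeHom_apply (e : Config S) : C.outcomeHom e = C.outcome e := rfl

end Experiment

/-! ## Backward propagation -/

namespace Op

variable {S : Type}

/-- The transpose of `propagate` on the component that flips measurements in the basis `β`. -/
def pull (β : Basis) (o : S → Op S) (ρ : S → ZMod 2) (s : S) : ZMod 2 :=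
  match o s with
  | reset _ => 0
  | meas _ => 0
  | swap s' => ρ s'
  | ctrl t => if β = Basis.Z then ρ s + ρ t else ρ s
  | targ c => if β = Basis.X then ρ s + ρ c else ρ s
  | nop => ρ s
  | idle => ρ s

/-- The site which interacts with `s`, or `s` itself. -/
def partner (o : S → Op S) (s : S) : S :=
  match o s with
  | swap s' => s'
  | ctrl t => t
  | targ c => c
  | _ => s

/-- Both sites of every two-site operation agree about it. -/
structure Consistent (o : S → Op S) : Prop where
  ctrl : ∀ s t, o s = Op.ctrl t → o t = Op.targ s
  targ : ∀ s t, o s = Op.targ t → o t = Op.ctrl s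
  swap : ∀ s t, o s = Op.swap t → o t = Op.swap s

theorem Consistent.partner_involutive {o : S → Op S} (h : Consistent o) :
    Function.Involutive (partner o) := by
  intro s
  unfold partner
  cases hs : o s with
  | nop => simp [hs]
  | idle => simp [hs]
  | reset _ => simp [hs]
  | meas _ => simp [hs]
  | ctrl t => simp [h.ctrl s t hs]
  | targ t => simp [h.targ s t hs]
  | swap t => simp [h.swap s t hs]

/-- The part of the propagated component that stays at its site. -/
def keep (β : Basis) (o : S → Op S) (ρ : S → ZMod 2) (F : S → Pauli) (s : S) : ZMod 2 :=
  match o s with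
  | reset _ => 0
  | meas _ => 0
  | swap _ => 0
  | _ => ρ s * β.comp (F s)

/-- The part of the propagated component that moves to `s` from its partner. -/
def receive (β : Basis) (o : S → Op S) (ρ : S → ZMod 2) (F : S → Pauli) (s : S) : ZMod 2 :=
  match o s with
  | swap s' => ρ s * β.comp (F s')
  | ctrl t => if β = Basis.X then ρ s * β.comp (F t) else 0
  | targ c => if β = Basis.Z then ρ s * β.comp (F c) else 0
  | _ => 0

/-- What a layer outputs at a site is a kept part plus a part received from the partner. Reindexing
the received parts by the involution `partner` turns them into parts sent out, which is how `pull`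
counts them. -/
theorem sum_pull [Fintype S] {o : S → Op S} (h : Consistent o) (β : Basis) (ρ : S → ZMod 2)
    (F : S → Pauli) :
    ∑ s, ρ s * β.comp (propagate o F s) = ∑ s, pull β o ρ s * β.comp (F s) := by
  have h1 : ∀ s, ρ s * β.comp (propagate o F s) = keep β o ρ F s + receive β o ρ F s := by
    intro s
    unfold propagate keep receive
    cases o s <;> cases β <;> simp <;> ring
  have h2 : ∀ s, pull β o ρ s * β.comp (F s) = keep β o ρ F s + receive β o ρ F (partner o s) := by
    intro s
    unfold pull keep receive partner
    cases hs : o s with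
    | nop => simp [hs]
    | idle => simp [hs]
    | reset _ => simp [hs]
    | meas _ => simp [hs]
    | ctrl t => simp only [h.ctrl s t hs]; cases β <;> simp; ring
    | targ t => simp only [h.targ s t hs]; cases β <;> simp; ring
    | swap t => simp only [h.swap s t hs]; simp
  simp only [h1, h2, Finset.sum_add_distrib]
  congr 1
  exact (Equiv.sum_comp h.partner_involutive.toPerm (receive β o ρ F)).symm

end Op

namespace Experiment

variable {S D : Type} [Fintype S] (C : Experiment S D)

/-- A functional of the frame before layer `n`, read as a functional of the Pauli error. -/
theorem sum_frame {m n : ℕ} (hmn : m ≤ n) (β : Basis) (ρ : ℕ → S → ZMod 2)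
    (hc : ∀ τ, m ≤ τ → τ < n → Op.Consistent (C.op τ))
    (hρ : ∀ τ, m ≤ τ → τ < n → Op.pull β (C.op τ) (ρ (τ + 1)) = ρ τ) (e : Config S) :
    ∑ s, ρ n s * β.comp (C.frame e n s) =
      ∑ s, ρ m s * β.comp (C.frame e m s) +
        ∑ τ ∈ Finset.Ioc m n, ∑ s, ρ τ s * β.comp (e τ s) := by
  induction n, hmn using Nat.le_induction with
  | base => simp
  | succ n hmn ih =>
    rw [← Finset.insert_Ioc_right_eq_Ioc_add_one hmn, Finset.sum_insert (by simp)]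
    simp only [frame, map_add, mul_add, Finset.sum_add_distrib]
    rw [Op.sum_pull (hc n hmn (by omega)), hρ n hmn (by omega),
      ih (fun τ h h' => hc τ h (by omega)) (fun τ h h' => hρ τ h (by omega))]
    ring

end Experiment

end AtomLoss

namespace AtomLoss

variable {d : ℕ}

/-! ## Geometry of the interactions -/

theorem dataCoord_eq_some {i : Fin (d + 1)} {far : Bool} {a : Fin d} :
    dataCoord i far = some a ↔ plaqCoord a far = i := by
  unfold dataCoord plaqCoord
  cases far <;> simp only [Bool.false_eq_true, if_true, if_false]
  · constructor
    · intro h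
      split_ifs at h with h1
      simp only [Option.some.injEq] at h
      subst h
      ext; simp; omega
    · rintro rfl
      simp
  · constructor
    · intro h
      split_ifs at h with h1
      simp only [Option.some.injEq] at h
      subst h
      ext; simp
    · rintro rfl
      simp

theorem Plaq.corner_eq_some {P : Plaq d} {c : Corner} {q : Data d} :
    P.corner c = some q ↔ q.plaq c = P := by
  unfold Plaq.corner Data.plaq
  simp only [Option.bind_eq_some_iff, Option.map_eq_some_iff, dataCoord_eq_some]
  constructor
  · rintro ⟨a, ha, b, hb, rfl⟩
    exact Prod.ext ha hb
  · rintro rfl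
    exact ⟨_, rfl, _, rfl, rfl⟩

theorem plaqCoord_val (a : Fin d) (far : Bool) :
    (plaqCoord a far).val = a.val + (if far then 0 else 1) := by
  unfold plaqCoord
  cases far <;> simp

/-- The first component of the corner in layer `t` for stabilizers of type `Z`. -/
def orderLo (k t : ℕ) : Bool := decide (t % 2 = 1) ^^ decide (k % 2 = 1)

/-- The first component of the corner in layer `t` for stabilizers of type `X`. -/
def orderHi (k t : ℕ) : Bool := decide (t / 2 = 1) ^^ decide (k % 2 = 1)

theorem order_Z (k t : ℕ) : order k Basis.Z t = (orderLo k t, orderHi k t) := rfl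

theorem order_X (k t : ℕ) : order k Basis.X t = (orderHi k t, orderLo k t) := rfl

/-- The two orders differ by exchanging the coordinates of the corner, which preserves the parity of
the coordinate sum. So of the two candidate partners of a data qubit, exactly one has the type it is
a candidate for: the schedule has no collisions, and `meet` captures the interaction. -/
theorem type_plaq_order (k t : ℕ) (q : Data d) :
    (q.plaq (order k Basis.X t)).type = (q.plaq (order k Basis.Z t)).type := by
  unfold Plaq.type Data.plaq
  simp only [order_X, order_Z, plaqCoord_val]
  congr 2
  generalize (if orderHi k t = true then 0 else 1) = x
  generalize (if orderLo k t = true then 0 else 1) = y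
  omega

/-- Both types start at the same corner, so `swapLayer` can find the partner of a data qubit from
the `X` order alone. This corner alternates between NW and SE from round to round. -/
theorem order_zero (k : ℕ) (β : Basis) : order k β 0 = (decide (k % 2 = 1), decide (k % 2 = 1)) := by
  cases β <;> simp [order]

/-- The type of the plaquette with which the data qubit `q` interacts in layer `t` of round `k`. -/
def meetType (k t : ℕ) (q : Data d) : Basis := (q.plaq (order k Basis.X t)).type

/-- The plaquette with which the data qubit `q` interacts in layer `t` of round `k`. -/
def meet (k t : ℕ) (q : Data d) : Plaq d := q.plaq (order k (meetType k t q) t)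

/-- The data qubit with which the plaquette `P` interacts in layer `t` of round `k`. -/
def cor (k t : ℕ) (P : Plaq d) : Option (Data d) := P.corner (order k P.type t)

theorem type_meet (k t : ℕ) (q : Data d) : (meet k t q).type = meetType k t q := by
  unfold meet
  cases h : meetType k t q
  · exact h
  · rw [← type_plaq_order]; exact h

theorem cor_eq_some {k t : ℕ} {P : Plaq d} {q : Data d} : cor k t P = some q ↔ meet k t q = P := by
  unfold cor
  rw [Plaq.corner_eq_some]
  constructor
  · intro h
    have : meetType k t q = P.type := by
      unfold meetType
      rw [← h]
      cases hP : P.type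
      · rw [hP] at h
      · rw [hP] at h; rw [type_plaq_order, h, hP]
    unfold meet
    rw [this, h]
  · intro h
    rw [← h, type_meet]
    rfl

theorem cor_meet (k t : ℕ) (q : Data d) : cor k t (meet k t q) = some q := cor_eq_some.2 rfl

theorem cnotLayer_data (k t : ℕ) (q : Data d) :
    cnotLayer k t (Sum.inl q) =
      if (meet k t q).IsStab then
        match (meet k t q).type with
        | Basis.X => Op.targ (Sum.inr (meet k t q))
        | Basis.Z => Op.ctrl (Sum.inr (meet k t q))
      else Op.idle := by
  unfold cnotLayer
  simp only
  rw [← type_plaq_order k t q, show (q.plaq (order k Basis.X t)).type = meetType k t q from rfl,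
    type_meet]
  unfold meet
  cases h : meetType k t q <;> simp

theorem cnotLayer_anc (k t : ℕ) (P : Plaq d) :
    cnotLayer k t (Sum.inr P) =
      if P.IsStab then
        match cor k t P with
        | none => Op.idle
        | some q =>
          match P.type with
          | Basis.X => Op.ctrl (Sum.inl q)
          | Basis.Z => Op.targ (Sum.inl q)
      else Op.nop := rfl

theorem swapLayer_data (k : ℕ) (q : Data d) :
    swapLayer k (Sum.inl q) =
      if (meet k 0 q).IsStab then Op.swap (Sum.inr (meet k 0 q)) else Op.nop := by
  unfold swapLayer
  simp only
  have : q.plaq (order k Basis.X 0) = meet k 0 q := by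
    unfold meet
    rw [order_zero, order_zero]
  rw [this]

theorem swapLayer_anc (k : ℕ) (P : Plaq d) :
    swapLayer k (Sum.inr P) =
      if P.IsStab then
        match cor k 0 P with
        | none => Op.nop
        | some q => Op.swap (Sum.inl q)
      else Op.nop := rfl

theorem cnotLayer_consistent (k t : ℕ) : Op.Consistent (cnotLayer (d := d) k t) := by
  constructor
  · rintro (q | P) s h
    · rw [cnotLayer_data] at h
      split_ifs at h with h1
      cases hty : (meet k t q).type <;> simp only [hty] at h <;> cases h
      rw [cnotLayer_anc, if_pos h1, cor_meet]
      simp [hty]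
    · rw [cnotLayer_anc] at h
      split_ifs at h with h1
      cases hc : cor k t P with
      | none => simp [hc] at h
      | some q =>
        have hm := cor_eq_some.1 hc
        cases hty : P.type <;> simp only [hty, hc] at h <;> cases h
        rw [cnotLayer_data, hm, if_pos h1, hty]
  · rintro (q | P) s h
    · rw [cnotLayer_data] at h
      split_ifs at h with h1
      cases hty : (meet k t q).type <;> simp only [hty] at h <;> cases h
      rw [cnotLayer_anc, if_pos h1, cor_meet]
      simp [hty]
    · rw [cnotLayer_anc] at h
      split_ifs at h with h1
      cases hc : cor k t P with
      | none => simp [hc] at h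
      | some q =>
        have hm := cor_eq_some.1 hc
        cases hty : P.type <;> simp only [hty, hc] at h <;> cases h
        rw [cnotLayer_data, hm, if_pos h1, hty]
  · rintro (q | P) s h
    · rw [cnotLayer_data] at h
      split_ifs at h with h1
      cases hty : (meet k t q).type <;> simp only [hty] at h <;> cases h
    · rw [cnotLayer_anc] at h
      split_ifs at h with h1
      cases hc : cor k t P with
      | none => simp [hc] at h
      | some q => cases hty : P.type <;> simp only [hty, hc] at h <;> cases h

theorem swapLayer_consistent (k : ℕ) : Op.Consistent (swapLayer (d := d) k) := by
  constructor
  · rintro (q | P) s h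
    · rw [swapLayer_data] at h
      split_ifs at h
    · rw [swapLayer_anc] at h
      split_ifs at h
      cases hc : cor k 0 P <;> simp [hc] at h
  · rintro (q | P) s h
    · rw [swapLayer_data] at h
      split_ifs at h
    · rw [swapLayer_anc] at h
      split_ifs at h
      cases hc : cor k 0 P <;> simp [hc] at h
  · rintro (q | P) s h
    · rw [swapLayer_data] at h
      split_ifs at h with h1
      cases h
      rw [swapLayer_anc, if_pos h1, cor_meet]
    · rw [swapLayer_anc] at h
      split_ifs at h with h1
      cases hc : cor k 0 P with
      | none => simp [hc] at h
      | some q =>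
        simp only [hc] at h
        cases h
        rw [swapLayer_data, cor_eq_some.1 hc, if_pos h1]

theorem ancillaLayer_reset_consistent : Op.Consistent (ancillaLayer (d := d) Op.reset) := by
  constructor <;> rintro (q | P) s h <;> simp only [ancillaLayer] at h <;>
    first | cases h | split_ifs at h

theorem ancillaLayer_meas_consistent : Op.Consistent (ancillaLayer (d := d) Op.meas) := by
  constructor <;> rintro (q | P) s h <;> simp only [ancillaLayer] at h <;>
    first | cases h | split_ifs at h

theorem roundLayer_consistent (k i : ℕ) : Op.Consistent (roundLayer (d := d) k i) := by
  unfold roundLayer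
  split
  · exact ancillaLayer_reset_consistent
  · exact cnotLayer_consistent _ _
  · exact swapLayer_consistent _
  · exact cnotLayer_consistent _ _
  · exact cnotLayer_consistent _ _
  · exact cnotLayer_consistent _ _
  · exact ancillaLayer_meas_consistent

theorem dataLayer_reset_consistent (b : Basis) :
    Op.Consistent (dataLayer (d := d) (Op.reset b)) := by
  constructor <;> rintro (q | P) s h <;> simp only [dataLayer] at h <;> cases h

theorem dataLayer_meas_consistent (b : Basis) :
    Op.Consistent (dataLayer (d := d) (Op.meas b)) := by
  constructor <;> rintro (q | P) s h <;> simp only [dataLayer] at h <;> cases h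

/-! ## Layers of the memory experiment -/

section

variable {T : ℕ} {b : Basis}

theorem midSwap_op_zero : (midSwap d T b).op 0 = dataLayer (Op.reset b) := rfl

/-- The shift by one is the initial reset in layer 0; ancillas are measured at `i = 6`, which is
`measTime k`. -/
theorem midSwap_op_round {k i : ℕ} (hk : k < T) (hi : i < 7) :
    (midSwap d T b).op (7 * k + 1 + i) = roundLayer k i := by
  unfold midSwap
  simp only
  rw [if_neg (by omega), if_pos (by omega)]
  congr 1 <;> omega

theorem midSwap_op_final : (midSwap d T b).op (7 * T + 1) = dataLayer (Op.meas b) := by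
  unfold midSwap
  simp

theorem midSwap_depth : (midSwap d T b).depth = 7 * T + 2 := rfl

/-- Every layer is the initial reset, a layer of a round, the final measurement, or void. -/
theorem time_cases (T τ : ℕ) : τ = 0 ∨ (∃ k i, k < T ∧ i < 7 ∧ τ = 7 * k + 1 + i) ∨
    τ = 7 * T + 1 ∨ 7 * T + 1 < τ := by
  by_cases h0 : τ = 0
  · exact Or.inl h0
  by_cases h1 : τ ≤ 7 * T
  · exact Or.inr (Or.inl ⟨(τ - 1) / 7, (τ - 1) % 7, by omega, by omega, by omega⟩)
  · omega

theorem midSwap_op_void {τ : ℕ} (h : 7 * T + 1 < τ) (s : Site d) :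
    (midSwap d T b).op τ s = Op.nop := by
  unfold midSwap
  simp only
  rw [if_neg (by omega), if_neg (by omega), if_neg (by omega)]

theorem midSwap_consistent (τ : ℕ) : Op.Consistent ((midSwap d T b).op τ) := by
  rcases time_cases T τ with rfl | ⟨k, i, hk, hi, rfl⟩ | rfl | h
  · exact dataLayer_reset_consistent b
  · rw [midSwap_op_round hk hi]; exact roundLayer_consistent k i
  · rw [midSwap_op_final]; exact dataLayer_meas_consistent b
  · constructor <;> intro s t h' <;> rw [midSwap_op_void h] at h' <;> cases h'

end

/-! ## Backward propagation through the layers -/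

/-- A weight on data qubits, read at a data qubit that may be missing. -/
def optVal (f : Data d → ZMod 2) (o : Option (Data d)) : ZMod 2 := o.elim 0 f

@[simp] theorem optVal_none (f : Data d → ZMod 2) : optVal f none = 0 := rfl
@[simp] theorem optVal_some (f : Data d → ZMod 2) (q : Data d) : optVal f (some q) = f q := rfl

theorem pull_cnot_data (β : Basis) (k t : ℕ) (ρ : Site d → ZMod 2) (q : Data d) :
    Op.pull β (cnotLayer k t) ρ (Sum.inl q) = ρ (Sum.inl q) +
      if (meet k t q).IsStab ∧ (meet k t q).type = β then ρ (Sum.inr (meet k t q)) else 0 := by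
  unfold Op.pull
  rw [cnotLayer_data]
  by_cases h : (meet k t q).IsStab
  · cases hty : (meet k t q).type <;> cases β <;> simp [h]
  · simp [h]

theorem pull_cnot_anc (β : Basis) (k t : ℕ) (ρ : Site d → ZMod 2) (P : Plaq d) :
    Op.pull β (cnotLayer k t) ρ (Sum.inr P) = ρ (Sum.inr P) +
      if P.IsStab ∧ P.type ≠ β then optVal (fun q => ρ (Sum.inl q)) (cor k t P) else 0 := by
  unfold Op.pull
  rw [cnotLayer_anc]
  by_cases h : P.IsStab
  · cases hc : cor k t P with
    | none => simp [h]
    | some q => cases hty : P.type <;> cases β <;> simp [h]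
  · simp [h]

theorem pull_swap_data (β : Basis) (k : ℕ) (ρ : Site d → ZMod 2) (q : Data d) :
    Op.pull β (swapLayer k) ρ (Sum.inl q) =
      if (meet k 0 q).IsStab then ρ (Sum.inr (meet k 0 q)) else ρ (Sum.inl q) := by
  unfold Op.pull
  rw [swapLayer_data]
  by_cases h : (meet k 0 q).IsStab <;> simp [h]

theorem pull_swap_anc (β : Basis) (k : ℕ) (ρ : Site d → ZMod 2) (P : Plaq d) :
    Op.pull β (swapLayer k) ρ (Sum.inr P) =
      if P.IsStab then (cor k 0 P).elim (ρ (Sum.inr P)) (fun q => ρ (Sum.inl q))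
      else ρ (Sum.inr P) := by
  unfold Op.pull
  rw [swapLayer_anc]
  by_cases h : P.IsStab
  · cases hc : cor k 0 P <;> simp [h]
  · simp [h]

theorem pull_ancilla_data (β : Basis) (f : Basis → Op (Site d)) (ρ : Site d → ZMod 2)
    (q : Data d) : Op.pull β (ancillaLayer f) ρ (Sum.inl q) = ρ (Sum.inl q) := rfl

theorem pull_reset_anc (β : Basis) (ρ : Site d → ZMod 2) (P : Plaq d) :
    Op.pull β (ancillaLayer Op.reset) ρ (Sum.inr P) =
      if P.IsStab then 0 else ρ (Sum.inr P) := by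
  unfold Op.pull ancillaLayer
  by_cases h : P.IsStab <;> simp [h]

theorem pull_meas_anc (β : Basis) (ρ : Site d → ZMod 2) (P : Plaq d) :
    Op.pull β (ancillaLayer Op.meas) ρ (Sum.inr P) =
      if P.IsStab then 0 else ρ (Sum.inr P) := by
  unfold Op.pull ancillaLayer
  by_cases h : P.IsStab <;> simp [h]

end AtomLoss

namespace AtomLoss

variable {d : ℕ}

/-! ## The sensitivity of data operators to errors in the course of the experiment -/

/-- The weights of the operators on data qubits that commute with all stabilizers of type other
than `β`. -/
def Commutes (β : Basis) (w : Data d → ZMod 2) : Prop :=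
  ∀ (k : ℕ) (P : Plaq d), P.IsStab → P.type ≠ β →
    optVal w (cor k 0 P) + optVal w (cor k 1 P) + optVal w (cor k 2 P) + optVal w (cor k 3 P) = 0

/-- The sensitivity of the data operator `w` to errors at the site `s` right before layer `i` of
round `k`. -/
def sens (β : Basis) (w : Data d → ZMod 2) (k i : ℕ) : Site d → ZMod 2
  | Sum.inl q => if i = 2 ∧ (meet k 0 q).IsStab ∧ (meet k 0 q).type = β then 0 else w q
  | Sum.inr P =>
    if P.IsStab then
      match i with
      | 1 => if P.type = β then optVal w (cor k 0 P) else 0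
      | 2 => optVal w (cor k 0 P)
      | 3 => if P.type = β then 0 else optVal w (cor k 0 P)
      | 4 => if P.type = β then 0 else optVal w (cor k 2 P) + optVal w (cor k 3 P)
      | 5 => if P.type = β then 0 else optVal w (cor k 3 P)
      | _ => 0
    else 0

/-- Ancillas of type `β` only collect the relevant error component, while those of the other type
spread it to the data. After the shuttling step an ancilla of the other type still spreads to its
corners 1, 2 and 3; these together weigh as much as corner 0. -/
theorem pull_sens {β : Basis} {w : Data d → ZMod 2} (hw : Commutes β w) (k : ℕ) {i : ℕ}
    (hi : i < 7) : Op.pull β (roundLayer k i) (sens β w k (i + 1)) = sens β w k i := by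
  funext s
  interval_cases i <;> simp only [roundLayer]
  · rcases s with q | P
    · rw [pull_ancilla_data]; simp [sens]
    · rw [pull_reset_anc]; by_cases h : P.IsStab <;> simp [sens, h]
  · rcases s with q | P
    · rw [pull_cnot_data]
      by_cases h : (meet k 0 q).IsStab <;> by_cases h' : (meet k 0 q).type = β <;>
        simp [sens, h, h', cor_meet]
    · rw [pull_cnot_anc]
      by_cases h : P.IsStab <;> by_cases h' : P.type = β
      · simp [sens, h, h']
      · cases hc : cor k 0 P with
        | none => simp [sens, h, h', hc]
        -- An error on a fresh ancilla of the other type reaches both atoms of the first CNOT. One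
        -- becomes the data qubit and the other spreads to the remaining corners, with equal weights
        -- that cancel: the error has become a stabilizer.
        | some q => simp [sens, h, h', hc, cor_eq_some.1 hc, zmod2_self_add]
      · simp [sens, h, h']
      · simp [sens, h]
  · rcases s with q | P
    · rw [pull_swap_data]
      by_cases h : (meet k 0 q).IsStab <;> by_cases h' : (meet k 0 q).type = β <;>
        simp [sens, h, h', cor_meet]
    · rw [pull_swap_anc]
      by_cases h : P.IsStab
      · cases hc : cor k 0 P <;> by_cases h' : P.type = β <;> simp [sens, h, h', hc]
      · simp [sens, h]
  · rcases s with q | P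
    · rw [pull_cnot_data]
      by_cases h : (meet k 1 q).IsStab <;> by_cases h' : (meet k 1 q).type = β <;>
        simp [sens, h, h']
    · rw [pull_cnot_anc]
      by_cases h : P.IsStab
      · by_cases h' : P.type = β
        · simp [sens, h, h']
        -- The one place where `w` must commute with the stabilizers of the other type.
        · have := hw k P h h'
          simp only [sens, h, h', if_true, if_false, ne_eq, not_false_eq_true, true_and]
          norm_num
          have e : optVal (fun q => w q) (cor k 1 P) = optVal w (cor k 1 P) := rfl
          rw [e]
          generalize optVal w (cor k 0 P) = x0 at *
          generalize optVal w (cor k 1 P) = x1 at *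
          generalize optVal w (cor k 2 P) = x2 at *
          generalize optVal w (cor k 3 P) = x3 at *
          revert x0 x1 x2 x3
          decide
      · simp [sens, h]
  · rcases s with q | P
    · rw [pull_cnot_data]
      by_cases h : (meet k 2 q).IsStab <;> by_cases h' : (meet k 2 q).type = β <;>
        simp [sens, h, h']
    · rw [pull_cnot_anc]
      by_cases h : P.IsStab <;> by_cases h' : P.type = β <;> simp [sens, h, h', add_comm]
  · rcases s with q | P
    · rw [pull_cnot_data]
      by_cases h : (meet k 3 q).IsStab <;> by_cases h' : (meet k 3 q).type = β <;>
        simp [sens, h, h']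
    · rw [pull_cnot_anc]
      by_cases h : P.IsStab <;> by_cases h' : P.type = β <;> simp [sens, h, h']
  · rcases s with q | P
    · rw [pull_ancilla_data]; simp [sens]
    · rw [pull_meas_anc]; by_cases h : P.IsStab <;> simp [sens, h]

/-- The data operator itself, as a functional on all sites. -/
def onData (w : Data d → ZMod 2) : Site d → ZMod 2 := Sum.elim w (fun _ => 0)

theorem sens_zero (β : Basis) (w : Data d → ZMod 2) (k : ℕ) : sens β w k 0 = onData w := by
  funext s
  rcases s with q | P <;> simp [sens, onData]

theorem sens_seven (β : Basis) (w : Data d → ZMod 2) (k : ℕ) : sens β w k 7 = onData w := by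
  funext s
  rcases s with q | P <;> simp [sens, onData]

/-- The sensitivity of `w` to errors right before layer `τ`. -/
def sensAt (β : Basis) (w : Data d → ZMod 2) (τ : ℕ) : Site d → ZMod 2 :=
  if τ = 0 then 0 else sens β w ((τ - 1) / 7) ((τ - 1) % 7)

theorem sensAt_round (β : Basis) (w : Data d → ZMod 2) (k : ℕ) {i : ℕ} (hi : i < 7) :
    sensAt β w (7 * k + 1 + i) = sens β w k i := by
  unfold sensAt
  rw [if_neg (by omega), show (7 * k + 1 + i - 1) / 7 = k by omega,
    show (7 * k + 1 + i - 1) % 7 = i by omega]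

theorem sensAt_start (β : Basis) (w : Data d → ZMod 2) (k : ℕ) :
    sensAt β w (7 * k + 1) = onData w := by
  rw [← sens_zero β w k, ← sensAt_round β w k (by norm_num : 0 < 7)]

theorem sensAt_zero (β : Basis) (w : Data d → ZMod 2) : sensAt β w 0 = 0 := rfl

variable {T : ℕ} {b : Basis}

theorem pull_sensAt {β : Basis} {w : Data d → ZMod 2} (hw : Commutes β w) {τ : ℕ}
    (hτ : τ < 7 * T + 1) :
    Op.pull β ((midSwap d T b).op τ) (sensAt β w (τ + 1)) = sensAt β w τ := by
  rcases time_cases T τ with rfl | ⟨k, i, hk, hi, rfl⟩ | rfl | h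
  · rw [midSwap_op_zero, sensAt_zero]
    have := sensAt_start β w 0
    rw [show 0 + 1 = 7 * 0 + 1 by rfl, this]
    funext s
    rcases s with q | P <;> simp [Op.pull, dataLayer, onData]
  · rw [midSwap_op_round hk hi, sensAt_round β w k hi, ← pull_sens hw k hi]
    congr 1
    by_cases h6 : i = 6
    · subst h6
      rw [show 7 * k + 1 + 6 + 1 = 7 * (k + 1) + 1 by ring, sensAt_start, sens_seven]
    · rw [← sensAt_round β w k (by omega : i + 1 < 7)]
      rfl
  · omega
  · omega

/-- The change of the data operator `w` at the end of the experiment, as a functional of the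
error. -/
def pairing (T : ℕ) (β : Basis) (w : Data d → ZMod 2) (e : Experiment.Config (Site d)) : ZMod 2 :=
  ∑ τ ∈ Finset.range (7 * T + 2), ∑ s, sensAt β w τ s * β.comp (e τ s)

theorem pairing_add (T : ℕ) (β : Basis) (w : Data d → ZMod 2)
    (e e' : Experiment.Config (Site d)) :
    pairing T β w (e + e') = pairing T β w e + pairing T β w e' := by
  simp [pairing, mul_add, Finset.sum_add_distrib]

theorem sum_onData (w : Data d → ZMod 2) (f : Site d → ZMod 2) :
    ∑ s, onData w s * f s = ∑ q, w q * f (Sum.inl q) := by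
  simp [onData, Fintype.sum_sum_type]

theorem sum_flip_eq_pairing {w : Data d → ZMod 2} (hw : Commutes b w)
    (e : Experiment.Config (Site d)) :
    ∑ q, w q * (midSwap d T b).flip e (7 * T + 1) (Sum.inl q) = pairing T b w e := by
  have h := (midSwap d T b).sum_frame (Nat.zero_le (7 * T + 1)) b (sensAt b w)
    (fun τ _ _ => midSwap_consistent τ) (fun τ _ hτ => pull_sensAt hw hτ) e
  rw [sensAt_start, sum_onData] at h
  have h2 : ∀ q : Data d, (midSwap d T b).flip e (7 * T + 1) (Sum.inl q) =
      b.comp ((midSwap d T b).frame e (7 * T + 1) (Sum.inl q)) := fun q =>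
    (midSwap d T b).flip_eq e _ _ b (by rw [midSwap_op_final]; rfl)
  simp only [h2, h, pairing]
  rw [Nat.range_succ_eq_Icc_zero, ← Finset.Ioc_insert_left (Nat.zero_le _),
    Finset.sum_insert (by simp), sensAt_zero]
  simp

end AtomLoss

namespace AtomLoss

variable {d : ℕ}

/-! ## Weights of stabilizers and logical operators -/

/-- The sum of `u` over the two coordinates next to `i`, as far as they exist. -/
def nearSum (u : Fin d → ZMod 2) (i : Fin (d + 1)) : ZMod 2 :=
  (dataCoord i false).elim 0 u + (dataCoord i true).elim 0 u

theorem optVal_corner (u v : Fin d → ZMod 2) (P : Plaq d) (c : Corner) :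
    optVal (fun q => u q.1 * v q.2) (P.corner c) =
      (dataCoord P.1 c.1).elim 0 u * (dataCoord P.2 c.2).elim 0 v := by
  unfold Plaq.corner
  cases dataCoord P.1 c.1 <;> cases dataCoord P.2 c.2 <;> simp

/-- In a round, a plaquette interacts with each of its corners once. -/
theorem sum_order {M : Type*} [AddCommMonoid M] (f : Corner → M) (k : ℕ) (β : Basis) :
    f (order k β 0) + f (order k β 1) + f (order k β 2) + f (order k β 3) =
      f (false, false) + f (false, true) + f (true, false) + f (true, true) := by
  rcases Nat.mod_two_eq_zero_or_one k with h | h <;> cases β <;> simp [order, h] <;> abel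

theorem sum_cor_mul (u v : Fin d → ZMod 2) (k : ℕ) (P : Plaq d) :
    optVal (fun q => u q.1 * v q.2) (cor k 0 P) + optVal (fun q => u q.1 * v q.2) (cor k 1 P) +
      optVal (fun q => u q.1 * v q.2) (cor k 2 P) + optVal (fun q => u q.1 * v q.2) (cor k 3 P) =
      nearSum u P.1 * nearSum v P.2 := by
  unfold cor
  rw [sum_order (fun c => optVal (fun q : Data d => u q.1 * v q.2) (P.corner c)) k P.type]
  simp only [optVal_corner, nearSum]
  ring

/-- The indicator of a set of data qubits. -/
def indicator (A : Finset (Data d)) (q : Data d) : ZMod 2 := if q ∈ A then 1 else 0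

/-- The indicator of the coordinates next to `i₀`. -/
def nextTo (i₀ : Fin (d + 1)) (a : Fin d) : ZMod 2 :=
  if a.val = i₀.val ∨ a.val + 1 = i₀.val then 1 else 0

theorem Plaq.mem_support {P : Plaq d} {q : Data d} :
    q ∈ P.support ↔ (q.1.val = P.1.val ∨ q.1.val + 1 = P.1.val) ∧
      (q.2.val = P.2.val ∨ q.2.val + 1 = P.2.val) := by
  unfold Plaq.support Data.plaq
  simp only [Finset.mem_filter, Finset.mem_univ, true_and, Prod.ext_iff, Fin.ext_iff,
    plaqCoord_val, Prod.exists, Bool.exists_bool]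
  simp only [Bool.false_eq_true, if_false, if_true, add_zero]
  tauto

theorem indicator_support (P : Plaq d) :
    indicator P.support = fun q => nextTo P.1 q.1 * nextTo P.2 q.2 := by
  funext q
  unfold indicator nextTo
  simp only [Plaq.mem_support]
  split_ifs <;> simp_all

theorem elim_dataCoord_false (u : Fin d → ZMod 2) (i : Fin (d + 1)) :
    (dataCoord i false).elim 0 u = if h : 0 < i.val then u ⟨i.val - 1, by omega⟩ else 0 := by
  unfold dataCoord
  by_cases h : 0 < i.val <;> simp [h]

theorem elim_dataCoord_true (u : Fin d → ZMod 2) (i : Fin (d + 1)) :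
    (dataCoord i true).elim 0 u = if h : i.val < d then u ⟨i.val, h⟩ else 0 := by
  unfold dataCoord
  by_cases h : i.val < d <;> simp [h]

/-- Equal interior indices share two coordinates, and `1 + 1 = 0`. An odd overlap remains only for
adjacent indices, or for equal indices at the boundary, where one of the two coordinates is missing.
-/
theorem nearSum_nextTo (i₀ i : Fin (d + 1)) (h : nearSum (nextTo i₀) i ≠ 0) :
    (i.val = i₀.val ∧ (i.val = 0 ∨ i.val = d)) ∨ i.val = i₀.val + 1 ∨ i₀.val = i.val + 1 := by
  by_contra hc
  apply h
  simp only [nearSum, elim_dataCoord_false, elim_dataCoord_true, nextTo]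
  have := i.isLt
  have := i₀.isLt
  by_cases h1 : 0 < i.val <;> by_cases h2 : i.val < d <;> by_cases h3 : i.val = i₀.val
  · simp only [h1, h2, dif_pos]
    rw [if_pos (by omega), if_pos (by omega)]
    exact zmod2_self_add 1
  all_goals
    simp only [h1, h2, dif_pos, dif_neg, not_false_eq_true, add_zero, zero_add]
    try omega
    try rw [if_neg (by omega)]
    try rw [if_neg (by omega)]
    try simp

theorem Plaq.type_eq_Z {P : Plaq d} : P.type = Basis.Z ↔ (P.1.val + P.2.val) % 2 = 0 := by
  unfold Plaq.type
  split_ifs <;> simp_all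

theorem Plaq.type_eq_X {P : Plaq d} : P.type = Basis.X ↔ (P.1.val + P.2.val) % 2 = 1 := by
  unfold Plaq.type
  split_ifs with h <;> simp <;> omega

theorem Plaq.type_ne {P P' : Plaq d} :
    P.type ≠ P'.type ↔ (P.1.val + P.2.val + P'.1.val + P'.2.val) % 2 = 1 := by
  unfold Plaq.type
  split_ifs <;> simp <;> omega

theorem Plaq.IsStab.cases {P : Plaq d} (h : P.IsStab) :
    (0 < P.1.val ∧ P.1.val < d ∧ 0 < P.2.val ∧ P.2.val < d) ∨
    ((P.1.val = 0 ∨ P.1.val = d) ∧ 0 < P.2.val ∧ P.2.val < d ∧ (P.1.val + P.2.val) % 2 = 1) ∨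
    ((P.2.val = 0 ∨ P.2.val = d) ∧ 0 < P.1.val ∧ P.1.val < d ∧ (P.1.val + P.2.val) % 2 = 0) := by
  unfold Plaq.IsStab at h
  rwa [Plaq.type_eq_X, Plaq.type_eq_Z] at h

/-- The overlap factorizes over the two coordinates. For plaquettes of different colour an odd
overlap would force one coordinate to differ by one and the other to coincide at the boundary. But
all stabilizers on one boundary have the same type. -/
theorem commutes_stab {P₀ : Plaq d} (h₀ : P₀.IsStab) : Commutes P₀.type (indicator P₀.support) := by
  intro k P hP hne
  rw [indicator_support, sum_cor_mul]
  by_contra hc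
  have h1 := nearSum_nextTo P₀.1 P.1 (left_ne_zero_of_mul hc)
  have h2 := nearSum_nextTo P₀.2 P.2 (right_ne_zero_of_mul hc)
  rw [Plaq.type_ne] at hne
  have h3 := hP.cases
  have h4 := h₀.cases
  omega

/-- A stabilizer of the other type never lies at an end of the logical line. Along the line it has
both neighbouring coordinates, and their contributions cancel. -/
theorem commutes_logical (b : Basis) : Commutes b (indicator (logicalSupport d b)) := by
  intro k P hP hne
  have h3 := hP.cases
  cases b
  · have hty : P.type = Basis.Z := by cases h : P.type <;> simp_all
    have : indicator (logicalSupport d Basis.X) =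
        fun q => (fun _ : Fin d => (1 : ZMod 2)) q.1 * (fun a => if a.val = 0 then 1 else 0) q.2 := by
      funext q; simp [indicator, logicalSupport]
    rw [this]
    refine (sum_cor_mul (fun _ => 1) (fun a => if a.val = 0 then 1 else 0) k P).trans ?_
    rw [Plaq.type_eq_Z] at hty
    have : nearSum (fun _ : Fin d => (1 : ZMod 2)) P.1 = 0 := by
      simp only [nearSum, elim_dataCoord_false, elim_dataCoord_true]
      rw [dif_pos (by omega), dif_pos (by omega)]
      exact zmod2_self_add 1
    rw [this, zero_mul]
  · have hty : P.type = Basis.X := by cases h : P.type <;> simp_all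
    have : indicator (logicalSupport d Basis.Z) =
        fun q => (fun a : Fin d => if a.val = 0 then (1 : ZMod 2) else 0) q.1 * (fun _ => 1) q.2 := by
      funext q; simp [indicator, logicalSupport]
    rw [this]
    refine (sum_cor_mul (fun a => if a.val = 0 then 1 else 0) (fun _ => 1) k P).trans ?_
    rw [Plaq.type_eq_X] at hty
    have : nearSum (fun _ : Fin d => (1 : ZMod 2)) P.2 = 0 := by
      simp only [nearSum, elim_dataCoord_false, elim_dataCoord_true]
      rw [dif_pos (by omega), dif_pos (by omega)]
      exact zmod2_self_add 1
    rw [this, mul_zero]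

variable {T : ℕ} {b : Basis}

theorem sum_image_data (A : Finset (Data d)) (e : Experiment.Config (Site d)) :
    ∑ m ∈ A.image (fun q => (7 * T + 1, (Sum.inl q : Site d))), (midSwap d T b).flip e m.1 m.2 =
      ∑ q, indicator A q * (midSwap d T b).flip e (7 * T + 1) (Sum.inl q) := by
  rw [Finset.sum_image (by intro x _ y _ h; simpa using h)]
  simp [indicator, Finset.sum_ite_mem]

theorem observable_eq_pairing (e : Experiment.Config (Site d)) :
    (midSwap d T b).observable e = pairing T b (indicator (logicalSupport d b)) e := by
  rw [← sum_flip_eq_pairing (commutes_logical b)]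
  exact sum_image_data _ e

/-- The flip of the outcome of the stabilizer `P` in round `k`. -/
def ancFlip (T : ℕ) (b : Basis) (e : Experiment.Config (Site d)) (k : ℕ) (P : Plaq d) : ZMod 2 :=
  (midSwap d T b).flip e (measTime k) (Sum.inr P)

theorem syndrome_nonstab {e : Experiment.Config (Site d)} {t : Fin (T + 1)} {P : Plaq d}
    (h : ¬P.IsStab) : (midSwap d T b).syndrome e (t, P) = 0 := by
  simp [Experiment.syndrome, midSwap, h]

theorem syndrome_first {e : Experiment.Config (Site d)} {t : Fin (T + 1)} {P : Plaq d}
    (h : P.IsStab) (ht : t.val = 0) :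
    (midSwap d T b).syndrome e (t, P) = if P.type = b then ancFlip T b e 0 P else 0 := by
  unfold Experiment.syndrome
  have : (midSwap d T b).det (t, P) =
      if P.type = b then {(measTime 0, Sum.inr P)} else ∅ := by
    simp only [midSwap]
    rw [if_pos h, if_pos ht]
  rw [this]
  split_ifs <;> simp [ancFlip]

theorem syndrome_middle {e : Experiment.Config (Site d)} {t : Fin (T + 1)} {P : Plaq d}
    (h : P.IsStab) (ht : t.val ≠ 0) (ht' : t.val < T) :
    (midSwap d T b).syndrome e (t, P) = ancFlip T b e (t.val - 1) P + ancFlip T b e t.val P := by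
  unfold Experiment.syndrome
  have : (midSwap d T b).det (t, P) =
      {(measTime (t.val - 1), Sum.inr P), (measTime t.val, Sum.inr P)} := by
    simp only [midSwap]
    rw [if_pos h, if_neg ht, if_pos ht']
  rw [this, Finset.sum_pair]
  · rfl
  · simp [measTime]; omega

theorem syndrome_last {e : Experiment.Config (Site d)} {t : Fin (T + 1)} {P : Plaq d}
    (h : P.IsStab) (ht : t.val ≠ 0) (ht' : t.val = T) :
    (midSwap d T b).syndrome e (t, P) = if P.type = b then ancFlip T b e (T - 1) P +
      ∑ q, indicator P.support q * (midSwap d T b).flip e (7 * T + 1) (Sum.inl q) else 0 := by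
  unfold Experiment.syndrome
  have : (midSwap d T b).det (t, P) =
      if P.type = b then insert (measTime (T - 1), Sum.inr P)
            (P.support.image fun q => (7 * T + 1, Sum.inl q))
        else ∅ := by
    simp only [midSwap]
    rw [if_pos h, if_neg ht, if_neg (by omega)]
  rw [this]
  split_ifs
  · rw [Finset.sum_insert (by simp), sum_image_data]
    rfl
  · simp

/-- The comparisons of consecutive outcomes telescope, so only the parity of the final data
measurement survives. -/
theorem sum_syndrome_eq_pairing (hT : 1 ≤ T) {P : Plaq d} (h : P.IsStab) (hb : P.type = b)
    (e : Experiment.Config (Site d)) :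
    ∑ t, (midSwap d T b).syndrome e (t, P) = pairing T b (indicator P.support) e := by
  have hc := commutes_stab h
  rw [hb] at hc
  rw [← sum_flip_eq_pairing hc, Fin.sum_univ_castSucc,
    syndrome_last h (by simp; omega) (by simp), if_pos hb, ← add_assoc]
  -- The partial sum of the detectors up to time `n` is the outcome of round `n`; the last detector
  -- then cancels the outcome of round `T - 1`.
  suffices hs : ∀ n, n < T → ∑ t ∈ Finset.range (n + 1),
      (if ht : t < T then (midSwap d T b).syndrome e ((⟨t, ht⟩ : Fin T).castSucc, P) else 0) =
        ancFlip T b e n P by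
    have := hs (T - 1) (by omega)
    rw [Nat.sub_add_cancel hT, ← Fin.sum_univ_eq_sum_range
      (fun t => if ht : t < T then (midSwap d T b).syndrome e ((⟨t, ht⟩ : Fin T).castSucc, P)
        else 0)] at this
    simp only [Fin.is_lt, dif_pos, Fin.eta] at this
    rw [this, zmod2_self_add, zero_add]
  intro n hn
  induction n with
  | zero =>
    simp only [zero_add, Finset.sum_range_one]
    rw [dif_pos hn, syndrome_first h (by simp), if_pos hb]
  | succ n ih =>
    rw [Finset.sum_range_succ, ih (by omega), dif_pos hn, syndrome_middle h (by simp) (by simpa)]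
    simp only [Fin.val_castSucc, Nat.add_sub_cancel]
    rw [← add_assoc, zmod2_self_add, zero_add]

end AtomLoss

namespace AtomLoss

/-! ## The distance of the code, with narrow errors -/

section Grid

variable {d ε : ℕ} {F : ℕ → ℕ → ZMod 2}

/-- Prefix sums of the rows of `F`. -/
def rowSum (F : ℕ → ℕ → ZMod 2) (a c : ℕ) : ZMod 2 := ∑ c' ∈ Finset.range c, F a c'

theorem rowSum_succ (a c : ℕ) : rowSum F a (c + 1) = rowSum F a c + F a c :=
  Finset.sum_range_succ _ _

/-- The plaquettes of colour `ε` between two adjacent rows tile the strip by pairs of columns, so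
the prefix sums of both rows agree at every other column. Induction goes in steps of two; the base
is the empty prefix or, for the other parity, the half plaquette at the left end. -/
theorem rowSum_eq_prev
    (h0 : ∀ i, 0 < i → i < d → i % 2 = ε → F (i - 1) 0 + F i 0 = 0)
    (hj : ∀ i j, 0 < i → i < d → j < d → (i + j + 1) % 2 = ε →
      F (i - 1) j + F (i - 1) (j + 1) + F i j + F i (j + 1) = 0)
    {i : ℕ} (hi : 0 < i) (hid : i < d) (hε : ε < 2) :
    ∀ j, j ≤ d + 1 → (i + j) % 2 ≠ ε → rowSum F (i - 1) j = rowSum F i j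
  | 0, _, _ => by simp [rowSum]
  | 1, _, h => by
    simp only [rowSum, Finset.sum_range_one]
    exact CharTwo.add_eq_zero.1 (h0 i hi hid (by omega))
  | j + 2, hjd, h => by
    have ih := rowSum_eq_prev h0 hj hi hid hε j (by omega) (by omega)
    have := hj i j hi hid (by omega) (by omega)
    simp only [rowSum_succ, ih]
    rw [add_assoc, add_assoc]
    congr 1
    rw [← CharTwo.add_eq_zero, ← this]
    ring

theorem exists_jump (a : ℕ) : ∀ c, rowSum F a c = 1 →
    ∃ c' < c, rowSum F a c' = 0 ∧ rowSum F a (c' + 1) = 1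
  | 0, h => by simp [rowSum] at h
  | c + 1, h => by
    rcases zmod2_cases (rowSum F a c) with h' | h'
    · exact ⟨c, by omega, h', h⟩
    · obtain ⟨c', hc', h1⟩ := exists_jump a c h'
      exact ⟨c', by omega, h1⟩

/-- If the rows of `F` are odd, `F` is even on a checkerboard of plaquettes, and `F` is a sum of
functions that in different rows are only supported on opposite corners of a plaquette
of the other colour, then there are at least as many summands as rows. -/
theorem card_of_rowSum {ι : Type*} (W : Finset ι) (S : ι → ℕ → ℕ → ZMod 2)
    (hF : ∀ a c, F a c = ∑ n ∈ W, S n a c)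
    (hout : ∀ a, F a d = 0) (hε : ε < 2)
    (h0 : ∀ i, 0 < i → i < d → i % 2 = ε → F (i - 1) 0 + F i 0 = 0)
    (hj : ∀ i j, 0 < i → i < d → j < d → (i + j + 1) % 2 = ε →
      F (i - 1) j + F (i - 1) (j + 1) + F i j + F i (j + 1) = 0)
    (hone : rowSum F 0 d = 1)
    (hS : ∀ n ∈ W, ∀ a c a' c', S n a c ≠ 0 → S n a' c' ≠ 0 → a < a' → a' = a + 1 ∧
      (c' = c + 1 ∨ c = c' + 1) ∧ (a' + max c c') % 2 ≠ ε) :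
    d ≤ W.card := by
  have hprev := fun i hi hid => rowSum_eq_prev (i := i) h0 hj hi hid hε
  have hrow : ∀ a, a < d → rowSum F a d = 1 := by
    intro a
    induction a with
    | zero => intro _; exact hone
    | succ a ih =>
      intro ha
      rw [← ih (by omega)]
      -- At the wrong parity the strip ends in a half plaquette. Going one column further to `d + 1`
      -- is harmless, since the entries of column `d` vanish.
      by_cases h : (a + 1 + d) % 2 = ε
      · have := hprev (a + 1) (by omega) ha (d + 1) le_rfl (by omega)
        simpa [rowSum_succ, hout] using this.symm
      · exact (hprev (a + 1) (by omega) ha d (by omega) h).symm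
  -- In each row, fix a column `c a` at which the prefix sum jumps from 0 to 1. There `F` is
  -- nonzero, hence so is some summand `n a`.
  choose! c hcd hc0 hc1 using fun a (ha : a < d) => exists_jump a d (hrow a ha)
  have hex : ∀ a, a < d → ∃ n ∈ W, S n a (c a) ≠ 0 := by
    intro a ha
    by_contra hcon
    push Not at hcon
    have h1 := hc1 a ha
    rw [rowSum_succ, hc0 a ha, zero_add, hF, Finset.sum_eq_zero hcon] at h1
    exact zero_ne_one h1
  rcases Nat.eq_zero_or_pos d with hd0 | hd0
  · omega
  have : Nonempty ι := ⟨(hex 0 hd0).choose⟩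
  choose! n hnW hn using hex
  have hinj : ∀ a a', a < d → a' < d → n a = n a' → ¬ a < a' := by
    intro a a' ha ha' hnn hlt
    have h2 := hn a' ha'
    rw [← hnn] at h2
    obtain ⟨h3, h4, h5⟩ := hS (n a) (hnW a ha) a (c a) a' (c a') (hn a ha) h2 hlt
    subst h3
    -- A summand serving two rows would put their jumps on a diagonal. At the column between the two
    -- cells, one row has already jumped and the other has not, but the prefix sums agree there by
    -- the parity in `h5`.
    rcases h4 with h4 | h4
    · have := hprev (a + 1) (by omega) ha' (c (a + 1)) (by have := hcd _ ha'; omega)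
        (by rwa [max_eq_right (by omega)] at h5)
      rw [Nat.add_sub_cancel, hc0 (a + 1) ha', h4, hc1 a ha] at this
      exact one_ne_zero this
    · have := hprev (a + 1) (by omega) ha' (c a) (by have := hcd _ ha; omega)
        (by rwa [max_eq_left (by omega)] at h5)
      rw [Nat.add_sub_cancel, hc0 a ha, h4, hc1 (a + 1) ha'] at this
      exact zero_ne_one this
  have := Finset.card_le_card_of_injOn (s := Finset.range d) (t := W) n
    (fun a ha => hnW a (by simpa using ha))
    (fun a ha a' ha' h => by
      simp only [Finset.coe_range, Set.mem_Iio] at ha ha'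
      have h1 := hinj a a' ha ha' h
      have h2 := hinj a' a ha' ha h.symm
      omega)
  simpa using this

end Grid

variable {d : ℕ}

/-- The data qubit in row `a` and column `c` of the lattice, turned such that the logical
operator of type `b` is a row. -/
def gridSite (b : Basis) (a c : Fin d) : Data d :=
  match b with
  | Basis.Z => (a, c)
  | Basis.X => (c, a)

def across (b : Basis) (q : Data d) : ℕ :=
  match b with
  | Basis.Z => q.1.val
  | Basis.X => q.2.val

def along (b : Basis) (q : Data d) : ℕ :=
  match b with
  | Basis.Z => q.2.val
  | Basis.X => q.1.val

/-- The parity of the coordinates of the plaquettes of type `b`. -/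
def Basis.parity (b : Basis) : ℕ :=
  match b with
  | Basis.Z => 0
  | Basis.X => 1

/-- A data operator that in different rows is only supported on opposite corners of a plaquette
of type other than `b`. -/
def Narrow (b : Basis) (S : Data d → ZMod 2) : Prop :=
  ∀ q q', S q ≠ 0 → S q' ≠ 0 → across b q < across b q' → across b q' = across b q + 1 ∧
    (along b q' = along b q + 1 ∨ along b q = along b q' + 1) ∧
    (across b q' + max (along b q) (along b q')) % 2 ≠ b.parity

/-- A data operator as a function on `ℕ × ℕ`. -/
def grid (b : Basis) (F : Data d → ZMod 2) (a c : ℕ) : ZMod 2 :=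
  if h : a < d ∧ c < d then F (gridSite b ⟨a, h.1⟩ ⟨c, h.2⟩) else 0

theorem grid_ne_zero {b : Basis} {F : Data d → ZMod 2} {a c : ℕ} (h : grid b F a c ≠ 0) :
    ∃ q, across b q = a ∧ along b q = c ∧ F q ≠ 0 := by
  unfold grid at h
  split_ifs at h with h1
  · refine ⟨_, ?_, ?_, h⟩ <;> cases b <;> rfl
  · exact absurd rfl h

theorem sum_nextTo (i : Fin (d + 1)) (f : Fin d → ZMod 2) :
    ∑ a, nextTo i a * f a = nearSum f i := by
  have : ∀ a, nextTo i a * f a = (if dataCoord i false = some a then f a else 0) +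
      (if dataCoord i true = some a then f a else 0) := by
    intro a
    simp only [dataCoord_eq_some, Fin.ext_iff, plaqCoord_val, nextTo]
    simp only [Bool.false_eq_true, if_false, if_true, add_zero]
    by_cases h1 : a.val = i.val <;> by_cases h2 : a.val + 1 = i.val
    · omega
    all_goals simp [h1, h2]
  simp only [this, Finset.sum_add_distrib, nearSum]
  congr 1
  · cases dataCoord i false <;> simp
  · cases dataCoord i true <;> simp

theorem sum_mul_indicator_support (F : Data d → ZMod 2) (P : Plaq d) :
    ∑ q, F q * indicator P.support q =
      nearSum (fun a => nearSum (fun c => F (a, c)) P.2) P.1 := by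
  rw [indicator_support, Fintype.sum_prod_type, ← sum_nextTo]
  refine Finset.sum_congr rfl fun a _ => ?_
  rw [← sum_nextTo, Finset.mul_sum]
  refine Finset.sum_congr rfl fun c _ => ?_
  ring

theorem nearSum_swap (F : Data d → ZMod 2) (i j : Fin (d + 1)) :
    nearSum (fun a => nearSum (fun c => F (a, c)) j) i =
      nearSum (fun c => nearSum (fun a => F (a, c)) i) j := by
  simp only [← sum_nextTo, Finset.mul_sum]
  rw [Finset.sum_comm]
  exact Finset.sum_congr rfl fun _ _ => Finset.sum_congr rfl fun _ _ => by ring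

/-- The plaquette `(i, j)` of the turned lattice. -/
def gridPlaq (b : Basis) (i j : Fin (d + 1)) : Plaq d :=
  match b with
  | Basis.Z => (i, j)
  | Basis.X => (j, i)

theorem sum_mul_indicator_gridPlaq (b : Basis) (F : Data d → ZMod 2) (i j : Fin (d + 1)) :
    ∑ q, F q * indicator (gridPlaq b i j).support q =
      nearSum (fun a => nearSum (fun c => F (gridSite b a c)) j) i := by
  rw [sum_mul_indicator_support]
  cases b
  · exact nearSum_swap F j i
  · rfl

theorem gridPlaq_type {b : Basis} {i j : Fin (d + 1)} (h : (i.val + j.val) % 2 = b.parity) :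
    (gridPlaq b i j).type = b := by
  cases b
  · rw [Plaq.type_eq_X]; simp only [gridPlaq, Basis.parity] at *; omega
  · rw [Plaq.type_eq_Z]; simp only [gridPlaq, Basis.parity] at *; omega

/-- Between two consecutive rows every plaquette of colour `b` is a stabilizer, including the half
plaquettes at both ends. -/
theorem gridPlaq_isStab {b : Basis} {i j : Fin (d + 1)} (h : (i.val + j.val) % 2 = b.parity)
    (hi : 0 < i.val) (hid : i.val < d) : (gridPlaq b i j).IsStab := by
  have hty := gridPlaq_type h
  have hj := j.isLt
  unfold Plaq.IsStab
  rw [hty]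
  cases b <;> simp only [gridPlaq, Basis.parity, reduceCtorEq, and_false, false_or, or_false,
    and_true] at * <;> omega

theorem nearSum_zero (f : Fin d → ZMod 2) (hd : 0 < d) (j : Fin (d + 1)) (hj : j.val = 0) :
    nearSum f j = f ⟨0, hd⟩ := by
  simp only [nearSum, elim_dataCoord_false, elim_dataCoord_true]
  rw [dif_neg (by omega), dif_pos (by omega)]
  simp [hj]

theorem grid_linear {ι : Type*} (b : Basis) (W : Finset ι) (S : ι → Data d → ZMod 2) (a c : ℕ) :
    grid b (∑ n ∈ W, S n) a c = ∑ n ∈ W, grid b (S n) a c := by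
  unfold grid
  split_ifs <;> simp

theorem sum_logical (b : Basis) (F : Data d → ZMod 2) (hd : 0 < d) :
    ∑ q, F q * indicator (logicalSupport d b) q = rowSum (grid b F) 0 d := by
  have h1 : rowSum (grid b F) 0 d = ∑ c : Fin d, F (gridSite b ⟨0, hd⟩ c) := by
    unfold rowSum
    rw [← Fin.sum_univ_eq_sum_range]
    refine Finset.sum_congr rfl fun c _ => ?_
    unfold grid
    rw [dif_pos ⟨hd, c.isLt⟩]
  rw [h1, Fintype.sum_prod_type]
  cases b
  · refine Finset.sum_congr rfl fun a _ => ?_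
    rw [Finset.sum_eq_single ⟨0, hd⟩]
    · simp [indicator, logicalSupport, gridSite]
    · intro c _ hc
      have : c.val ≠ 0 := fun h => hc (Fin.ext h)
      simp [indicator, logicalSupport, this]
    · simp
  · rw [Finset.sum_eq_single ⟨0, hd⟩]
    · simp [indicator, logicalSupport, gridSite]
    · intro c _ hc
      have : c.val ≠ 0 := fun h => hc (Fin.ext h)
      simp [indicator, logicalSupport, this]
    · simp

/-- A nontrivial logical operator is a product of at least `d` narrow operators. -/
theorem distance {ι : Type*} (b : Basis) (hd : 0 < d) (W : Finset ι) (S : ι → Data d → ZMod 2)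
    (hS : ∀ n ∈ W, Narrow b (S n))
    (hstab : ∀ P : Plaq d, P.IsStab → P.type = b →
      ∑ q, (∑ n ∈ W, S n) q * indicator P.support q = 0)
    (hlog : ∑ q, (∑ n ∈ W, S n) q * indicator (logicalSupport d b) q = 1) :
    d ≤ W.card := by
  refine card_of_rowSum (d := d) (ε := b.parity) W (fun n => grid b (S n))
    (fun a c => grid_linear b W S a c) (fun a => ?_) (by cases b <;> simp [Basis.parity]) ?_ ?_ ?_ ?_
  · unfold grid
    rw [dif_neg (by omega)]
  · intro i hi hid hε
    have hp : ((⟨i, by omega⟩ : Fin (d + 1)).val + (0 : Fin (d + 1)).val) % 2 = b.parity := by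
      simpa using hε
    have := hstab _ (gridPlaq_isStab hp hi hid) (gridPlaq_type hp)
    rw [sum_mul_indicator_gridPlaq] at this
    rw [← this]
    simp only [nearSum_zero _ hd 0 rfl]
    simp only [nearSum, elim_dataCoord_false, elim_dataCoord_true]
    rw [dif_pos hi, dif_pos hid]
    unfold grid
    rw [dif_pos ⟨by omega, hd⟩, dif_pos ⟨by omega, hd⟩]
  · intro i j hi hid hjd hε
    have hp : ((⟨i, by omega⟩ : Fin (d + 1)).val + (⟨j + 1, by omega⟩ : Fin (d + 1)).val) % 2 =
        b.parity := hε
    have := hstab _ (gridPlaq_isStab hp hi hid) (gridPlaq_type hp)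
    rw [sum_mul_indicator_gridPlaq] at this
    rw [← this]
    simp only [nearSum, elim_dataCoord_false, elim_dataCoord_true]
    rw [dif_pos hi, dif_pos hid]
    simp only [Nat.zero_lt_succ, dif_pos, Nat.add_sub_cancel]
    unfold grid
    have h' : i - 1 < d := by omega
    -- If `j + 1 = d`, this is the half plaquette at the right end, and `grid` reads 0 in the
    -- missing column.
    by_cases hj1 : j + 1 < d
    · simp only [h', hid, hjd, hj1, and_self, ↓reduceDIte]
      ring
    · simp only [h', hid, hjd, hj1, and_self, and_false, ↓reduceDIte]
      ring
  · rw [← hlog, sum_logical b _ hd]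
  · intro n hn a c a' c' h h' hlt
    obtain ⟨q, rfl, rfl, hq⟩ := grid_ne_zero h
    obtain ⟨q', rfl, rfl, hq'⟩ := grid_ne_zero h'
    exact hS n hn q q' hq hq' hlt

end AtomLoss

namespace AtomLoss

/-! ## Wires -/

/-- The site after the operation `o` of an atom that is at `s` before it. -/
def Op.next {S : Type} (o : Op S) (s : S) : Option S :=
  match o with
  | Op.meas _ => none
  | Op.reset _ => none
  | Op.swap s' => some s'
  | _ => some s

namespace Experiment

variable {S D : Type} (C : Experiment S D)

/-- The site after layer `τ` of the atom that is at `s` before it. -/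
def step (τ : ℕ) (s : S) : Option S := (C.op τ s).next s

theorem wire_succ (τ : ℕ) (s : S) (n : ℕ) :
    C.wire τ s (n + 1) = (C.step τ s).bind fun s' => C.wire (τ + 1) s' n := by
  unfold step Op.next
  rw [wire]
  cases C.op τ s <;> rfl

theorem wire_add (τ : ℕ) (s : S) (n m : ℕ) :
    C.wire τ s (n + m) = (C.wire τ s n).bind fun s' => C.wire (τ + n) s' m := by
  induction n generalizing τ s with
  | zero => simp [wire]
  | succ n ih =>
    rw [show n + 1 + m = (n + m) + 1 by ring, wire_succ, wire_succ]
    cases C.step τ s with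
    | none => rfl
    | some s' => simp only [Option.bind_some, ih, show τ + 1 + n = τ + (n + 1) by ring]

variable {C}

theorem OnWire.tail {τ σ μ : ℕ} {s s' m : S} (h : C.OnWire τ s σ s') (hm : C.OnWire τ s μ m)
    (hσ : σ ≤ μ) : C.OnWire σ s' μ m := by
  refine ⟨hσ, ?_⟩
  have h1 := hm.2
  have h2 := h.1
  rw [show μ - τ = (σ - τ) + (μ - σ) by omega, wire_add, h.2] at h1
  simpa [show τ + (σ - τ) = σ by omega] using h1

theorem OnWire.le_meas {τ σ μ : ℕ} {s s' m : S} (h : C.OnWire τ s σ s') (hm : C.OnWire τ s μ m)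
    (hmeas : (C.op μ m).isMeas = true) : σ ≤ μ := by
  by_contra hlt
  have ht := hm.tail h (by omega)
  have h1 := ht.2
  rw [show σ - μ = (σ - μ - 1) + 1 by omega, wire_succ] at h1
  unfold step at h1
  cases ho : C.op μ m <;> simp_all [Op.isMeas, Op.next]

theorem OnWire.cases_head {τ μ : ℕ} {s m : S} (h : C.OnWire τ s μ m) :
    (τ = μ ∧ s = m) ∨ (τ < μ ∧ ∃ s', C.step τ s = some s' ∧ C.OnWire (τ + 1) s' μ m) := by
  rcases h.1.eq_or_lt with rfl | hlt
  · left
    have := h.2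
    simpa [wire] using this
  · right
    refine ⟨hlt, ?_⟩
    have h1 := h.2
    rw [show μ - τ = (μ - (τ + 1)) + 1 by omega, wire_succ] at h1
    obtain ⟨s', hs, h2⟩ := Option.bind_eq_some_iff.1 h1
    exact ⟨s', hs, hlt, h2⟩

/-- Backward induction along a wire. -/
theorem OnWire.backward {μ : ℕ} {m : S} {Inv : ℕ → S → Prop} (h0 : Inv μ m)
    (hs : ∀ τ < μ, ∀ s s', C.step τ s = some s' → Inv (τ + 1) s' → Inv τ s) {τ : ℕ} {s : S}
    (h : C.OnWire τ s μ m) : Inv τ s := by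
  obtain ⟨n, hn⟩ : ∃ n, n = μ - τ := ⟨_, rfl⟩
  induction n generalizing τ s with
  | zero =>
    rcases h.cases_head with ⟨rfl, rfl⟩ | ⟨h1, _⟩
    · exact h0
    · omega
  | succ n ih =>
    rcases h.cases_head with ⟨rfl, rfl⟩ | ⟨h1, s', h2, h3⟩
    · omega
    · exact hs τ h1 s s' h2 (ih h3 (by omega))

end Experiment

variable {d T : ℕ} {b : Basis}

open Experiment

/-- Atoms move only in the shuttling step. The second conclusion records that no atom at a
stabilizer site survives a reset or a measurement; it limits how long a wire can stay at an ancilla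
site. -/
theorem step_round {k i : ℕ} (hk : k < T) (hi : i < 7) {s s' : Site d}
    (h : (midSwap d T b).step (7 * k + 1 + i) s = some s') (h2 : i ≠ 2) :
    s' = s ∧ ∀ P : Plaq d, s = Sum.inr P → P.IsStab → i ≠ 0 ∧ i ≠ 6 := by
  unfold step at h
  rw [midSwap_op_round hk hi] at h
  have hc : ∀ t, (cnotLayer k t s).next s = some s' → s' = s := by
    intro t h
    cases ho : cnotLayer k t s with
    | swap u =>
      exfalso
      rcases s with q | P
      · rw [cnotLayer_data] at ho
        split_ifs at ho
        cases hty : (meet k t q).type <;> simp [hty] at ho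
      · rw [cnotLayer_anc] at ho
        split_ifs at ho
        cases hc : cor k t P <;> cases hty : P.type <;> simp [hc, hty] at ho
    | _ => simp_all [Op.next]
  interval_cases i <;> simp only [roundLayer] at h
  · rcases s with q | P
    · simp only [ancillaLayer, Op.next, Option.some.injEq] at h
      subst h
      simp
    · by_cases hP : P.IsStab <;> simp [ancillaLayer, hP, Op.next] at h
      simp only [← h, Sum.inr.injEq, forall_eq', true_and]
      exact fun h' => absurd h' hP
  · simp [hc 0 h]
  · omega
  · simp [hc 1 h]
  · simp [hc 2 h]
  · simp [hc 3 h]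
  · rcases s with q | P
    · simp only [ancillaLayer, Op.next, Option.some.injEq] at h
      subst h
      simp
    · by_cases hP : P.IsStab <;> simp [ancillaLayer, hP, Op.next] at h
      simp only [← h, Sum.inr.injEq, forall_eq', true_and]
      exact fun h' => absurd h' hP

theorem step_swap {k : ℕ} (hk : k < T) {s s' : Site d}
    (h : (midSwap d T b).step (7 * k + 1 + 2) s = some s') :
    (∃ q, s = Sum.inl q ∧ (meet k 0 q).IsStab ∧ s' = Sum.inr (meet k 0 q)) ∨
    (∃ q, s = Sum.inl q ∧ ¬(meet k 0 q).IsStab ∧ s' = s) ∨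
    (∃ P q, s = Sum.inr P ∧ P.IsStab ∧ cor k 0 P = some q ∧ s' = Sum.inl q) ∨
    (∃ P, s = Sum.inr P ∧ (P.IsStab → cor k 0 P = none) ∧ s' = s) := by
  unfold step at h
  rw [midSwap_op_round hk (by norm_num)] at h
  simp only [roundLayer] at h
  rcases s with q | P
  · rw [swapLayer_data] at h
    by_cases hs : (meet k 0 q).IsStab <;> simp only [hs, if_true, if_false, Op.next] at h
    · exact Or.inl ⟨q, rfl, hs, by simpa using h.symm⟩
    · exact Or.inr (Or.inl ⟨q, rfl, hs, by simpa using h.symm⟩)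
  · right; right
    rw [swapLayer_anc] at h
    by_cases hs : P.IsStab <;> simp only [hs, if_true, if_false, Op.next] at h
    · cases hc : cor k 0 P with
      | none => simp only [hc] at h; exact Or.inr ⟨P, rfl, fun _ => hc, by simpa using h.symm⟩
      | some q => simp only [hc] at h; exact Or.inl ⟨P, q, rfl, hs, hc, by simpa using h.symm⟩
    · exact Or.inr ⟨P, rfl, fun h' => absurd h' hs, by simpa using h.symm⟩

/-- The places of an atom which serves as, or is about to become, the data qubit `q`. -/
def ServesAs (q : Data d) (τ : ℕ) (s : Site d) : Prop :=
  s = Sum.inl q ∨ ∃ k P, P.IsStab ∧ cor k 0 P = some q ∧ s = Sum.inr P ∧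
    (τ = 7 * k + 1 + 1 ∨ τ = 7 * k + 1 + 2)

/-- Going back through a shuttling step, the atom at `q` was there already or came from an ancilla
with first corner `q`. In the latter case the wire starts after the ancilla reset, which leaves just
two layers before the shuttling step. -/
theorem ServesAs.step {q : Data d} {τ : ℕ} (hτ : τ < 7 * T + 1) {s s' : Site d}
    (h : (midSwap d T b).step τ s = some s') (h' : ServesAs q (τ + 1) s') : ServesAs q τ s := by
  rcases time_cases T τ with rfl | ⟨k, i, hk, hi, rfl⟩ | rfl | h1
  · rcases s with q' | P
    · simp [Experiment.step, midSwap_op_zero, dataLayer, Op.next] at h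
    · simp only [Experiment.step, midSwap_op_zero, dataLayer, Op.next, Option.some.injEq] at h
      rcases h' with h' | ⟨k, P', _, _, _, h2⟩
      · rw [← h] at h'; cases h'
      · omega
  · by_cases h2 : i = 2
    · subst h2
      rcases h' with rfl | ⟨k', P', _, _, _, h2⟩
      · rcases step_swap hk h with ⟨q', rfl, _, h3⟩ | ⟨q', rfl, _, h3⟩ | ⟨P, q', rfl, hP, hc, h3⟩ |
          ⟨P, rfl, _, h3⟩
        · cases h3
        · exact Or.inl h3.symm
        · cases h3
          exact Or.inr ⟨k, P, hP, hc, rfl, Or.inr rfl⟩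
        · cases h3
      · omega
    · obtain ⟨h3, h4⟩ := step_round hk hi h h2
      subst h3
      rcases h' with rfl | ⟨k', P', hP', hc, rfl, h5⟩
      · exact Or.inl rfl
      · have := h4 P' rfl hP'
        exact Or.inr ⟨k', P', hP', hc, rfl, by omega⟩
  · omega
  · omega

/-- The places of the atom which is measured as the ancilla `P` in round `k`. -/
def EndsAt (k : ℕ) (P : Plaq d) (τ : ℕ) (s : Site d) : Prop :=
  (7 * k + 1 + 3 ≤ τ ∧ τ ≤ 7 * k + 1 + 6 ∧ s = Sum.inr P) ∨
  (τ ≤ 7 * k + 1 + 2 ∧ ((∃ q, cor k 0 P = some q ∧ ServesAs q τ s) ∨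
    (cor k 0 P = none ∧ s = Sum.inr P ∧ 7 * k + 1 + 1 ≤ τ)))

/-- Traced backwards, the atom stays at `P` until the shuttling step. Before that it served as the
data qubit at the first corner of `P`, or was the fresh ancilla itself if this corner is missing. -/
theorem endsAt_of_onWire {k : ℕ} (hk : k < T) {P : Plaq d} (hP : P.IsStab) {τ : ℕ} {s : Site d}
    (h : (midSwap d T b).OnWire τ s (7 * k + 1 + 6) (Sum.inr P)) : EndsAt k P τ s := by
  refine h.backward (Inv := EndsAt k P) (Or.inl ⟨by omega, le_rfl, rfl⟩) ?_
  intro τ hτ s s' hs hinv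
  rcases hinv with ⟨h1, h2, rfl⟩ | ⟨h1, ⟨q, hq, h2⟩ | ⟨h2, rfl, h3⟩⟩
  · rcases h1.eq_or_lt with h3 | h3
    · have h4 : τ = 7 * k + 1 + 2 := by omega
      subst h4
      right
      refine ⟨le_rfl, ?_⟩
      rcases step_swap hk hs with ⟨q', rfl, _, h3⟩ | ⟨q', rfl, _, h3⟩ | ⟨P, q', rfl, hP, hc, h3⟩ |
          ⟨P', rfl, hc, h3⟩
      · cases h3
        exact Or.inl ⟨q', cor_meet k 0 q', Or.inl rfl⟩
      · cases h3
      · cases h3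
      · cases h3
        exact Or.inr ⟨hc hP, rfl, by omega⟩
    · obtain ⟨i, rfl⟩ : ∃ i, τ = 7 * k + 1 + i := ⟨τ - (7 * k + 1), by omega⟩
      have := step_round hk (by omega) hs (by omega)
      exact Or.inl ⟨by omega, by omega, this.1.symm⟩
  · exact Or.inr ⟨by omega, Or.inl ⟨q, hq, h2.step (by omega) hs⟩⟩
  · obtain ⟨i, rfl⟩ : ∃ i, τ = 7 * k + 1 + i := ⟨τ - (7 * k + 1), by omega⟩
    have := step_round hk (by omega) hs (by omega)
    refine Or.inr ⟨by omega, Or.inr ⟨h2, this.1.symm, ?_⟩⟩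
    have := this.2 P this.1.symm hP
    omega

theorem servesAs_of_onWire {q : Data d} {τ : ℕ} {s : Site d}
    (h : (midSwap d T b).OnWire τ s (7 * T + 1) (Sum.inl q)) : ServesAs q τ s :=
  h.backward (Inv := ServesAs q) (Or.inl rfl) fun _ hτ _ _ hs hinv => hinv.step hτ hs

/-- Every measurement is that of an ancilla at the end of a round, or of a data qubit at the end. -/
theorem meas_cases (m : (midSwap d T b).Meas) :
    (∃ q, m.1.1.val = 7 * T + 1 ∧ m.1.2 = Sum.inl q) ∨
    (∃ k P, k < T ∧ P.IsStab ∧ m.1.1.val = 7 * k + 1 + 6 ∧ m.1.2 = Sum.inr P) := by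
  obtain ⟨⟨⟨τ, hτ⟩, s⟩, hm⟩ := m
  simp only at hm ⊢
  rcases time_cases T τ with rfl | ⟨k, i, hk, hi, rfl⟩ | rfl | h
  · rw [midSwap_op_zero] at hm
    rcases s with q | P <;> simp [dataLayer, Op.isMeas] at hm
  · rw [midSwap_op_round hk hi] at hm
    have hcn : ∀ t, (cnotLayer k t s).isMeas = false := by
      intro t
      rcases s with q | P
      · rw [cnotLayer_data]
        split_ifs
        · cases (meet k t q).type <;> rfl
        · rfl
      · rw [cnotLayer_anc]
        split_ifs
        · cases cor k t P <;> cases P.type <;> rfl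
        · rfl
    interval_cases i <;> simp only [roundLayer, hcn, Bool.false_eq_true] at hm
    · rcases s with q | P
      · simp [ancillaLayer, Op.isMeas] at hm
      · by_cases hP : P.IsStab <;> simp [ancillaLayer, hP, Op.isMeas] at hm
    · rcases s with q | P
      · rw [swapLayer_data] at hm
        split_ifs at hm <;> simp [Op.isMeas] at hm
      · rw [swapLayer_anc] at hm
        split_ifs at hm
        · cases hc : cor k 0 P <;> simp [hc, Op.isMeas] at hm
        · simp [Op.isMeas] at hm
    · rcases s with q | P
      · simp [ancillaLayer, Op.isMeas] at hm
      · by_cases hP : P.IsStab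
        · exact Or.inr ⟨k, P, hk, hP, rfl, rfl⟩
        · simp [ancillaLayer, hP, Op.isMeas] at hm
  · rw [midSwap_op_final] at hm
    rcases s with q | P
    · exact Or.inl ⟨q, rfl, rfl⟩
    · simp [dataLayer, Op.isMeas] at hm
  · rw [midSwap_op_void h] at hm
    simp [Op.isMeas] at hm

end AtomLoss

namespace AtomLoss

variable {d T : ℕ} {b : Basis}

open Experiment

/-! ## Narrowness of the data operators caused by single faults -/

/-- The error acts on the logical operator like a narrow data operator. -/
def Thin (T : ℕ) (b : Basis) (e : Config (Site d)) : Prop :=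
  ∃ S, Narrow b S ∧ ∀ w, Commutes b w → pairing T b w e = ∑ q, S q * w q

/-- The data operator supported on a single qubit, which may be missing. -/
def single (o : Option (Data d)) (q : Data d) : ZMod 2 := if o = some q then 1 else 0

theorem sum_single (o : Option (Data d)) (w : Data d → ZMod 2) :
    ∑ q, single o q * w q = optVal w o := by
  cases o <;> simp [single]

theorem single_ne_zero {o : Option (Data d)} {q : Data d} (h : single o q ≠ 0) : o = some q := by
  unfold single at h
  by_contra hc
  simp [hc] at h

theorem thin_single {e : Config (Site d)} (o : Option (Data d)) (c : ZMod 2)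
    (h : ∀ w, Commutes b w → pairing T b w e = c * optVal w o) : Thin T b e := by
  refine ⟨fun q => c * single o q, ?_, fun w hw => ?_⟩
  · intro q q' hq hq' hlt
    have h1 := single_ne_zero (right_ne_zero_of_mul hq)
    have h2 := single_ne_zero (right_ne_zero_of_mul hq')
    rw [h1] at h2
    cases h2
    omega
  · rw [h w hw, ← sum_single, Finset.mul_sum]
    exact Finset.sum_congr rfl fun q _ => by ring

/-- The parity of the layer fixes the coordinate of the corner along the logical operator
(`orderLo`). Corners visited in layers of different parity therefore differ along it: they share a
row or are opposite corners of `P`, but never lie in one column. -/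
theorem narrow_corner {P : Plaq d} (hne : P.type ≠ b) {k s t : ℕ} (hst : (s + t) % 2 = 1)
    {q q' : Data d} (hq : cor k s P = some q) (hq' : cor k t P = some q') (hlt : across b q < across b q') :
    across b q' = across b q + 1 ∧
    (along b q' = along b q + 1 ∨ along b q = along b q' + 1) ∧
    (across b q' + max (along b q) (along b q')) % 2 ≠ b.parity := by
  unfold cor at hq hq'
  rw [Plaq.corner_eq_some] at hq hq'
  have hlo : orderLo k s ≠ orderLo k t := by
    unfold orderLo
    rcases Nat.mod_two_eq_zero_or_one k with hk | hk <;>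
    rcases Nat.mod_two_eq_zero_or_one s with hs | hs <;>
    rcases Nat.mod_two_eq_zero_or_one t with ht | ht <;> simp [hk, hs, ht] <;> omega
  have e1 := congrArg (fun P : Plaq d => P.1.val) hq
  have e2 := congrArg (fun P : Plaq d => P.2.val) hq
  have e1' := congrArg (fun P : Plaq d => P.1.val) hq'
  have e2' := congrArg (fun P : Plaq d => P.2.val) hq'
  cases b
  · have hty : P.type = Basis.Z := by cases h : P.type <;> simp_all
    rw [hty, order_Z] at hq hq' e1 e2 e1' e2'
    rw [Plaq.type_eq_Z] at hty
    simp only [Data.plaq, plaqCoord_val] at e1 e2 e1' e2'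
    simp only [across, along, Basis.parity] at *
    cases h1 : orderLo k s <;> cases h2 : orderLo k t <;> cases h3 : orderHi k s <;>
      cases h4 : orderHi k t <;> simp only [h1, h2, h3, h4, Bool.false_eq_true, if_true, if_false,
        ne_eq, not_true_eq_false] at * <;> omega
  · have hty : P.type = Basis.X := by cases h : P.type <;> simp_all
    rw [hty, order_X] at hq hq' e1 e2 e1' e2'
    rw [Plaq.type_eq_X] at hty
    simp only [Data.plaq, plaqCoord_val] at e1 e2 e1' e2'
    simp only [across, along, Basis.parity] at *
    cases h1 : orderLo k s <;> cases h2 : orderLo k t <;> cases h3 : orderHi k s <;>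
      cases h4 : orderHi k t <;> simp only [h1, h2, h3, h4, Bool.false_eq_true, if_true, if_false,
        ne_eq, not_true_eq_false] at * <;> omega

theorem thin_pair {e : Config (Site d)} {P : Plaq d} (hne : P.type ≠ b) {k s t : ℕ}
    (hst : (s + t) % 2 = 1) (c c' : ZMod 2)
    (h : ∀ w, Commutes b w →
      pairing T b w e = c * optVal w (cor k s P) + c' * optVal w (cor k t P)) : Thin T b e := by
  refine ⟨fun q => c * single (cor k s P) q + c' * single (cor k t P) q, ?_, fun w hw => ?_⟩
  · have hsupp : ∀ q, c * single (cor k s P) q + c' * single (cor k t P) q ≠ 0 →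
        cor k s P = some q ∨ cor k t P = some q := by
      intro q hq
      by_contra hcon
      push Not at hcon
      simp [single, hcon] at hq
    intro q q' hq hq' hlt
    rcases hsupp q hq with h1 | h1 <;> rcases hsupp q' hq' with h2 | h2
    · rw [h1] at h2; cases h2; omega
    · exact narrow_corner hne hst h1 h2 hlt
    · exact narrow_corner hne (by omega) h1 h2 hlt
    · rw [h1] at h2; cases h2; omega
  · rw [h w hw, ← sum_single, ← sum_single, Finset.mul_sum, Finset.mul_sum,
      ← Finset.sum_add_distrib]
    exact Finset.sum_congr rfl fun q _ => by ring

/-- If the sensitivities at all places where `e` acts are multiples of one functional, then so is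
the action of `e`. -/
theorem pairing_of_support (Λ : (Data d → ZMod 2) → ZMod 2) (e : Config (Site d))
    (h : ∀ τ s, e τ s ≠ 0 → ∃ c, ∀ w, Commutes b w → sensAt b w τ s = c * Λ w) :
    ∃ c, ∀ w, Commutes b w → pairing T b w e = c * Λ w := by
  have h' : ∀ τ s, ∃ c, ∀ w, Commutes b w → sensAt b w τ s * b.comp (e τ s) = c * Λ w := by
    intro τ s
    by_cases he : e τ s = 0
    · exact ⟨0, fun w _ => by simp [he]⟩
    · obtain ⟨c, hc⟩ := h τ s he
      exact ⟨c * b.comp (e τ s), fun w hw => by rw [hc w hw]; ring⟩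
  choose c hc using h'
  refine ⟨∑ τ ∈ Finset.range (7 * T + 2), ∑ s, c τ s, fun w hw => ?_⟩
  unfold pairing
  simp only [Finset.sum_mul]
  exact Finset.sum_congr rfl fun τ _ => Finset.sum_congr rfl fun s _ => hc τ s w hw

theorem sensAt_data (τ : ℕ) (q : Data d) :
    ∃ c : ZMod 2, ∀ w, sensAt b w τ (Sum.inl q) = c * w q := by
  unfold sensAt
  by_cases h0 : τ = 0
  · exact ⟨0, fun w => by simp [h0]⟩
  · simp only [h0, if_false, sens]
    by_cases h : (τ - 1) % 7 = 2 ∧ (meet ((τ - 1) / 7) 0 q).IsStab ∧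
        (meet ((τ - 1) / 7) 0 q).type = b
    · exact ⟨0, fun w => by simp [h]⟩
    · exact ⟨1, fun w => by simp [h]⟩

/-- An ancilla atom about to be shuttled to `q` already acts on `w` through `w q` or not at all, so
the atom affects a single data qubit throughout. -/
theorem sensAt_servesAs {q : Data d} {τ : ℕ} {s : Site d} (h : ServesAs q τ s) :
    ∃ c : ZMod 2, ∀ w, sensAt b w τ s = c * w q := by
  rcases h with rfl | ⟨k, P, hP, hc, rfl, rfl | rfl⟩
  · exact sensAt_data τ q
  · by_cases h : P.type = b
    · exact ⟨1, fun w => by rw [sensAt_round b w k (by norm_num)]; simp [sens, hP, h, hc]⟩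
    · exact ⟨0, fun w => by rw [sensAt_round b w k (by norm_num)]; simp [sens, hP, h]⟩
  · exact ⟨1, fun w => by rw [sensAt_round b w k (by norm_num)]; simp [sens, hP, hc]⟩

/-- In the first half of its life, an atom which ends as the ancilla `P` only affects the first
corner of `P`. -/
theorem sensAt_endsAt_early {k : ℕ} {P : Plaq d} (hP : P.IsStab) {τ : ℕ} {s : Site d}
    (h : EndsAt k P τ s) (hτ : τ ≤ 7 * k + 1 + 3) :
    ∃ c : ZMod 2, ∀ w, sensAt b w τ s = c * optVal w (cor k 0 P) := by
  rcases h with ⟨h1, h2, rfl⟩ | ⟨h1, ⟨q, hq, h2⟩ | ⟨h2, rfl, h3⟩⟩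
  · obtain rfl : τ = 7 * k + 1 + 3 := by omega
    by_cases h : P.type = b
    · exact ⟨0, fun w => by rw [sensAt_round b w k (by norm_num)]; simp [sens, hP, h]⟩
    · exact ⟨1, fun w => by rw [sensAt_round b w k (by norm_num)]; simp [sens, hP, h]⟩
  · obtain ⟨c, hc⟩ := sensAt_servesAs (b := b) h2
    exact ⟨c, fun w => by rw [hc, hq]; rfl⟩
  · refine ⟨0, fun w => ?_⟩
    have : τ = 7 * k + 1 + 1 ∨ τ = 7 * k + 1 + 2 := by omega
    rcases this with rfl | rfl <;> rw [sensAt_round b w k (by norm_num)] <;> simp [sens, hP, h2]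

theorem sensAt_anc_late {k i : ℕ} {P : Plaq d} (hi : 3 ≤ i) (hi' : i ≤ 6) (hne : P.type = b)
    (w : Data d → ZMod 2) : sensAt b w (7 * k + 1 + i) (Sum.inr P) = 0 := by
  rw [sensAt_round b w k (by omega)]
  interval_cases i <;> simp [sens, hne]

theorem sensAt_anc_four {k : ℕ} {P : Plaq d} (hP : P.IsStab) (hne : P.type ≠ b)
    (w : Data d → ZMod 2) : sensAt b w (7 * k + 1 + 4) (Sum.inr P) =
      optVal w (cor k 2 P) + optVal w (cor k 3 P) := by
  rw [sensAt_round b w k (by omega)]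
  simp [sens, hP, hne]

theorem sensAt_anc_five {k : ℕ} {P : Plaq d} (hP : P.IsStab) (hne : P.type ≠ b)
    (w : Data d → ZMod 2) :
    sensAt b w (7 * k + 1 + 5) (Sum.inr P) = optVal w (cor k 3 P) := by
  rw [sensAt_round b w k (by omega)]
  simp [sens, hP, hne]

theorem sensAt_anc_six {k : ℕ} {P : Plaq d} (w : Data d → ZMod 2) :
    sensAt b w (7 * k + 1 + 6) (Sum.inr P) = 0 := by
  rw [sensAt_round b w k (by omega)]
  simp [sens]

theorem dataCoord_eq_none {i : Fin (d + 1)} {far : Bool} :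
    dataCoord i far = none ↔ if far then i.val = d else i.val = 0 := by
  have := i.isLt
  unfold dataCoord
  cases far <;> simp <;> omega

theorem Plaq.corner_eq_none {P : Plaq d} {c : Corner} :
    P.corner c = none ↔ dataCoord P.1 c.1 = none ∨ dataCoord P.2 c.2 = none := by
  unfold Plaq.corner
  cases dataCoord P.1 c.1 <;> cases dataCoord P.2 c.2 <;> simp

/-- Whether a stabilizer has the corner of layer `t` only depends on the half of the round. -/
theorem cor_eq_none {k t : ℕ} {P : Plaq d} (hP : P.IsStab) :
    cor k t P = none ↔ dataCoord (match P.type with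
      | Basis.X => P.1
      | Basis.Z => P.2) (orderHi k t) = none := by
  unfold cor
  rw [Plaq.corner_eq_none]
  have h := hP.cases
  cases hty : P.type
  · rw [Plaq.type_eq_X] at hty
    rw [order_X]
    simp only [dataCoord_eq_none]
    cases orderHi k t <;> cases orderLo k t <;> simp only [Bool.false_eq_true, if_true, if_false] <;>
      omega
  · rw [Plaq.type_eq_Z] at hty
    rw [order_Z]
    simp only [dataCoord_eq_none]
    cases orderHi k t <;> cases orderLo k t <;> simp only [Bool.false_eq_true, if_true, if_false] <;>
      omega

theorem cor_none_first {k : ℕ} {P : Plaq d} (hP : P.IsStab) :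
    cor k 0 P = none ↔ cor k 1 P = none := by
  rw [cor_eq_none hP, cor_eq_none hP]
  rfl

theorem cor_none_second {k : ℕ} {P : Plaq d} (hP : P.IsStab) :
    cor k 2 P = none ↔ cor k 3 P = none := by
  rw [cor_eq_none hP, cor_eq_none hP]
  rfl

theorem role_cnot_anc {k t : ℕ} {P : Plaq d} (hP : P.IsStab) (h : cor k t P ≠ none) :
    (cnotLayer k t (Sum.inr P)).role = some (match P.type with
      | Basis.X => Basis.Z
      | Basis.Z => Basis.X) := by
  rw [cnotLayer_anc, if_pos hP]
  cases hc : cor k t P with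
  | none => exact absurd hc h
  | some q => cases hty : P.type <;> simp [Op.role]

/-- Ancillas do not change their role between the second and the third, or the third and the
fourth CNOT. -/
theorem not_roleChange {k i t : ℕ} (hk : k < T) {P : Plaq d} (hP : P.IsStab)
    (hi : (i = 4 ∧ t = 1) ∨ (i = 5 ∧ t = 2)) (h : cor k t P ≠ none) (h' : cor k (t + 1) P ≠ none) :
    ¬(midSwap d T b).RoleChange (7 * k + 1 + i) (Sum.inr P) := by
  rintro ⟨β, β', h1, h2, h3⟩
  have hl : (roundLayer k (i - 1) : Site d → _) = cnotLayer k t := by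
    rcases hi with ⟨rfl, rfl⟩ | ⟨rfl, rfl⟩ <;> rfl
  have hl' : (roundLayer k i : Site d → _) = cnotLayer k (t + 1) := by
    rcases hi with ⟨rfl, rfl⟩ | ⟨rfl, rfl⟩ <;> rfl
  have hop : (midSwap d T b).op (7 * k + 1 + (i - 1)) = cnotLayer k t := by
    rw [midSwap_op_round hk (by omega), hl]
  rw [midSwap_op_round hk (by omega), hl', role_cnot_anc hP h'] at h1
  rw [show 7 * k + 1 + i = (7 * k + 1 + (i - 1)) + 1 by omega, lastRole, hop] at h2
  have hr := role_cnot_anc hP h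
  cases ho : cnotLayer k t (Sum.inr P) with
  | nop => simp [ho, Op.role] at hr
  | idle => simp [ho, Op.role] at hr
  | swap _ => simp [ho, Op.role] at hr
  | reset _ => rw [ho] at h2 hr; simp only at h2; rw [hr] at h2; rw [h1] at h2; simp_all
  | meas _ => rw [ho] at h2 hr; simp only at h2; rw [hr] at h2; rw [h1] at h2; simp_all
  | ctrl _ => rw [ho] at h2 hr; simp only at h2; rw [hr] at h2; rw [h1] at h2; simp_all
  | targ _ => rw [ho] at h2 hr; simp only at h2; rw [hr] at h2; rw [h1] at h2; simp_all

theorem onWire_of_relevant {ℓ : (midSwap d T b).LossLoc} {m : (midSwap d T b).Meas}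
    (hm : (midSwap d T b).Detects ℓ m) {τ : ℕ} {s : Site d}
    (h : (midSwap d T b).Relevant ℓ τ s) :
    (midSwap d T b).OnWire τ s m.1.1 m.1.2 :=
  h.1.tail hm (h.1.le_meas hm m.2)

theorem onWire_of_ne_zero {m : (midSwap d T b).Meas} {e : Config (Site d)}
    (he : e ∈ (midSwap d T b).atomEnvelope m) {τ : ℕ} {s : Site d} (h : e τ s ≠ 0) :
    (midSwap d T b).OnWire τ s m.1.1 m.1.2 := by
  obtain ⟨ℓ, hm, he⟩ := he
  exact onWire_of_relevant hm (he τ s h)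

/-- The ways in which the loss of an atom that ends as the ancilla `P` affects the data. -/
theorem pairing_atomEnvelope {k : ℕ} {P : Plaq d} (hk : k < T) (hP : P.IsStab)
    (hne : P.type ≠ b) {m : (midSwap d T b).Meas} (hm1 : m.1.1.val = 7 * k + 1 + 6)
    (hm2 : m.1.2 = Sum.inr P) {e : Config (Site d)} (he : e ∈ (midSwap d T b).atomEnvelope m) :
    ∃ c, (∀ w, Commutes b w → pairing T b w e = c * optVal w (cor k 0 P)) ∨
      (∀ w, Commutes b w →
        pairing T b w e = c * (optVal w (cor k 2 P) + optVal w (cor k 3 P))) ∨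
      (∀ w, Commutes b w → pairing T b w e = c * optVal w (cor k 3 P)) := by
  obtain ⟨ℓ, hdet, he⟩ := he
  have hends : ∀ τ s, e τ s ≠ 0 → EndsAt k P τ s := by
    intro τ s h
    refine endsAt_of_onWire (b := b) hk hP ?_
    rw [← hm1, ← hm2]
    exact onWire_of_relevant hdet (he τ s h)
  have hlate : ∀ τ s, e τ s ≠ 0 → 7 * k + 1 + 3 < τ →
      (τ = 7 * k + 1 + 4 ∨ τ = 7 * k + 1 + 5 ∨ τ = 7 * k + 1 + 6) ∧ s = Sum.inr P := by
    intro τ s h h'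
    rcases hends τ s h with ⟨h1, h2, h3⟩ | ⟨h1, _⟩
    · exact ⟨by omega, h3⟩
    · omega
  -- Without the first two corners, commutation makes the weights of the other two corners cancel,
  -- and only corner 3 alone is left.
  by_cases h01 : cor k 0 P = none
  · have h1 := (cor_none_first hP).1 h01
    obtain ⟨c, hc⟩ := pairing_of_support (T := T) (b := b) (fun w => optVal w (cor k 3 P)) e (by
      intro τ s h
      by_cases hτ : τ ≤ 7 * k + 1 + 3
      · obtain ⟨c, hc⟩ := sensAt_endsAt_early (b := b) hP (hends τ s h) hτ
        exact ⟨0, fun w _ => by rw [hc, h01]; simp⟩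
      · obtain ⟨rfl | rfl | rfl, rfl⟩ := hlate τ s h (by omega)
        · refine ⟨0, fun w hw => ?_⟩
          have := hw k P hP hne
          rw [h01, h1] at this
          rw [sensAt_anc_four hP hne]
          simpa using this
        · exact ⟨1, fun w _ => by rw [sensAt_anc_five hP hne, one_mul]⟩
        · exact ⟨0, fun w _ => by rw [sensAt_anc_six, zero_mul]⟩)
    exact ⟨c, Or.inr (Or.inr hc)⟩
  -- Without the last two corners, nothing after the second CNOT matters.
  by_cases h23 : cor k 2 P = none
  · have h3 := (cor_none_second hP).1 h23
    obtain ⟨c, hc⟩ := pairing_of_support (T := T) (b := b) (fun w => optVal w (cor k 0 P)) e (by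
      intro τ s h
      by_cases hτ : τ ≤ 7 * k + 1 + 3
      · obtain ⟨c, hc⟩ := sensAt_endsAt_early (b := b) hP (hends τ s h) hτ
        exact ⟨c, fun w _ => hc w⟩
      · obtain ⟨rfl | rfl | rfl, rfl⟩ := hlate τ s h (by omega)
        · exact ⟨0, fun w _ => by rw [sensAt_anc_four hP hne, h23, h3]; simp⟩
        · exact ⟨0, fun w _ => by rw [sensAt_anc_five hP hne, h3]; simp⟩
        · exact ⟨0, fun w _ => by rw [sensAt_anc_six, zero_mul]⟩)
    exact ⟨c, Or.inl hc⟩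
  have h1 : cor k 1 P ≠ none := fun h => h01 ((cor_none_first hP).2 h)
  have h3 : cor k 3 P ≠ none := fun h => h23 ((cor_none_second hP).2 h)
  -- A complete ancilla undergoes no Hadamard between the second, third and fourth CNOT, so the
  -- places before layers 4 and 5 can only be relevant as the loss location itself. This prevents
  -- one loss from combining the different late effects.
  have hrel : ∀ τ s, e τ s ≠ 0 → ℓ.1.1.val + 1 ≤ τ ∧ ∀ i, (i = 4 ∨ i = 5) →
      τ = 7 * k + 1 + i → τ = ℓ.1.1.val + 1 := by
    intro τ s h
    refine ⟨(he τ s h).1.1, ?_⟩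
    rintro i hi rfl
    obtain ⟨-, rfl⟩ := hlate _ s h (by omega)
    rcases (he _ _ h).2 with h4 | h4 | h4
    · exact h4
    · exfalso
      rcases hi with rfl | rfl
      · exact not_roleChange hk hP (Or.inl ⟨rfl, rfl⟩) h1 h23 h4
      · exact not_roleChange hk hP (Or.inr ⟨rfl, rfl⟩) h23 h3 h4
    · exfalso
      rw [midSwap_op_round hk (by omega)] at h4
      have : ∀ t, cor k t P ≠ none → (cnotLayer k t (Sum.inr P)).isMeas = true → False := by
        intro t ht h4
        rw [cnotLayer_anc, if_pos hP] at h4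
        cases hc : cor k t P with
        | none => exact ht hc
        | some q => cases hty : P.type <;> simp [hc, hty, Op.isMeas] at h4
      rcases hi with rfl | rfl
      · exact this 2 h23 h4
      · exact this 3 h3 h4
  -- A loss before layer 4 leaves only the early effect on corner 0, a loss right before layer 4 the
  -- hook on corners 2 and 3, and a later one at most corner 3.
  rcases lt_trichotomy (ℓ.1.1.val + 1) (7 * k + 1 + 4) with hl | hl | hl
  · obtain ⟨c, hc⟩ := pairing_of_support (T := T) (b := b) (fun w => optVal w (cor k 0 P)) e (by
      intro τ s h
      have hr := hrel τ s h
      by_cases hτ : τ ≤ 7 * k + 1 + 3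
      · obtain ⟨c, hc⟩ := sensAt_endsAt_early (b := b) hP (hends τ s h) hτ
        exact ⟨c, fun w _ => hc w⟩
      · obtain ⟨h4 | h4 | rfl, rfl⟩ := hlate τ s h (by omega)
        · have := hr.2 4 (by simp) h4; omega
        · have := hr.2 5 (by simp) h4; omega
        · exact ⟨0, fun w _ => by rw [sensAt_anc_six, zero_mul]⟩)
    exact ⟨c, Or.inl hc⟩
  · obtain ⟨c, hc⟩ := pairing_of_support (T := T) (b := b)
      (fun w => optVal w (cor k 2 P) + optVal w (cor k 3 P)) e (by
      intro τ s h
      have hr := hrel τ s h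
      obtain ⟨rfl | h4 | rfl, rfl⟩ := hlate τ s h (by omega)
      · exact ⟨1, fun w _ => by rw [sensAt_anc_four hP hne, one_mul]⟩
      · have := hr.2 5 (by simp) h4; omega
      · exact ⟨0, fun w _ => by rw [sensAt_anc_six, zero_mul]⟩)
    exact ⟨c, Or.inr (Or.inl hc)⟩
  · obtain ⟨c, hc⟩ := pairing_of_support (T := T) (b := b) (fun w => optVal w (cor k 3 P)) e (by
      intro τ s h
      have hr := hrel τ s h
      obtain ⟨rfl | rfl | rfl, rfl⟩ := hlate τ s h (by omega)
      · omega
      · exact ⟨1, fun w _ => by rw [sensAt_anc_five hP hne, one_mul]⟩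
      · exact ⟨0, fun w _ => by rw [sensAt_anc_six, zero_mul]⟩)
    exact ⟨c, Or.inr (Or.inr hc)⟩

theorem eq_first_of_sum {k : ℕ} {P : Plaq d} (hP : P.IsStab) (hne : P.type ≠ b)
    {w : Data d → ZMod 2} (hw : Commutes b w) :
    optVal w (cor k 1 P) =
      optVal w (cor k 0 P) + (optVal w (cor k 2 P) + optVal w (cor k 3 P)) := by
  have := hw k P hP hne
  generalize optVal w (cor k 0 P) = x0 at *
  generalize optVal w (cor k 1 P) = x1 at *
  generalize optVal w (cor k 2 P) = x2 at *
  generalize optVal w (cor k 3 P) = x3 at *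
  revert x0 x1 x2 x3
  decide

/-- Corner 0 together with corners 2 and 3 would not be narrow, but against commuting `w` it is
equivalent to corner 1 alone. -/
theorem thin_first_hook {k : ℕ} {P : Plaq d} (hP : P.IsStab) (hne : P.type ≠ b) (c c' : ZMod 2)
    {e : Config (Site d)} (h : ∀ w, Commutes b w → pairing T b w e =
      c * optVal w (cor k 0 P) + c' * (optVal w (cor k 2 P) + optVal w (cor k 3 P))) :
    Thin T b e := by
  rcases zmod2_cases c with rfl | rfl
  · exact thin_pair hne (k := k) (s := 2) (t := 3) rfl c' c' (fun w hw => by rw [h w hw]; ring)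
  rcases zmod2_cases c' with rfl | rfl
  · exact thin_single (cor k 0 P) 1 (fun w hw => by rw [h w hw]; ring)
  · exact thin_single (cor k 1 P) 1 (fun w hw => by
      rw [h w hw, eq_first_of_sum hP hne hw]; ring)

/-- The actual error of an atom and the one assumed by the decoder may belong to different loss
locations. Their sum must be thin for each atom to count only once in the distance bound. Of the
combined effects on an ancilla of the other type, corner 0 with corner 3 is a diagonal, corners 2
and 3 share a row, and corner 0 with the hook reduces to corner 1. -/
theorem thin_atoms {m : (midSwap d T b).Meas} {e e' : Config (Site d)}
    (he : e ∈ (midSwap d T b).atomEnvelope m) (he' : e' ∈ (midSwap d T b).atomEnvelope m) :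
    Thin T b (e + e') := by
  have hsup : ∀ τ s, (e + e') τ s ≠ 0 → (midSwap d T b).OnWire τ s m.1.1 m.1.2 := by
    intro τ s h
    by_cases h1 : e τ s = 0
    · exact onWire_of_ne_zero he' (fun h2 => h (by simp [h1, h2]))
    · exact onWire_of_ne_zero he h1
  rcases meas_cases m with ⟨q, hm1, hm2⟩ | ⟨k, P, hk, hP, hm1, hm2⟩
  · obtain ⟨c, hc⟩ := pairing_of_support (T := T) (b := b) (fun w => w q) (e + e') (by
      intro τ s h
      have := hsup τ s h
      rw [hm1, hm2] at this
      obtain ⟨c, hc⟩ := sensAt_servesAs (b := b) (servesAs_of_onWire this)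
      exact ⟨c, fun w _ => hc w⟩)
    exact thin_single (some q) c hc
  by_cases hne : P.type = b
  · obtain ⟨c, hc⟩ := pairing_of_support (T := T) (b := b) (fun w => optVal w (cor k 0 P)) (e + e') (by
      intro τ s h
      have := hsup τ s h
      rw [hm1, hm2] at this
      have hends := endsAt_of_onWire hk hP this
      by_cases hτ : τ ≤ 7 * k + 1 + 3
      · obtain ⟨c, hc⟩ := sensAt_endsAt_early (b := b) hP hends hτ
        exact ⟨c, fun w _ => hc w⟩
      · rcases hends with ⟨h1, h2, rfl⟩ | ⟨h1, _⟩
        · obtain ⟨i, rfl⟩ : ∃ i, τ = 7 * k + 1 + i := ⟨τ - (7 * k + 1), by omega⟩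
          exact ⟨0, fun w _ => by rw [sensAt_anc_late (by omega) (by omega) hne, zero_mul]⟩
        · omega)
    exact thin_single _ c hc
  · obtain ⟨c, h⟩ := pairing_atomEnvelope hk hP hne hm1 hm2 he
    obtain ⟨c', h'⟩ := pairing_atomEnvelope hk hP hne hm1 hm2 he'
    rcases h with h | h | h <;> rcases h' with h' | h' | h'
    · exact thin_single (cor k 0 P) (c + c') fun w hw => by
        rw [pairing_add, h w hw, h' w hw]; ring
    · exact thin_first_hook hP hne c c' (k := k) fun w hw => by
        rw [pairing_add, h w hw, h' w hw]
    · exact thin_pair hne (k := k) (s := 0) (t := 3) rfl c c' fun w hw => by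
        rw [pairing_add, h w hw, h' w hw]
    · exact thin_first_hook hP hne c' c (k := k) fun w hw => by
        rw [pairing_add, h w hw, h' w hw]; ring
    · exact thin_pair hne (k := k) (s := 2) (t := 3) rfl (c + c') (c + c') fun w hw => by
        rw [pairing_add, h w hw, h' w hw]; ring
    · exact thin_pair hne (k := k) (s := 2) (t := 3) rfl c (c + c') fun w hw => by
        rw [pairing_add, h w hw, h' w hw]; ring
    · exact thin_pair hne (k := k) (s := 0) (t := 3) rfl c' c fun w hw => by
        rw [pairing_add, h w hw, h' w hw]; ring
    · exact thin_pair hne (k := k) (s := 2) (t := 3) rfl c' (c + c') fun w hw => by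
        rw [pairing_add, h w hw, h' w hw]; ring
    · exact thin_single (cor k 3 P) (c + c') fun w hw => by
        rw [pairing_add, h w hw, h' w hw]; ring

end AtomLoss

namespace AtomLoss

variable {d T : ℕ} {b : Basis}

open Experiment

/-! ## Narrowness of Pauli faults -/

theorem thin_zero {e : Config (Site d)}
    (h : ∀ τ s, e τ s ≠ 0 → ∀ w, sensAt b w τ s = 0) : Thin T b e := by
  obtain ⟨c, hc⟩ := pairing_of_support (T := T) (b := b) (fun w => optVal w none) e
    (fun τ s h' => ⟨0, fun w _ => by rw [h τ s h' w]; simp⟩)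
  exact thin_single none c hc

/-- At a single site the sensitivity is a multiple of the weight of one data qubit, except on
ancillas of the other type right before layer 4, where it is the hook on corners 2 and 3. -/
theorem thin_site {e : Config (Site d)} {τ₀ : ℕ} {s₀ : Site d}
    (h : ∀ τ s, e τ s ≠ 0 → τ = τ₀ ∧ s = s₀) : Thin T b e := by
  have hΛ : ∀ Λ : (Data d → ZMod 2) → ZMod 2,
      (∃ c : ZMod 2, ∀ w, sensAt b w τ₀ s₀ = c * Λ w) →
      ∃ c, ∀ w, Commutes b w → pairing T b w e = c * Λ w := by
    rintro Λ ⟨c, hc⟩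
    refine pairing_of_support Λ e fun τ s hne => ?_
    obtain ⟨rfl, rfl⟩ := h τ s hne
    exact ⟨c, fun w _ => hc w⟩
  rcases s₀ with q | P
  · obtain ⟨c, hc⟩ := hΛ (fun w => optVal w (some q)) (sensAt_data τ₀ q)
    exact thin_single _ c hc
  by_cases h0 : τ₀ = 0
  · refine thin_zero fun τ s hne w => ?_
    rw [(h τ s hne).1, h0, sensAt_zero]
    rfl
  obtain ⟨k, i, hi, rfl⟩ : ∃ k i, i < 7 ∧ τ₀ = 7 * k + 1 + i :=
    ⟨(τ₀ - 1) / 7, (τ₀ - 1) % 7, by omega, by omega⟩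
  by_cases hP : P.IsStab
  swap
  · refine thin_zero fun τ s hne w => ?_
    rw [(h τ s hne).1, (h τ s hne).2, sensAt_round b w k hi]
    simp [sens, hP]
  by_cases hlt : (i = 4 ∨ i = 5) ∧ P.type ≠ b
  · obtain ⟨h45, hne⟩ := hlt
    rcases h45 with rfl | rfl
    · obtain ⟨c, hc⟩ := hΛ _ ⟨1, fun w => by rw [sensAt_anc_four hP hne, one_mul]⟩
      exact thin_pair hne (k := k) (s := 2) (t := 3) rfl c c fun w hw => by rw [hc w hw]; ring
    · obtain ⟨c, hc⟩ := hΛ _ ⟨1, fun w => by rw [sensAt_anc_five hP hne, one_mul]⟩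
      exact thin_single _ c hc
  · obtain ⟨c, hc⟩ := hΛ (fun w => optVal w (cor k 0 P)) (by
      have : ∀ c : ZMod 2, (∀ w, sens b w k i (Sum.inr P) = c * optVal w (cor k 0 P)) →
          ∃ c : ZMod 2, ∀ w, sensAt b w (7 * k + 1 + i) (Sum.inr P) =
            c * optVal w (cor k 0 P) := fun c hc =>
        ⟨c, fun w => by rw [sensAt_round b w k hi, hc]⟩
      by_cases hty : P.type = b
      · interval_cases i
        · exact this 0 fun w => by simp [sens]
        · exact this 1 fun w => by simp [sens, hP, hty]
        · exact this 1 fun w => by simp [sens, hP]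
        all_goals exact this 0 fun w => by simp [sens, hty]
      · interval_cases i
        · exact this 0 fun w => by simp [sens]
        · exact this 0 fun w => by simp [sens, hty]
        · exact this 1 fun w => by simp [sens, hP]
        · exact this 1 fun w => by simp [sens, hP, hty]
        · exact absurd ⟨Or.inl rfl, hty⟩ hlt
        · exact absurd ⟨Or.inr rfl, hty⟩ hlt
        · exact this 0 fun w => by simp [sens])
    exact thin_single _ c hc

theorem pairing_two_sites {e : Config (Site d)} {τ₀ : ℕ} {s₁ s₂ : Site d}
    (h : ∀ τ s, e τ s ≠ 0 → τ = τ₀ ∧ (s = s₁ ∨ s = s₂)) :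
    ∃ c c' : ZMod 2, ∀ w, Commutes b w →
      pairing T b w e = c * sensAt b w τ₀ s₁ + c' * sensAt b w τ₀ s₂ := by
  classical
  let e₁ : Config (Site d) := fun τ s => if s = s₁ then e τ s else 0
  let e₂ : Config (Site d) := fun τ s => if s = s₁ then 0 else e τ s
  have he : e = e₁ + e₂ := by
    funext τ s
    simp only [Pi.add_apply, e₁, e₂]
    split_ifs <;> simp
  obtain ⟨c, hc⟩ := pairing_of_support (T := T) (b := b) (fun w => sensAt b w τ₀ s₁) e₁ (by
    intro τ s hne
    simp only [e₁] at hne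
    split_ifs at hne with hs
    · exact ⟨1, fun w _ => by rw [(h τ s hne).1, hs, one_mul]⟩
    · exact absurd rfl hne)
  obtain ⟨c', hc'⟩ := pairing_of_support (T := T) (b := b) (fun w => sensAt b w τ₀ s₂) e₂ (by
    intro τ s hne
    simp only [e₂] at hne
    split_ifs at hne with hs
    · exact absurd rfl hne
    · exact ⟨1, fun w _ => by rw [(h τ s hne).1, ((h τ s hne).2.resolve_left hs), one_mul]⟩)
  exact ⟨c, c', fun w hw => by rw [he, pairing_add, hc w hw, hc' w hw]⟩

/-- After a CNOT with an ancilla of the other type, the two sites act as follows. After the first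
CNOT both act on the same data qubit; after the second, on corner 1 and on the hook, whose sum is
corner 0; after the third, on corners 2 and 3; after the fourth the ancilla has no effect. Ancillas
of type `b` matter only before the shuttling step, and then through `q` itself. -/
theorem thin_cnot {e : Config (Site d)} {k i t : ℕ} {q : Data d} (hP : (meet k t q).IsStab)
    (hi : (i = 1 ∧ t = 0) ∨ (i = 3 ∧ t = 1) ∨ (i = 4 ∧ t = 2) ∨ (i = 5 ∧ t = 3))
    (h : ∀ τ s, e τ s ≠ 0 → τ = 7 * k + 1 + (i + 1) ∧
      (s = Sum.inl q ∨ s = Sum.inr (meet k t q))) : Thin T b e := by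
  obtain ⟨c, c', hc⟩ := pairing_two_sites (T := T) (b := b) h
  obtain ⟨x, hx⟩ := sensAt_data (b := b) (7 * k + 1 + (i + 1)) q
  simp only [hx, ← mul_assoc] at hc
  by_cases hty : (meet k t q).type = b
  · by_cases ht : i = 1
    · obtain rfl : t = 0 := by omega
      subst ht
      refine thin_single (some q) (c * x + c') fun w hw => ?_
      rw [hc w hw, sensAt_round b w k (by omega)]
      simp only [sens, hP, if_true, cor_meet, optVal_some]
      ring
    · refine thin_single (some q) (c * x) fun w hw => ?_
      rw [hc w hw, sensAt_anc_late (by omega) (by omega) hty, optVal_some]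
      ring
  · rcases hi with ⟨rfl, rfl⟩ | ⟨rfl, rfl⟩ | ⟨rfl, rfl⟩ | ⟨rfl, rfl⟩
    · refine thin_single (some q) (c * x + c') fun w hw => ?_
      rw [hc w hw, sensAt_round b w k (by omega)]
      simp only [sens, hP, if_true, cor_meet, optVal_some]
      ring
    · have hq : ∀ w, w q = optVal w (cor k 1 (meet k 1 q)) := fun w => by rw [cor_meet]; rfl
      rcases zmod2_cases (c * x) with h0 | h0 <;> simp only [h0] at hc
      · refine thin_first_hook hP hty (k := k) 0 c' fun w hw => ?_
        rw [hc w hw, sensAt_anc_four hP hty]; ring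
      · rcases zmod2_cases c' with rfl | rfl
        · refine thin_single (some q) 1 fun w hw => ?_
          rw [hc w hw, optVal_some]; ring
        · refine thin_first_hook hP hty (k := k) 1 0 fun w hw => ?_
          rw [hc w hw, sensAt_anc_four hP hty, hq w, eq_first_of_sum hP hty hw]
          linear_combination zmod2_self_add (optVal w (cor k 2 (meet k 1 q)) +
            optVal w (cor k 3 (meet k 1 q)))
    · refine thin_pair hty (k := k) (s := 2) (t := 3) rfl (c * x) c' fun w hw => ?_
      rw [hc w hw, sensAt_anc_five hP hty, cor_meet, optVal_some]
    · refine thin_single (some q) (c * x) fun w hw => ?_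
      rw [hc w hw, sensAt_anc_six, optVal_some]
      ring

theorem cnotLayer_eq_ctrl {k t : ℕ} {s s' : Site d} (h : cnotLayer k t s = Op.ctrl s') :
    ∃ q, (meet k t q).IsStab ∧ ((s = Sum.inl q ∧ s' = Sum.inr (meet k t q)) ∨
      (s' = Sum.inl q ∧ s = Sum.inr (meet k t q))) := by
  rcases s with q | P
  · rw [cnotLayer_data] at h
    split_ifs at h with h1
    cases hty : (meet k t q).type <;> simp only [hty] at h <;> cases h
    exact ⟨q, h1, Or.inl ⟨rfl, rfl⟩⟩
  · rw [cnotLayer_anc] at h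
    split_ifs at h with h1
    cases hc : cor k t P with
    | none => simp [hc] at h
    | some q =>
      cases hty : P.type <;> simp only [hty, hc] at h <;> cases h
      have := cor_eq_some.1 hc
      subst this
      exact ⟨q, h1, Or.inr ⟨rfl, rfl⟩⟩

theorem midSwap_op_eq_ctrl {τ : ℕ} {s s' : Site d} (h : (midSwap d T b).op τ s = Op.ctrl s') :
    ∃ k i t q, k < T ∧ τ = 7 * k + 1 + i ∧
      ((i = 1 ∧ t = 0) ∨ (i = 3 ∧ t = 1) ∨ (i = 4 ∧ t = 2) ∨ (i = 5 ∧ t = 3)) ∧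
      (meet k t q).IsStab ∧ ((s = Sum.inl q ∧ s' = Sum.inr (meet k t q)) ∨
      (s' = Sum.inl q ∧ s = Sum.inr (meet k t q))) := by
  rcases time_cases T τ with rfl | ⟨k, i, hk, hi, rfl⟩ | rfl | h1
  · rw [midSwap_op_zero] at h
    rcases s with q | P <;> cases h
  · rw [midSwap_op_round hk hi] at h
    interval_cases i <;> simp only [roundLayer] at h
    · rcases s with q | P
      · cases h
      · simp only [ancillaLayer] at h; split_ifs at h
    · obtain ⟨q, hq⟩ := cnotLayer_eq_ctrl h
      exact ⟨k, 1, 0, q, hk, rfl, by omega, hq⟩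
    · rcases s with q | P
      · rw [swapLayer_data] at h; split_ifs at h
      · rw [swapLayer_anc] at h
        split_ifs at h
        cases hc : cor k 0 P <;> simp [hc] at h
    · obtain ⟨q, hq⟩ := cnotLayer_eq_ctrl h
      exact ⟨k, 3, 1, q, hk, rfl, by omega, hq⟩
    · obtain ⟨q, hq⟩ := cnotLayer_eq_ctrl h
      exact ⟨k, 4, 2, q, hk, rfl, by omega, hq⟩
    · obtain ⟨q, hq⟩ := cnotLayer_eq_ctrl h
      exact ⟨k, 5, 3, q, hk, rfl, by omega, hq⟩
    · rcases s with q | P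
      · cases h
      · simp only [ancillaLayer] at h; split_ifs at h
  · rw [midSwap_op_final] at h
    rcases s with q | P <;> cases h
  · rw [midSwap_op_void h1] at h
    cases h

section Support

variable {S D : Type} [DecidableEq S] (C : Experiment S D)

theorem Experiment.faultConfig_ctrl {ℓ : C.PauliLoc} {t : S} (ht : C.op ℓ.1.1 ℓ.1.2 = Op.ctrl t)
    {v : Pauli × Pauli} {σ : ℕ} {s : S} (h : C.faultConfig ℓ v σ s ≠ 0) :
    σ = ℓ.1.1 + 1 ∧ (s = ℓ.1.2 ∨ s = t) := by
  unfold faultConfig at h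
  rw [ht] at h
  simp only at h
  by_contra hcon
  apply h
  rw [if_neg (by tauto), if_neg (by tauto), add_zero]

theorem Experiment.faultConfig_not_ctrl (ℓ : C.PauliLoc) (ht : ∀ t, C.op ℓ.1.1 ℓ.1.2 ≠ Op.ctrl t) :
    ∃ τ₀, (τ₀ = ℓ.1.1.val ∨ τ₀ = ℓ.1.1 + 1) ∧ ∀ v σ s, C.faultConfig ℓ v σ s ≠ 0 →
      σ = τ₀ ∧ s = ℓ.1.2 := by
  cases ho : C.op ℓ.1.1 ℓ.1.2 with
  | meas β =>
    refine ⟨ℓ.1.1, Or.inl rfl, fun v σ s h => ?_⟩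
    unfold faultConfig at h
    rw [ho] at h
    simp only at h
    by_contra hcon
    exact h (if_neg hcon)
  | ctrl t => exact absurd ho (ht t)
  | _ =>
    refine ⟨ℓ.1.1 + 1, Or.inr rfl, fun v σ s h => ?_⟩
    unfold faultConfig at h
    rw [ho] at h
    simp only at h
    by_contra hcon
    exact h (if_neg hcon)

end Support

theorem thin_fault (ℓ : (midSwap d T b).PauliLoc) (v : Pauli × Pauli) :
    Thin T b ((midSwap d T b).faultConfig ℓ v) := by
  by_cases hc : ∃ t, (midSwap d T b).op ℓ.1.1 ℓ.1.2 = Op.ctrl t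
  · obtain ⟨s', hs'⟩ := hc
    obtain ⟨k, i, t, q, hk, hτ, hi, hP, hq⟩ := midSwap_op_eq_ctrl hs'
    refine thin_cnot hP hi fun τ s h => ?_
    obtain ⟨h1, h2⟩ := (midSwap d T b).faultConfig_ctrl hs' h
    refine ⟨by omega, ?_⟩
    rcases hq with ⟨h3, h4⟩ | ⟨h3, h4⟩ <;> rw [h3, h4] at h2 <;> tauto
  · push Not at hc
    obtain ⟨τ₀, -, h⟩ := (midSwap d T b).faultConfig_not_ctrl ℓ hc
    exact thin_site fun τ s => h v τ s

end AtomLoss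

namespace AtomLoss

variable {d T : ℕ} {b : Basis}

open Experiment

/-! ## Sensitivity of the stabilizer measurements -/

theorem single_cor {k t : ℕ} {P : Plaq d} {q : Data d} :
    single (cor k t P) q = if meet k t q = P then 1 else 0 := by
  unfold single
  simp only [cor_eq_some]

/-- Whether the corners `f` of `i` and `f'` of `i'` coincide, in one coordinate. -/
def agree (i : Fin (d + 1)) (f : Bool) (i' : Fin (d + 1)) (f' : Bool) : ZMod 2 :=
  if ∃ a, plaqCoord a f = i ∧ plaqCoord a f' = i' then 1 else 0

theorem agree_self (i i' : Fin (d + 1)) (f : Bool) :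
    agree i f i' f = if i.val = i'.val ∧ (if f then i.val < d else 0 < i.val) then 1 else 0 := by
  unfold agree
  congr 1
  apply propext
  constructor
  · rintro ⟨a, rfl, rfl⟩
    have := a.isLt
    refine ⟨rfl, ?_⟩
    rw [plaqCoord_val]
    cases f <;> simp
  · rintro ⟨h, h'⟩
    cases f
    · have h'' : 0 < i.val := by simpa using h'
      exact ⟨⟨i.val - 1, by omega⟩, by ext; rw [plaqCoord_val]; simp; omega,
        by ext; rw [plaqCoord_val]; simp; omega⟩
    · exact ⟨⟨i.val, by simpa using h'⟩, by ext; simp [plaqCoord_val],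
        by ext; simp [plaqCoord_val]; omega⟩

theorem agree_true_false (i i' : Fin (d + 1)) :
    agree i true i' false = if i'.val = i.val + 1 then 1 else 0 := by
  unfold agree
  congr 1
  apply propext
  have := i'.isLt
  constructor
  · rintro ⟨a, rfl, rfl⟩
    simp [plaqCoord_val]
  · rintro h
    exact ⟨⟨i.val, by omega⟩, by ext; simp [plaqCoord_val], by ext; simp [plaqCoord_val]; omega⟩

theorem agree_false_true (i i' : Fin (d + 1)) :
    agree i false i' true = if i.val = i'.val + 1 then 1 else 0 := by
  rw [← agree_true_false]
  unfold agree
  congr 1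
  apply propext
  exact exists_congr fun a => and_comm

theorem optVal_single_corner (P₀ P : Plaq d) (c c' : Corner) :
    optVal (single (P₀.corner c)) (P.corner c') =
      agree P₀.1 c.1 P.1 c'.1 * agree P₀.2 c.2 P.2 c'.2 := by
  have h : optVal (single (P₀.corner c)) (P.corner c') =
      if ∃ q : Data d, q.plaq c = P₀ ∧ q.plaq c' = P then 1 else 0 := by
    cases hc : P.corner c' with
    | none =>
      rw [if_neg]
      · rfl
      · rintro ⟨q, -, hq⟩
        rw [← Plaq.corner_eq_some, hc] at hq
        cases hq
    | some q =>
      have hq := Plaq.corner_eq_some.1 hc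
      simp only [optVal_some, single, Plaq.corner_eq_some]
      congr 1
      apply propext
      constructor
      · intro h; exact ⟨q, h, hq⟩
      · rintro ⟨q', h, h'⟩
        rw [← Plaq.corner_eq_some, hc] at h'
        cases h'
        exact h
  rw [h]
  unfold agree
  rw [ite_zero_mul_ite_zero]
  congr 1
  · apply propext
    simp only [Data.plaq, Prod.ext_iff]
    constructor
    · rintro ⟨q, ⟨h1, h2⟩, h3, h4⟩
      exact ⟨⟨q.1, h1, h3⟩, q.2, h2, h4⟩
    · rintro ⟨⟨a, h1, h3⟩, c, h2, h4⟩
      exact ⟨(a, c), ⟨h1, h2⟩, h3, h4⟩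

/-- The measurements of neighbouring stabilizers of different types do not disturb each other. -/
theorem schedule_even {P₀ P : Plaq d} (h₀ : P₀.IsStab) (h : P.IsStab) (hne : P.type ≠ P₀.type)
    (k : ℕ) :
    optVal (single (cor k 1 P₀)) (cor k 0 P) + optVal (single (cor k 2 P₀)) (cor k 0 P) +
      optVal (single (cor k 3 P₀)) (cor k 0 P) + optVal (single (cor k 2 P₀)) (cor k 1 P) +
      optVal (single (cor k 3 P₀)) (cor k 1 P) + optVal (single (cor k 3 P₀)) (cor k 2 P) = 0 := by
  have hc := h.cases
  have hc₀ := h₀.cases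
  have hne' := Plaq.type_ne.1 hne
  have hi := P.1.isLt
  have hj := P.2.isLt
  have hi₀ := P₀.1.isLt
  have hj₀ := P₀.2.isLt
  unfold cor
  simp only [optVal_single_corner]
  -- Each of the six terms detects a shared data qubit that `P` visits before `P₀`. The claim is
  -- that their number is even, which depends on the zigzag orders and is checked by coordinates.
  rcases Nat.mod_two_eq_zero_or_one k with hk | hk <;> cases hty : P.type <;>
    cases hty₀ : P₀.type <;> simp only [hty, hty₀, ne_eq, not_true_eq_false] at hne
  all_goals
    simp only [order, hk]
    norm_num
    simp only [agree_self, agree_true_false, agree_false_true, Bool.false_eq_true, if_true, if_false]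
    generalize P.1.val = i at *
    generalize P.2.val = j at *
    generalize P₀.1.val = i₀ at *
    generalize P₀.2.val = j₀ at *
    split_ifs <;> first | omega | decide

/-- The sensitivity of the measurement of the stabilizer `P₀` to errors after the shuttling step of
the same round `k`, right before layer `i + 3`. -/
def lateSens (k : ℕ) (P₀ : Plaq d) (i : ℕ) : Site d → ZMod 2
  | Sum.inl q => (if i = 0 then single (cor k 1 P₀) q else 0) +
      (if i ≤ 1 then single (cor k 2 P₀) q else 0) + (if i ≤ 2 then single (cor k 3 P₀) q else 0)
  | Sum.inr P =>
    if P.IsStab then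
      if P.type = P₀.type then
        if P = P₀ then 1 else 0
      else
        (if i = 0 then optVal (single (cor k 2 P₀)) (cor k 1 P) +
          optVal (single (cor k 3 P₀)) (cor k 1 P) else 0) +
        (if i ≤ 1 then optVal (single (cor k 3 P₀)) (cor k 2 P) else 0)
    else 0

/-- The sensitivity of the measurement of the stabilizer `P₀` to errors right before layer `i` of
the same round `k`. -/
def flipSens (k : ℕ) (P₀ : Plaq d) : ℕ → Site d → ZMod 2
  | 0 => onData (indicator P₀.support)
  | 1 => Op.pull P₀.type (cnotLayer k 0) (Op.pull P₀.type (swapLayer k) (lateSens k P₀ 0))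
  | 2 => Op.pull P₀.type (swapLayer k) (lateSens k P₀ 0)
  | i + 3 => lateSens k P₀ i

/-- If `q` first meets an ancilla of the other type, its atom becomes that ancilla and reaches `P₀`
only through the remaining corners of that plaquette. The parity of the schedule makes this detour
contribute exactly as if `q` had stayed in place. -/
theorem flipSens_one_data {k : ℕ} {P₀ : Plaq d} (h₀ : P₀.IsStab) (q : Data d) :
    flipSens k P₀ 1 (Sum.inl q) = indicator P₀.support q := by
  have hind : indicator P₀.support q = single (cor k 0 P₀) q + single (cor k 1 P₀) q +
      single (cor k 2 P₀) q + single (cor k 3 P₀) q := by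
    unfold cor
    rw [sum_order (fun c => single (P₀.corner c) q) k P₀.type]
    unfold single indicator
    simp only [Plaq.corner_eq_some, Plaq.mem_support, Data.plaq, Prod.ext_iff, Fin.ext_iff,
      plaqCoord_val]
    simp only [Bool.false_eq_true, if_true, if_false, add_zero]
    by_cases h1 : q.1.val = P₀.1.val <;> by_cases h2 : q.1.val + 1 = P₀.1.val
    · omega
    all_goals
      by_cases h3 : q.2.val = P₀.2.val <;> by_cases h4 : q.2.val + 1 = P₀.2.val
      · omega
      all_goals simp [h1, h2, h3, h4]
  rw [hind]
  simp only [flipSens]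
  rw [pull_cnot_data, pull_swap_data, pull_swap_anc, cor_meet]
  by_cases hs : (meet k 0 q).IsStab
  · simp only [hs, true_and, if_true]
    by_cases hty : (meet k 0 q).type = P₀.type
    · simp only [hty, if_true, lateSens, hs, Option.elim_some, Nat.zero_le, single_cor]
      ring
    · have h0 : meet k 0 q ≠ P₀ := fun h => hty (by rw [h])
      simp only [hty, if_false, lateSens, hs, if_true, Nat.zero_le, add_zero]
      have := schedule_even h₀ hs hty k
      rw [cor_meet] at this
      simp only [optVal_some] at this
      rw [single_cor (t := 0), if_neg h0, zero_add]
      clear hind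
      generalize single (cor k 1 P₀) q = x1 at *
      generalize single (cor k 2 P₀) q = x2 at *
      generalize single (cor k 3 P₀) q = x3 at *
      generalize optVal (single (cor k 2 P₀)) (cor k 1 (meet k 0 q)) = x4 at *
      generalize optVal (single (cor k 3 P₀)) (cor k 1 (meet k 0 q)) = x5 at *
      generalize optVal (single (cor k 3 P₀)) (cor k 2 (meet k 0 q)) = x6 at *
      revert x1 x2 x3 x4 x5 x6
      decide
  · have h0 : meet k 0 q ≠ P₀ := fun h => hs (by rw [h]; exact h₀)
    simp only [hs, false_and, if_false, lateSens, if_true, Nat.zero_le, add_zero]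
    rw [single_cor (t := 0), if_neg h0, zero_add]

/-- Layers 1 and 2 hold by definition. Layer 0 is where the sensitivity must collapse to the support
of the stabilizer, the ancillas being reset; in layers 3 to 5 each CNOT adds the corner it visits.
-/
theorem pull_flipSens {k : ℕ} {P₀ : Plaq d} (h₀ : P₀.IsStab) {i : ℕ} (hi : i < 6) :
    Op.pull P₀.type (roundLayer k i) (flipSens k P₀ (i + 1)) = flipSens k P₀ i := by
  have hd : ∀ t q, (if (meet k t q).IsStab ∧ (meet k t q).type = P₀.type then
      (if (meet k t q).IsStab then if (meet k t q).type = P₀.type then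
        if meet k t q = P₀ then (1 : ZMod 2) else 0 else 0 else 0) else 0) =
      single (cor k t P₀) q := by
    intro t q
    rw [single_cor]
    by_cases h : meet k t q = P₀
    · simp [h, h₀]
    · simp [h]
  interval_cases i <;> simp only [roundLayer]
  · funext s
    rcases s with q | P
    · rw [pull_ancilla_data, flipSens_one_data h₀]; rfl
    · rw [pull_reset_anc]
      by_cases h : P.IsStab
      · simp [h, flipSens, onData]
      · rw [if_neg h]
        simp only [flipSens]
        rw [pull_cnot_anc, pull_swap_anc]
        simp [h, lateSens, onData]
  · rfl
  · rfl
  · funext s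
    rcases s with q | P
    · rw [pull_cnot_data]
      have := hd 1 q
      by_cases hs : (meet k 1 q).IsStab <;> by_cases hty : (meet k 1 q).type = P₀.type <;>
        simp [flipSens, lateSens, hs, hty] at this ⊢ <;> rw [← this] <;> ring
    · rw [pull_cnot_anc]
      by_cases h : P.IsStab <;> by_cases h' : P.type = P₀.type
      · simp [flipSens, lateSens, h, h']
      · cases hc : cor k 1 P <;> simp [flipSens, lateSens, h, h', hc] <;> ring
      · simp [flipSens, lateSens, h]
      · simp [flipSens, lateSens, h]
  · funext s
    rcases s with q | P
    · rw [pull_cnot_data]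
      have := hd 2 q
      by_cases hs : (meet k 2 q).IsStab <;> by_cases hty : (meet k 2 q).type = P₀.type <;>
        simp [flipSens, lateSens, hs, hty] at this ⊢ <;> rw [← this] <;> ring
    · rw [pull_cnot_anc]
      by_cases h : P.IsStab <;> by_cases h' : P.type = P₀.type
      · simp [flipSens, lateSens, h, h']
      · cases hc : cor k 2 P <;> simp [flipSens, lateSens, h, h', hc]
      · simp [flipSens, lateSens, h]
      · simp [flipSens, lateSens, h]
  · funext s
    rcases s with q | P
    · rw [pull_cnot_data]
      have := hd 3 q
      by_cases hs : (meet k 3 q).IsStab <;> by_cases hty : (meet k 3 q).type = P₀.type <;>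
        simp [flipSens, lateSens, hs, hty] at this ⊢ <;> rw [← this]
    · rw [pull_cnot_anc]
      by_cases h : P.IsStab <;> by_cases h' : P.type = P₀.type
      · simp [flipSens, lateSens, h, h']
      · cases cor k 3 P <;> simp [flipSens, lateSens, h, h']
      · simp [flipSens, lateSens, h]
      · simp [flipSens, lateSens, h]

end AtomLoss

namespace AtomLoss

variable {d T : ℕ} {b : Basis}

open Experiment

/-! ## Locality of the detectors -/

def siteRow : Site d → ℕ
  | Sum.inl q => q.1.val
  | Sum.inr P => P.1.val

def siteCol : Site d → ℕ
  | Sum.inl q => q.2.val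
  | Sum.inr P => P.2.val

/-- Sites whose coordinates differ by at most `n`. -/
def Near (n : ℕ) (s s' : Site d) : Prop :=
  siteRow s ≤ siteRow s' + n ∧ siteRow s' ≤ siteRow s + n ∧
  siteCol s ≤ siteCol s' + n ∧ siteCol s' ≤ siteCol s + n

theorem Near.trans {n m : ℕ} {s s' s'' : Site d} (h : Near n s s') (h' : Near m s' s'') :
    Near (n + m) s s'' := by
  unfold Near at *
  omega

theorem Near.symm {n : ℕ} {s s' : Site d} (h : Near n s s') : Near n s' s := by
  unfold Near at *
  omega

theorem Near.mono {n m : ℕ} {s s' : Site d} (h : Near n s s') (hnm : n ≤ m) : Near m s s' := by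
  unfold Near at *
  omega

theorem near_self (n : ℕ) (s : Site d) : Near n s s := by
  unfold Near
  omega

theorem near_plaq (q : Data d) (c : Corner) : Near 1 (Sum.inl q : Site d) (Sum.inr (q.plaq c)) := by
  unfold Near siteRow siteCol Data.plaq
  simp only [plaqCoord_val]
  split_ifs <;> omega

theorem near_meet (k t : ℕ) (q : Data d) :
    Near 1 (Sum.inl q : Site d) (Sum.inr (meet k t q)) := near_plaq q _

theorem near_cor {k t : ℕ} {P : Plaq d} {q : Data d} (h : cor k t P = some q) :
    Near 1 (Sum.inr P : Site d) (Sum.inl q) := by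
  rw [← cor_eq_some.1 h]
  exact (near_meet k t q).symm

theorem near_partner_cnot (k t : ℕ) (s : Site d) : Near 1 s (Op.partner (cnotLayer k t) s) := by
  unfold Op.partner
  rcases s with q | P
  · rw [cnotLayer_data]
    by_cases h : (meet k t q).IsStab
    · rw [if_pos h]
      cases (meet k t q).type <;> exact near_meet k t q
    · rw [if_neg h]; exact near_self _ _
  · rw [cnotLayer_anc]
    by_cases h : P.IsStab
    · rw [if_pos h]
      cases hc : cor k t P with
      | none => exact near_self _ _
      | some q => cases P.type <;> exact near_cor hc
    · rw [if_neg h]; exact near_self _ _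

theorem near_partner_swap (k : ℕ) (s : Site d) : Near 1 s (Op.partner (swapLayer k) s) := by
  unfold Op.partner
  rcases s with q | P
  · rw [swapLayer_data]
    by_cases h : (meet k 0 q).IsStab
    · rw [if_pos h]; exact near_meet k 0 q
    · rw [if_neg h]; exact near_self _ _
  · rw [swapLayer_anc]
    by_cases h : P.IsStab
    · rw [if_pos h]
      cases hc : cor k 0 P with
      | none => exact near_self _ _
      | some q => exact near_cor hc
    · rw [if_neg h]; exact near_self _ _

theorem near_partner_round (k i : ℕ) (s : Site d) : Near 1 s (Op.partner (roundLayer k i) s) := by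
  unfold roundLayer
  have hanc : ∀ β : Basis → Op (Site d), (∀ x, Op.partner (fun _ => β x) s = s) →
      Near 1 s (Op.partner (ancillaLayer β) s) := by
    intro β hβ
    have : Op.partner (ancillaLayer β) s = s := by
      unfold Op.partner at *
      rcases s with q | P
      · rfl
      · unfold ancillaLayer
        by_cases h : P.IsStab
        · simp only [h, if_true]; exact hβ P.type
        · simp [h]
    rw [this]
    exact near_self _ _
  split
  · exact hanc _ fun _ => rfl
  · exact near_partner_cnot _ _ _
  · exact near_partner_swap _ _
  · exact near_partner_cnot _ _ _
  · exact near_partner_cnot _ _ _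
  · exact near_partner_cnot _ _ _
  · exact hanc _ fun _ => rfl

theorem Op.pull_ne_zero {S : Type} {β : Basis} {o : S → Op S} {ρ : S → ZMod 2} {s : S}
    (h : Op.pull β o ρ s ≠ 0) : ρ s ≠ 0 ∨ ρ (Op.partner o s) ≠ 0 := by
  by_contra hc
  push Not at hc
  apply h
  unfold Op.pull
  unfold Op.partner at hc
  cases ho : o s <;> simp_all

theorem near_of_pull {k i n : ℕ} {β : Basis} {ρ : Site d → ZMod 2} {s₀ : Site d}
    (hρ : ∀ s, ρ s ≠ 0 → Near n s s₀) {s : Site d} (h : Op.pull β (roundLayer k i) ρ s ≠ 0) :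
    Near (n + 1) s s₀ := by
  rcases Op.pull_ne_zero h with h | h
  · exact (hρ s h).mono (by omega)
  · exact ((near_partner_round k i s).trans (hρ _ h)).mono (by omega)

theorem near_of_indicator {P : Plaq d} {q : Data d} (h : indicator P.support q ≠ 0) :
    Near 1 (Sum.inl q : Site d) (Sum.inr P) := by
  unfold indicator at h
  split_ifs at h with h1
  · rw [Plaq.mem_support] at h1
    simp only [Near, siteRow, siteCol]
    omega
  · exact absurd rfl h

theorem near_of_onData {P : Plaq d} {s : Site d} (h : onData (indicator P.support) s ≠ 0) :
    Near 1 s (Sum.inr P) := by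
  rcases s with q | P'
  · exact near_of_indicator h
  · exact absurd rfl h

/-- Each layer pulled back widens the region by at most one. It starts at the end of the round with
the support of `P`, at distance one. -/
theorem near_of_sens {P : Plaq d} (hP : P.IsStab) {k i : ℕ} (hi : i ≤ 7) {s : Site d}
    (h : sens P.type (indicator P.support) k i s ≠ 0) : Near (8 - i) s (Sum.inr P) := by
  induction hi using Nat.decreasingInduction generalizing s with
  | self => rw [sens_seven] at h; exact near_of_onData h
  | of_succ i hi ih =>
    rw [← pull_sens (commutes_stab hP) k hi] at h
    have := near_of_pull (fun s hs => ih hs) h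
    exact this.mono (by omega)

theorem near_of_sensAt {P : Plaq d} (hP : P.IsStab) {τ : ℕ} {s : Site d}
    (h : sensAt P.type (indicator P.support) τ s ≠ 0) : Near 8 s (Sum.inr P) := by
  unfold sensAt at h
  split_ifs at h with h0
  · exact absurd rfl h
  · exact (near_of_sens hP (by omega) h).mono (by omega)

theorem near_of_flipSens {P : Plaq d} (hP : P.IsStab) {k i : ℕ} (hi : i ≤ 6) {s : Site d}
    (h : flipSens k P i s ≠ 0) : Near (8 - i) s (Sum.inr P) := by
  induction hi using Nat.decreasingInduction generalizing s with
  | self =>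
    rcases s with q | P'
    · simp [flipSens, lateSens] at h
    · by_cases hs : P' = P
      · subst hs; exact near_self _ _
      · simp [flipSens, lateSens, hs] at h
  | of_succ i hi ih =>
    rw [← pull_flipSens hP hi] at h
    have := near_of_pull (fun s hs => ih hs) h
    exact this.mono (by omega)

/-- The parity of the stabilizer `P` in the frame at the start of round `k`. -/
def stabFrame (T : ℕ) (b : Basis) (e : Config (Site d)) (k : ℕ) (P : Plaq d) : ZMod 2 :=
  ∑ s, onData (indicator P.support) s * P.type.comp ((midSwap d T b).frame e (7 * k + 1) s)

/-- Pulled back to the start of the round, the outcome is the parity of the stabilizer; along the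
way it picks up only errors near `P`. -/
theorem ancFlip_eq_stabFrame {e : Config (Site d)} {k : ℕ} (hk : k < T) {P : Plaq d}
    (hP : P.IsStab) (he : ∀ τ s, e τ s ≠ 0 → 7 * k + 1 < τ → τ ≤ 7 * k + 7 →
      ¬Near 8 s (Sum.inr P)) : ancFlip T b e k P = stabFrame T b e k P := by
  have h := (midSwap d T b).sum_frame (show 7 * k + 1 ≤ 7 * k + 7 by omega) P.type
    (fun τ => flipSens k P (τ - (7 * k + 1))) (fun τ _ _ => midSwap_consistent τ) (by
      intro τ h1 h2
      obtain ⟨i, rfl⟩ : ∃ i, τ = 7 * k + 1 + i := ⟨τ - (7 * k + 1), by omega⟩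
      rw [midSwap_op_round hk (by omega), show 7 * k + 1 + i + 1 - (7 * k + 1) = i + 1 by omega,
        show 7 * k + 1 + i - (7 * k + 1) = i by omega]
      exact pull_flipSens hP (by omega)) e
  have hz : ∑ τ ∈ Finset.Ioc (7 * k + 1) (7 * k + 7), ∑ s,
      flipSens k P (τ - (7 * k + 1)) s * P.type.comp (e τ s) = 0 := by
    refine Finset.sum_eq_zero fun τ hτ => Finset.sum_eq_zero fun s _ => ?_
    rw [Finset.mem_Ioc] at hτ
    by_cases h0 : e τ s = 0
    · simp [h0]
    · have : flipSens k P (τ - (7 * k + 1)) s = 0 := by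
        by_contra hne
        exact he τ s h0 hτ.1 hτ.2 ((near_of_flipSens hP (by omega) hne).mono (by omega))
      simp [this]
  rw [hz, add_zero, show 7 * k + 7 - (7 * k + 1) = 6 by omega, Nat.sub_self] at h
  have hop : (midSwap d T b).op (7 * k + 7) (Sum.inr P) = Op.meas P.type := by
    rw [show 7 * k + 7 = 7 * k + 1 + 6 by ring, midSwap_op_round hk (by norm_num)]
    simp [roundLayer, ancillaLayer, hP]
  unfold ancFlip measTime
  rw [flip_eq _ _ _ _ _ hop]
  refine Eq.trans ?_ h
  rw [Finset.sum_eq_single (Sum.inr P)]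
  · simp [flipSens, lateSens, hP]
  · rintro (q | P') _ hne
    · simp [flipSens, lateSens]
    · have : P' ≠ P := fun h => hne (by rw [h])
      simp [flipSens, lateSens, this]
  · simp

/-- The stabilizer commutes with those of the other type, so the sensitivity returns to the same
operator after a round, having picked up only nearby errors. -/
theorem stabFrame_succ {e : Config (Site d)} {k : ℕ} (hk : k < T) {P : Plaq d}
    (hP : P.IsStab) (he : ∀ τ s, e τ s ≠ 0 → 7 * k + 1 < τ → τ ≤ 7 * k + 8 →
      ¬Near 8 s (Sum.inr P)) : stabFrame T b e (k + 1) P = stabFrame T b e k P := by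
  have h := (midSwap d T b).sum_frame (show 7 * k + 1 ≤ 7 * (k + 1) + 1 by omega) P.type
    (sensAt P.type (indicator P.support)) (fun τ _ _ => midSwap_consistent τ)
    (fun τ _ hτ => pull_sensAt (commutes_stab hP) (by omega)) e
  rw [Finset.sum_eq_zero (s := Finset.Ioc _ _), sensAt_start, sensAt_start, add_zero] at h
  · exact h
  · intro τ hτ
    refine Finset.sum_eq_zero fun s _ => ?_
    rw [Finset.mem_Ioc] at hτ
    by_cases h0 : e τ s = 0
    · simp [h0]
    · have : sensAt P.type (indicator P.support) τ s = 0 := by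
        by_contra hne
        exact he τ s h0 hτ.1 (by omega) (near_of_sensAt hP hne)
      simp [this]

/-- The reset wipes out errors on the data before it, so only errors right after the reset count. -/
theorem stabFrame_zero {e : Config (Site d)} {P : Plaq d} (hP : P.IsStab)
    (he : ∀ s, e 1 s ≠ 0 → ¬Near 8 s (Sum.inr P)) : stabFrame T b e 0 P = 0 := by
  have h := (midSwap d T b).sum_frame (show 0 ≤ 7 * 0 + 1 by omega) P.type
    (sensAt P.type (indicator P.support)) (fun τ _ _ => midSwap_consistent τ)
    (fun τ _ hτ => pull_sensAt (commutes_stab hP) (by omega)) e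
  rw [sensAt_start, sensAt_zero] at h
  unfold stabFrame
  rw [h, show Finset.Ioc 0 (7 * 0 + 1) = {1} by rfl, Finset.sum_singleton]
  simp only [Pi.zero_apply, zero_mul, Finset.sum_const_zero, zero_add]
  refine Finset.sum_eq_zero fun s _ => ?_
  by_cases h0 : e 1 s = 0
  · simp [h0]
  · have : sensAt P.type (indicator P.support) 1 s = 0 := by
      by_contra hne
      exact he s h0 (near_of_sensAt hP hne)
    simp [this]

/-- A detector is only triggered by errors nearby. -/
theorem exists_of_syndrome_ne_zero (hT : 1 ≤ T) {e : Config (Site d)} {t : Fin (T + 1)}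
    {P : Plaq d} (h : (midSwap d T b).syndrome e (t, P) ≠ 0) :
    ∃ τ s, e τ s ≠ 0 ∧ 7 * t.val ≤ τ + 6 ∧ τ ≤ 7 * t.val + 7 ∧ Near 8 s (Sum.inr P) := by
  by_contra hcon
  push Not at hcon
  apply h
  by_cases hP : P.IsStab
  swap
  · exact syndrome_nonstab hP
  by_cases ht : t.val = 0
  · rw [syndrome_first hP ht, ancFlip_eq_stabFrame hT hP fun τ s h1 h2 h3 =>
        hcon τ s h1 (by omega) (by omega),
      stabFrame_zero hP fun s h1 => hcon 1 s h1 (by omega) (by omega)]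
    simp
  obtain ⟨k, hk⟩ : ∃ k, t.val = k + 1 := ⟨t.val - 1, by omega⟩
  have hkT : k < T := by have := t.isLt; omega
  by_cases htT : t.val < T
  -- The two outcomes are the parities at the starts of rounds `k` and `k + 1`, which agree in the
  -- absence of nearby errors.
  · rw [syndrome_middle hP ht htT, hk, Nat.add_sub_cancel,
      ancFlip_eq_stabFrame hkT hP fun τ s h1 h2 h3 => hcon τ s h1 (by omega) (by omega),
      ancFlip_eq_stabFrame (by omega) hP fun τ s h1 h2 h3 => hcon τ s h1 (by omega) (by omega),
      stabFrame_succ hkT hP fun τ s h1 h2 h3 => hcon τ s h1 (by omega) (by omega)]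
    exact zmod2_self_add _
  · have htT' : t.val = T := by have := t.isLt; omega
    rw [syndrome_last hP ht htT']
    split_ifs with hb
    · have h1 : ∑ q, indicator P.support q * (midSwap d T b).flip e (7 * T + 1) (Sum.inl q) =
          stabFrame T b e T P := by
        unfold stabFrame
        rw [sum_onData]
        refine Finset.sum_congr rfl fun q _ => ?_
        rw [flip_eq _ _ _ _ b (by rw [midSwap_op_final]; rfl), hb]
      have hT' : T = k + 1 := by omega
      rw [h1, show T - 1 = k by omega,
        ancFlip_eq_stabFrame hkT hP fun τ s h1 h2 h3 => hcon τ s h1 (by omega) (by omega)]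
      have := stabFrame_succ (b := b) (e := e) hkT hP fun τ s h1 h2 h3 =>
        hcon τ s h1 (by omega) (by omega)
      rw [← hT'] at this
      rw [this]
      exact zmod2_self_add _
    · rfl

end AtomLoss

namespace AtomLoss

variable {d T : ℕ} {b : Basis}

open Experiment

/-! ## Lifetimes of atoms -/

theorem ServesAs.near {q : Data d} {τ : ℕ} {s : Site d} (h : ServesAs q τ s) :
    Near 1 s (Sum.inl q : Site d) := by
  rcases h with rfl | ⟨k, P, _, hc, rfl, _⟩
  · exact near_self _ _
  · exact near_cor hc

theorem EndsAt.near {k : ℕ} {P : Plaq d} {τ : ℕ} {s : Site d} (h : EndsAt k P τ s) :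
    Near 2 s (Sum.inr P : Site d) := by
  rcases h with ⟨_, _, rfl⟩ | ⟨_, ⟨q, hq, h2⟩ | ⟨_, rfl, _⟩⟩
  · exact near_self _ _
  · exact h2.near.trans (near_cor hq).symm
  · exact near_self _ _

theorem near_of_onWire {m : (midSwap d T b).Meas} {τ : ℕ} {s : Site d}
    (h : (midSwap d T b).OnWire τ s m.1.1 m.1.2) : Near 2 s m.1.2 := by
  rcases meas_cases m with ⟨q, hm1, hm2⟩ | ⟨k, P, hk, hP, hm1, hm2⟩
  · rw [hm1, hm2] at h
    rw [hm2]
    exact (servesAs_of_onWire h).near.mono (by omega)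
  · rw [hm1, hm2] at h
    rw [hm2]
    exact (endsAt_of_onWire hk hP h).near

theorem Experiment.OnWire.exists_later {S D : Type} {C : Experiment S D} {τ μ σ : ℕ} {s m : S}
    (h : C.OnWire τ s μ m) (h1 : τ ≤ σ) (h2 : σ ≤ μ) : ∃ s', C.OnWire σ s' μ m := by
  induction σ, h1 using Nat.le_induction with
  | base => exact ⟨s, h⟩
  | succ σ h1 ih =>
    obtain ⟨s', hs'⟩ := ih (by omega)
    rcases hs'.cases_head with ⟨h3, _⟩ | ⟨_, s'', _, h4⟩
    · omega
    · exact ⟨s'', h4⟩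

/-- A data atom is replaced in one of two consecutive rounds. -/
theorem isStab_meet_or (hd : 3 ≤ d) (hodd : Odd d) (k : ℕ) (q : Data d) :
    (meet k 0 q).IsStab ∨ (meet (k + 1) 0 q).IsStab := by
  have hq1 := q.1.isLt
  have hq2 := q.2.isLt
  obtain ⟨n, rfl⟩ := hodd
  have key : (q.plaq (false, false)).IsStab ∨ (q.plaq (true, true)).IsStab := by
    unfold Plaq.IsStab
    simp only [Plaq.type_eq_X, Plaq.type_eq_Z, Data.plaq, plaqCoord_val]
    simp only [Bool.false_eq_true, if_true, if_false]
    omega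
  have h1 : ∀ k, meet k 0 q = q.plaq (decide (k % 2 = 1), decide (k % 2 = 1)) := by
    intro k
    unfold meet
    rw [order_zero]
  rw [h1, h1]
  rcases Nat.mod_two_eq_zero_or_one k with hk | hk
  · have : (k + 1) % 2 = 1 := by omega
    simpa [hk, this] using key
  · have : (k + 1) % 2 = 0 := by omega
    simpa [hk, this] using key.symm

/-- An atom that serves as a data qubit throughout a round is not replaced in it. -/
theorem not_isStab_meet {q : Data d} {μ H k : ℕ} {m : Site d} (hk : k < T)
    (hH : 7 * k + 1 + 3 ≤ H) (hHμ : H ≤ μ)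
    (hserves : ∀ σ s, (midSwap d T b).OnWire σ s μ m → σ ≤ H → ServesAs q σ s) {s : Site d}
    (h : (midSwap d T b).OnWire (7 * k + 1) s μ m) : ¬(meet k 0 q).IsStab := by
  intro hstab
  have hs : s = Sum.inl q := by
    rcases hserves _ _ h (by omega) with rfl | ⟨k', P, _, _, _, h3⟩
    · rfl
    · omega
  subst hs
  rcases h.cases_head with ⟨h1, _⟩ | ⟨_, s1, hs1, h1⟩
  · omega
  obtain ⟨rfl, -⟩ := step_round hk (i := 0) (by norm_num) hs1 (by norm_num)
  rcases h1.cases_head with ⟨h1, _⟩ | ⟨_, s2, hs2, h2⟩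
  · omega
  obtain ⟨rfl, -⟩ := step_round hk (i := 1) (by norm_num) hs2 (by norm_num)
  rcases h2.cases_head with ⟨h1, _⟩ | ⟨_, s3, hs3, h3⟩
  · omega
  have h4 := hserves _ _ h3 (by omega)
  rcases step_swap hk hs3 with ⟨q', h5, h6, rfl⟩ | ⟨q', h5, h6, rfl⟩ | ⟨P, q', h5, _⟩ | ⟨P, h5, _⟩
  · rcases h4 with h4 | ⟨k', P, _, _, _, h8⟩
    · cases h4
    · omega
  · cases h5
    exact h6 hstab
  · cases h5
  · cases h5

/-- The bound is 6 + 7 + 3: at most six layers until a round starts, one full round, and three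
layers of the next round to pass its shuttling step. In one of these two rounds the atom would have
been replaced. -/
theorem lifetime_serves (hd : 3 ≤ d) (hodd : Odd d) {q : Data d} {μ H τ : ℕ} {m s : Site d}
    (hHT : H ≤ 7 * T + 1) (hHμ : H ≤ μ)
    (hserves : ∀ σ s, (midSwap d T b).OnWire σ s μ m → σ ≤ H → ServesAs q σ s)
    (h : (midSwap d T b).OnWire τ s μ m) : H ≤ τ + 16 := by
  by_contra hlt
  obtain ⟨k, hk1, hk2⟩ : ∃ k, τ ≤ 7 * k + 1 ∧ 7 * k + 1 ≤ τ + 6 :=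
    ⟨(τ + 5) / 7, by omega, by omega⟩
  obtain ⟨s1, h1⟩ := h.exists_later hk1 (by omega)
  obtain ⟨s2, h2⟩ := h.exists_later (show τ ≤ 7 * (k + 1) + 1 by omega) (by omega)
  rcases isStab_meet_or hd hodd k q with h3 | h3
  · exact not_isStab_meet (T := T) (by omega) (by omega) hHμ hserves h1 h3
  · exact not_isStab_meet (T := T) (by omega) (by omega) hHμ hserves h2 h3

/-- Atoms live for less than three rounds. -/
theorem lifetime (hd : 3 ≤ d) (hodd : Odd d) {m : (midSwap d T b).Meas} {τ : ℕ} {s : Site d}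
    (h : (midSwap d T b).OnWire τ s m.1.1 m.1.2) : m.1.1.val ≤ τ + 20 := by
  rcases meas_cases m with ⟨q, hm1, hm2⟩ | ⟨k, P, hk, hP, hm1, hm2⟩
  · rw [hm1, hm2] at h
    have := lifetime_serves hd hodd le_rfl le_rfl (fun σ s h' _ => servesAs_of_onWire h') h
    omega
  · rw [hm1, hm2] at h
    cases hc : cor k 0 P with
    | none =>
      rcases endsAt_of_onWire hk hP h with h1 | ⟨_, ⟨q, hq, _⟩ | h1⟩
      · omega
      · rw [hc] at hq; cases hq
      · omega
    | some q =>
      -- The atom serves as a data qubit up to the shuttling step; its measurement comes four layers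
      -- later, whence 20 = 16 + 4.
      have := lifetime_serves hd hodd (q := q) (H := 7 * k + 1 + 2) (by omega) (by omega)
        (fun σ s h' hσ => by
          rcases endsAt_of_onWire hk hP h' with h1 | ⟨_, ⟨q', hq', h1⟩ | h1⟩
          · omega
          · rw [hc] at hq'; cases hq'; exact h1
          · rw [hc] at h1; cases h1.1) h
      omega

end AtomLoss

/-! ### Effective fault values and the exchange inequality -/

namespace AtomLoss

namespace Op

variable {S : Type}

/-- The part of a fault value that has an effect. -/
def effective (o : Op S) (v : Pauli × Pauli) : Pauli × Pauli :=
  match o with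
  | ctrl _ => v
  | _ => (v.1, 0)

theorem isFault_effective {o : Op S} {v : Pauli × Pauli} (h : o.effective v ≠ 0) :
    o.IsFault (o.effective v) := by
  refine ⟨h, ?_⟩
  unfold effective
  cases o <;> trivial

theorem effective_zero (o : Op S) : o.effective 0 = 0 := by
  unfold effective
  cases o <;> rfl

end Op

theorem sum_le_sum_of_exchange {ι : Type*} [Fintype ι] [DecidableEq ι] {W : Finset ι}
    {f g h : ι → ℕ} (hW : ∀ n ∈ W, h n = g n) (hWc : ∀ n ∉ W, h n = f n)
    (hle : ∑ n, f n ≤ ∑ n, h n) : ∑ n ∈ W, f n ≤ ∑ n ∈ W, g n := by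
  rw [← Finset.sum_compl_add_sum W, ← Finset.sum_compl_add_sum W h, Finset.sum_congr rfl hW,
    Finset.sum_congr rfl fun n hn => hWc n (Finset.mem_compl.1 hn)] at hle
  exact Nat.le_of_add_le_add_left hle

/-- Here `u` is the actual cost, `v` the decoder's cost and `ρ` marks loss reports: `W.card ≤ ∑ (u +
v + ρ) ≤ ∑ (2 * u + ρ)`. This is the origin of the weights 2, 1, 2 in the failure condition. -/
theorem card_le_sum_of_exchange {ι : Type*} {W : Finset ι} {u v ρ k : ι → ℕ}
    (hone : ∀ n ∈ W, 1 ≤ u n + v n + ρ n) (hle : ∑ n ∈ W, v n ≤ ∑ n ∈ W, u n)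
    (hk : ∀ n ∈ W, 2 * u n + ρ n ≤ k n) : W.card ≤ ∑ n ∈ W, k n := by
  have h1 := Finset.sum_le_sum hone
  have h2 := Finset.sum_le_sum hk
  simp only [Finset.sum_add_distrib, ← Finset.mul_sum, Finset.sum_const, smul_eq_mul,
    mul_one] at h1 h2
  omega

namespace Experiment

variable {S D : Type} [Fintype S] [DecidableEq S] (C : Experiment S D)

/-! ## Failures and connected clusters of faults -/

/-- Possible carriers of faults: the Pauli fault locations and the atoms. -/
abbrev Node := C.PauliLoc ⊕ C.Meas

/-- The combined errors of the actual faults and the decoder at a node. -/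
def nodeErrors : C.Node → Set (Config S)
  | Sum.inl ℓ => Set.range (C.faultConfig ℓ)
  | Sum.inr m => {e | ∃ e₁ ∈ C.atomEnvelope m, ∃ e₂ ∈ C.atomEnvelope m, e = e₁ + e₂}

/-- The number of faults at a node, with the weights in the bound on failures. -/
noncomputable def weight (p : C.PauliLoc → Pauli × Pauli) (R r : Finset C.Meas) : C.Node → ℕ
  | Sum.inl ℓ => if p ℓ ≠ 0 then 2 else 0
  | Sum.inr m => if m ∈ r then 1 else if m ∈ R then 2 else 0

variable {C}

theorem faultConfig_add (ℓ : C.PauliLoc) (v v' : Pauli × Pauli) :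
    C.faultConfig ℓ (v + v') = C.faultConfig ℓ v + C.faultConfig ℓ v' := by
  funext σ s
  simp only [faultConfig, Pi.add_apply]
  split
  · split_ifs <;> simp
  · split_ifs <;> simp [add_add_add_comm]
  · split_ifs <;> simp

/-- `faultConfig` as a linear map. -/
def faultHom (ℓ : C.PauliLoc) : Pauli × Pauli →+ Config S :=
  AddMonoidHom.mk' (C.faultConfig ℓ) (faultConfig_add ℓ)

theorem faultHom_apply (ℓ : C.PauliLoc) (v : Pauli × Pauli) :
    faultHom ℓ v = C.faultConfig ℓ v := rfl

theorem faultConfig_effective (ℓ : C.PauliLoc) (v : Pauli × Pauli) :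
    C.faultConfig ℓ ((C.op ℓ.1.1 ℓ.1.2).effective v) = C.faultConfig ℓ v := by
  funext σ s
  unfold faultConfig Op.effective
  cases C.op ℓ.1.1 ℓ.1.2 <;> rfl

namespace Assignment

/-- The part of the outcome of an assignment that comes from a node. -/
def nodeOutcome (a : C.Assignment) : C.Node → Outcome D
  | Sum.inl ℓ => ∑ i ∈ a.y with i.1.1 = ℓ, C.outcome (C.faultConfig i.1.1 i.1.2)
  | Sum.inr m => ∑ j ∈ a.x m, j

/-- The part of the cost of an assignment that comes from a node. -/
def nodeCost (a : C.Assignment) (r : Finset C.Meas) : C.Node → ℕ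
  | Sum.inl ℓ => (a.y.filter fun i => i.1.1 = ℓ).card
  | Sum.inr m => if m ∈ r then 0 else (a.x m).card

theorem outcome_eq_sum (a : C.Assignment) : a.outcome = ∑ n, a.nodeOutcome n := by
  rw [Fintype.sum_sum_type]
  unfold outcome nodeOutcome
  congr 1
  exact (Finset.sum_fiberwise _ _ _).symm

theorem cost_eq_sum (a : C.Assignment) (w : ℝ) (r : Finset C.Meas) :
    a.cost w r = w * ((∑ n, a.nodeCost r n : ℕ) : ℝ) := by
  rw [Fintype.sum_sum_type]
  unfold cost nodeCost
  rw [← Finset.card_eq_sum_card_fiberwise (fun _ _ => Finset.mem_univ _)]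
  push_cast
  rw [mul_add]
  congr 1
  rw [Finset.mul_sum, ← Finset.sum_compl_add_sum r]
  have : ∑ m ∈ r, w * (if m ∈ r then (0 : ℝ) else ((a.x m).card : ℝ)) = 0 :=
    Finset.sum_eq_zero fun m hm => by simp [hm]
  rw [this, add_zero]
  refine Finset.sum_congr rfl fun m hm => ?_
  rw [if_neg (Finset.mem_compl.1 hm)]

open Classical in
/-- The assignment that agrees with `a'` on `W` and with `a` elsewhere. -/
noncomputable def mix (a a' : C.Assignment) (W : Finset C.Node) : C.Assignment where
  x m := if Sum.inr m ∈ W then a'.x m else a.x m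
  y := (a'.y.filter fun i => Sum.inl i.1.1 ∈ W) ∪ (a.y.filter fun i => Sum.inl i.1.1 ∉ W)

theorem mix_y_filter (a a' : C.Assignment) (W : Finset C.Node) (ℓ : C.PauliLoc) :
    ((mix a a' W).y.filter fun i => i.1.1 = ℓ) =
      if Sum.inl ℓ ∈ W then a'.y.filter fun i => i.1.1 = ℓ else a.y.filter fun i => i.1.1 = ℓ := by
  ext i
  by_cases h : i.1.1 = ℓ
  · subst h
    by_cases hW : Sum.inl i.1.1 ∈ W <;> simp [mix, hW]
  · split_ifs <;> simp [h]

theorem nodeOutcome_mix (a a' : C.Assignment) (W : Finset C.Node) (n : C.Node) :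
    (mix a a' W).nodeOutcome n = if n ∈ W then a'.nodeOutcome n else a.nodeOutcome n := by
  rcases n with ℓ | m
  · simp only [nodeOutcome]
    rw [mix_y_filter]
    split_ifs <;> rfl
  · simp only [nodeOutcome, mix]
    split_ifs <;> rfl

theorem nodeCost_mix (a a' : C.Assignment) (r : Finset C.Meas) (W : Finset C.Node) (n : C.Node) :
    (mix a a' W).nodeCost r n = if n ∈ W then a'.nodeCost r n else a.nodeCost r n := by
  rcases n with ℓ | m
  · simp only [nodeCost]
    rw [mix_y_filter]
    split_ifs <;> rfl
  · simp only [nodeCost, mix]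
    split_ifs <;> rfl

end Assignment

theorem outcome_self_add (o : Outcome D) : o + o = 0 := by
  ext <;> exact zmod2_self_add _

open Classical in
/-- The assignment which describes the actual Pauli faults `p` and the errors `f` of the atoms
in `R`. -/
noncomputable def actual (p : C.PauliLoc → Pauli × Pauli) (R : Finset C.Meas)
    (f : C.Meas → Config S) : C.Assignment where
  x m := if m ∈ R then {C.outcome (f m)} else ∅
  y := Finset.univ.filter fun i => i.1.2 = (C.op i.1.1.1.1 i.1.1.1.2).effective (p i.1.1)

theorem actual_y_filter (p : C.PauliLoc → Pauli × Pauli) (R : Finset C.Meas)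
    (f : C.Meas → Config S) (ℓ : C.PauliLoc) :
    ((actual p R f).y.filter fun i => i.1.1 = ℓ) =
      if h : (C.op ℓ.1.1 ℓ.1.2).effective (p ℓ) ≠ 0 then
        {⟨(ℓ, (C.op ℓ.1.1 ℓ.1.2).effective (p ℓ)), Op.isFault_effective h⟩} else ∅ := by
  ext ⟨⟨ℓ', v⟩, hi⟩
  simp only [actual, Finset.mem_filter, Finset.mem_univ, true_and]
  split_ifs with h
  · simp only [Finset.mem_singleton, Subtype.mk.injEq, Prod.mk.injEq]
    constructor
    · rintro ⟨h1, rfl⟩; exact ⟨rfl, h1⟩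
    · rintro ⟨rfl, h1⟩; exact ⟨h1, rfl⟩
  · simp only [Finset.notMem_empty, iff_false]
    rintro ⟨h1, rfl⟩
    rw [ne_eq, not_not] at h
    rw [h] at h1
    exact hi.1 h1

theorem actual_nodeOutcome_inl (p : C.PauliLoc → Pauli × Pauli) (R : Finset C.Meas)
    (f : C.Meas → Config S) (ℓ : C.PauliLoc) :
    (actual p R f).nodeOutcome (Sum.inl ℓ) = C.outcome (C.faultConfig ℓ (p ℓ)) := by
  simp only [Assignment.nodeOutcome]
  rw [actual_y_filter]
  split_ifs with h
  · rw [Finset.sum_singleton, faultConfig_effective]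
  · rw [ne_eq, not_not] at h
    rw [← faultConfig_effective, h, Finset.sum_empty, ← faultHom_apply, map_zero,
      ← outcomeHom_apply, map_zero]

theorem actual_nodeCost_inl (p : C.PauliLoc → Pauli × Pauli) (R r : Finset C.Meas)
    (f : C.Meas → Config S) (ℓ : C.PauliLoc) :
    (actual p R f).nodeCost r (Sum.inl ℓ) ≤ if p ℓ ≠ 0 then 1 else 0 := by
  simp only [Assignment.nodeCost]
  rw [actual_y_filter]
  split_ifs with h h' h'
  · simp
  · rw [ne_eq, not_not] at h'
    rw [h', Op.effective_zero] at h
    exact absurd rfl h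
  · simp
  · simp

theorem actual_outcome (p : C.PauliLoc → Pauli × Pauli) (R : Finset C.Meas)
    (f : C.Meas → Config S) :
    (actual p R f).outcome = C.outcome (C.pauliConfig p + ∑ m ∈ R, f m) := by
  classical
  rw [Assignment.outcome_eq_sum, Fintype.sum_sum_type, ← outcomeHom_apply, map_add]
  congr 1
  · rw [pauliConfig, map_sum]
    exact Finset.sum_congr rfl fun ℓ _ => actual_nodeOutcome_inl p R f ℓ
  · rw [map_sum, ← Finset.sum_subset (Finset.subset_univ R)]
    · refine Finset.sum_congr rfl fun m hm => ?_
      simp [Assignment.nodeOutcome, actual, hm, outcomeHom_apply]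
    · intro m _ hm
      simp [Assignment.nodeOutcome, actual, hm]

/-- It allows a node to which only the actual error or only the decoder contributes to be treated as
a sum of two envelope elements. -/
theorem zero_mem_atomEnvelope {m : C.Meas} {e : Config S} (h : e ∈ C.atomEnvelope m) :
    0 ∈ C.atomEnvelope m := by
  obtain ⟨ℓ, hℓ, _⟩ := h
  exact ⟨ℓ, hℓ, fun σ s hne => absurd rfl hne⟩

/-- The errors at a node with nontrivial outcome. -/
theorem exists_nodeError {p : C.PauliLoc → Pauli × Pauli} {R r : Finset C.Meas}
    {f : C.Meas → Config S} (hf : ∀ m ∈ R, f m ∈ C.atomEnvelope m) {a : C.Assignment}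
    {D₀ : D → ZMod 2} (ha : a.Feasible D₀ r) {n : C.Node}
    (hn : (actual p R f).nodeOutcome n + a.nodeOutcome n ≠ 0) :
    ∃ e ∈ C.nodeErrors n, C.outcome e = (actual p R f).nodeOutcome n + a.nodeOutcome n := by
  rcases n with ℓ | m
  -- The decoder may choose several mechanisms at one location; with the actual fault they add up to
  -- a single fault value.
  · refine ⟨_, ⟨p ℓ + ∑ i ∈ a.y with i.1.1 = ℓ, i.1.2, rfl⟩, ?_⟩
    rw [← faultHom_apply, map_add, ← outcomeHom_apply, map_add, actual_nodeOutcome_inl]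
    congr 1
    simp only [map_sum, Assignment.nodeOutcome]
    refine Finset.sum_congr rfl fun i hi => ?_
    rw [← (Finset.mem_filter.1 hi).2]
    rfl
  · have h1 : (actual p R f).nodeOutcome (Sum.inr m) = 0 ∨ ∃ e ∈ C.atomEnvelope m,
        C.outcome e = (actual p R f).nodeOutcome (Sum.inr m) := by
      by_cases hm : m ∈ R
      · exact Or.inr ⟨f m, hf m hm, by simp [Assignment.nodeOutcome, actual, hm]⟩
      · left; simp [Assignment.nodeOutcome, actual, hm]
    have h2 : a.nodeOutcome (Sum.inr m) = 0 ∨ ∃ e ∈ C.atomEnvelope m,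
        C.outcome e = a.nodeOutcome (Sum.inr m) := by
      have hcard : (a.x m).card ≤ 1 := by
        by_cases hm : m ∈ r
        · exact (ha.2.1 m hm).le
        · exact ha.2.2.1 m hm
      rcases Nat.le_one_iff_eq_zero_or_eq_one.1 hcard with h | h
      · left
        rw [Finset.card_eq_zero] at h
        simp [Assignment.nodeOutcome, h]
      · right
        obtain ⟨j, hj⟩ := Finset.card_eq_one.1 h
        obtain ⟨e, he, hej⟩ := ha.1 m (by rw [hj]; simp : j ∈ (a.x m : Set (Outcome D)))
        exact ⟨e, he, by simp [Assignment.nodeOutcome, hj, hej]⟩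
    rcases h1 with h1 | ⟨e₁, he₁, h1⟩ <;> rcases h2 with h2 | ⟨e₂, he₂, h2⟩
    · exact absurd (by rw [h1, h2, add_zero]) hn
    · exact ⟨e₂, ⟨e₂, he₂, 0, zero_mem_atomEnvelope he₂, by simp⟩, by rw [h1, h2, zero_add]⟩
    · exact ⟨e₁, ⟨e₁, he₁, 0, zero_mem_atomEnvelope he₁, by simp⟩, by rw [h1, h2, add_zero]⟩
    · exact ⟨e₁ + e₂, ⟨e₁, he₁, e₂, he₂, rfl⟩, by
        rw [← h1, ← h2, ← outcomeHom_apply, map_add]; rfl⟩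

/-- A minimal set of outcomes that add up to an undetected logical flip is connected. -/
theorem exists_minimal_cluster {ι : Type*} [DecidableEq ι] (W₀ : Finset ι) (o : ι → Outcome D)
    (h₀ : ∑ n ∈ W₀, o n = (0, 1)) :
    ∃ W ⊆ W₀, ∑ n ∈ W, o n = (0, 1) ∧ (∀ n ∈ W, o n ≠ 0) ∧
      ∀ A ⊆ W, A.Nonempty → A ≠ W →
        ∃ a ∈ A, ∃ a' ∈ W \ A, ∃ i, (o a).1 i ≠ 0 ∧ (o a').1 i ≠ 0 := by
  classical
  obtain ⟨W, hW, hmin⟩ := Finset.exists_min_image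
    (W₀.powerset.filter fun W => ∑ n ∈ W, o n = (0, 1)) Finset.card
    ⟨W₀, by simp [h₀]⟩
  simp only [Finset.mem_filter, Finset.mem_powerset] at hW hmin
  have hlt : ∀ A ⊆ W, A ≠ W → ∑ n ∈ A, o n ≠ (0, 1) := by
    intro A hA hne hsum
    have := hmin A ⟨hA.trans hW.1, hsum⟩
    exact hne (Finset.eq_of_subset_of_card_le hA this)
  refine ⟨W, hW.1, hW.2, fun n hn h0 => ?_, fun A hA hAne hAW => ?_⟩
  · refine hlt (W.erase n) (Finset.erase_subset _ _) (fun h => ?_) ?_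
    · rw [← h] at hn; simp at hn
    · rw [← hW.2, ← Finset.add_sum_erase W o hn, h0, zero_add]
  · by_contra hcon
    push Not at hcon
    have hsplit : ∑ n ∈ W \ A, o n + ∑ n ∈ A, o n = (0, 1) := by
      rw [Finset.sum_sdiff hA, hW.2]
    -- If the two parts share no detector, each detector is silent on one part, hence its total
    -- vanishes on both. The observable flips on exactly one part, which contradicts minimality.
    have h1 : ∀ i, (∑ n ∈ A, o n).1 i = 0 ∧ (∑ n ∈ W \ A, o n).1 i = 0 := by
      intro i
      have hs : (∑ n ∈ W \ A, o n).1 i + (∑ n ∈ A, o n).1 i = 0 :=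
        congrFun (congrArg Prod.fst hsplit) i
      by_cases hex : ∃ a ∈ A, (o a).1 i ≠ 0
      · obtain ⟨a, ha, hai⟩ := hex
        have h2 : (∑ n ∈ W \ A, o n).1 i = 0 := by
          rw [Prod.fst_sum, Finset.sum_apply]
          exact Finset.sum_eq_zero fun a' ha' => hcon a ha a' ha' i hai
        rw [h2, zero_add] at hs
        exact ⟨hs, h2⟩
      · push Not at hex
        have h2 : (∑ n ∈ A, o n).1 i = 0 := by
          rw [Prod.fst_sum, Finset.sum_apply]
          exact Finset.sum_eq_zero hex
        rw [h2, add_zero] at hs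
        exact ⟨h2, hs⟩
    have h2 : (∑ n ∈ W \ A, o n).2 + (∑ n ∈ A, o n).2 = 1 := congrArg Prod.snd hsplit
    have hA1 : ∑ n ∈ A, o n = (0, (∑ n ∈ A, o n).2) := by
      ext i
      · exact (h1 i).1
      · rfl
    have hA2 : ∑ n ∈ W \ A, o n = (0, (∑ n ∈ W \ A, o n).2) := by
      ext i
      · exact (h1 i).2
      · rfl
    rcases zmod2_cases (∑ n ∈ A, o n).2 with h3 | h3
    · rw [h3, add_zero] at h2
      rw [h2] at hA2
      refine hlt _ Finset.sdiff_subset (fun h => ?_) hA2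
      obtain ⟨x, hx⟩ := hAne
      have : x ∈ W \ A := by rw [h]; exact hA hx
      simp [hx] at this
    · rw [h3] at hA1
      exact hlt A hA hAW hA1

/-- The actual faults are a feasible assignment. -/
theorem actual_feasible (p : C.PauliLoc → Pauli × Pauli) {R r : Finset C.Meas} (hR : r ⊆ R)
    {f : C.Meas → Config S} (hf : ∀ m ∈ R, f m ∈ C.atomEnvelope m) :
    (actual p R f).Feasible (C.syndrome (C.pauliConfig p + ∑ m ∈ R, f m)) r := by
  refine ⟨fun m => ?_, fun m hm => ?_, fun m _ => ?_, by rw [actual_outcome]; rfl⟩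
  · by_cases hm : m ∈ R
    · simp only [actual, hm, if_true, Finset.coe_singleton, Set.singleton_subset_iff]
      exact ⟨f m, hf m hm, rfl⟩
    · simp [actual, hm]
  · simp [actual, hR hm]
  · simp only [actual]
    split_ifs <;> simp

namespace Assignment

/-- All constraints but the syndrome refer to single nodes, and the syndrome changes by the combined
one of `W`, which vanishes. -/
theorem feasible_mix {a a' : C.Assignment} {D₀ : D → ZMod 2} {r : Finset C.Meas}
    (ha : a.Feasible D₀ r) (ha' : a'.Feasible D₀ r) {W : Finset C.Node}
    (hW : (∑ n ∈ W, (a'.nodeOutcome n + a.nodeOutcome n)).1 = 0) :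
    (a.mix a' W).Feasible D₀ r := by
  refine ⟨fun m => ?_, fun m hm => ?_, fun m hm => ?_, ?_⟩
  · simp only [mix]
    split_ifs
    · exact ha'.1 m
    · exact ha.1 m
  · simp only [mix]
    split_ifs
    · exact ha'.2.1 m hm
    · exact ha.2.1 m hm
  · simp only [mix]
    split_ifs
    · exact ha'.2.2.1 m hm
    · exact ha.2.2.1 m hm
  · have h1 : (a.mix a' W).outcome =
        a.outcome + ∑ n ∈ W, (a'.nodeOutcome n + a.nodeOutcome n) := by
      classical
      rw [outcome_eq_sum, outcome_eq_sum, ← Finset.sum_compl_add_sum W,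
        ← Finset.sum_compl_add_sum W a.nodeOutcome, add_assoc, ← Finset.sum_add_distrib]
      congr 1
      · refine Finset.sum_congr rfl fun n hn => ?_
        rw [nodeOutcome_mix, if_neg (Finset.mem_compl.1 hn)]
      · refine Finset.sum_congr rfl fun n hn => ?_
        rw [nodeOutcome_mix, if_pos hn, add_left_comm, outcome_self_add, add_zero]
    rw [h1, Prod.fst_add, ha.2.2.2, hW, add_zero]

theorem nodeOutcome_eq_zero {a : C.Assignment} {r : Finset C.Meas} {n : C.Node}
    (h : a.nodeCost r n = 0) (hr : ∀ m ∈ r, n ≠ Sum.inr m) : a.nodeOutcome n = 0 := by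
  rcases n with ℓ | m
  · simp only [nodeCost, Finset.card_eq_zero] at h
    simp only [nodeOutcome]
    rw [h, Finset.sum_empty]
  · have hm : m ∉ r := fun hm => hr m hm rfl
    simp only [nodeCost, hm, if_false, Finset.card_eq_zero] at h
    simp only [nodeOutcome]
    rw [h, Finset.sum_empty]

end Assignment

/-- A Pauli fault or an unreported loss costs at most 1 and has weight 2; an atom reported as lost
costs nothing and has weight 1. -/
theorem actual_nodeCost_le (p : C.PauliLoc → Pauli × Pauli) (L r : Finset C.Meas)
    (f : C.Meas → Config S) (n : C.Node) :
    2 * (actual p (L ∪ r) f).nodeCost r n +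
      Sum.elim (fun _ => 0) (fun m => if m ∈ r then 1 else 0) n ≤ C.weight p L r n := by
  rcases n with ℓ | m
  · have := actual_nodeCost_inl p (L ∪ r) r f ℓ
    simp only [weight, Sum.elim_inl]
    split_ifs at this ⊢
    · omega
    · omega
  · simp only [weight, Sum.elim_inr, Assignment.nodeCost]
    by_cases hm : m ∈ r
    · simp [hm]
    · by_cases hm' : m ∈ L <;> simp [hm, hm', actual]

/-- In a set of nodes on which the optimal solution can be exchanged for the actual faults, a large
fraction of the nodes carries faults. -/
theorem card_le_weight {w : ℝ} (hw : 0 < w) {p : C.PauliLoc → Pauli × Pauli} {L r : Finset C.Meas}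
    {f : C.Meas → Config S} {a : C.Assignment} {W : Finset C.Node}
    (hcost : a.cost w r ≤ (a.mix (actual p (L ∪ r) f) W).cost w r)
    (hne : ∀ n ∈ W, (actual p (L ∪ r) f).nodeOutcome n + a.nodeOutcome n ≠ 0) :
    W.card ≤ ∑ n ∈ W, C.weight p L r n := by
  classical
  generalize ha₀ : actual p (L ∪ r) f = a₀ at *
  rw [Assignment.cost_eq_sum, Assignment.cost_eq_sum] at hcost
  have hcost' : ∑ n, a.nodeCost r n ≤ ∑ n, (a.mix a₀ W).nodeCost r n := by
    exact_mod_cast le_of_mul_le_mul_left hcost hw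
  have hcostW : ∑ n ∈ W, a.nodeCost r n ≤ ∑ n ∈ W, a₀.nodeCost r n :=
    sum_le_sum_of_exchange (fun n hn => by rw [Assignment.nodeCost_mix, if_pos hn])
      (fun n hn => by rw [Assignment.nodeCost_mix, if_neg hn]) hcost'
  refine card_le_sum_of_exchange (ρ := Sum.elim (fun _ => 0) (fun m => if m ∈ r then 1 else 0))
    (fun n hn => ?_) hcostW fun n _ => ?_
  -- A node without actual cost, decoder cost or report would contribute no outcome from either
  -- side, contrary to `hne`.
  · rw [Nat.one_le_iff_ne_zero]
    intro h
    simp only [Nat.add_eq_zero_iff] at h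
    have hr : ∀ m ∈ r, n ≠ Sum.inr m := by
      rintro m hm rfl
      simp [hm] at h
    refine hne n hn ?_
    rw [Assignment.nodeOutcome_eq_zero h.1.1 hr, Assignment.nodeOutcome_eq_zero h.1.2 hr, add_zero]
  · rw [← ha₀]
    exact actual_nodeCost_le p L r f n

/-- Every failure of the decoder comes from a connected cluster of nodes, of which a large fraction
carries faults. -/
theorem exists_cluster {w : ℝ} (hw : 0 < w) {Dec : (D → ZMod 2) → Finset C.Meas → ZMod 2}
    (hDec : C.IsEnvelopeMLE w Dec) {p : C.PauliLoc → Pauli × Pauli} {l : Finset C.LossLoc}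
    {r : Finset C.Meas} (hfail : C.Fails Dec p l r) :
    ∃ (W : Finset C.Node) (err : C.Node → Config S), (∀ n ∈ W, err n ∈ C.nodeErrors n) ∧
      C.outcome (∑ n ∈ W, err n) = (0, 1) ∧ W.card ≤ ∑ n ∈ W, C.weight p (C.lostAtoms l) r n ∧
      ∀ A ⊆ W, A.Nonempty → A ≠ W → ∃ a ∈ A, ∃ a' ∈ W \ A, ∃ i,
        C.syndrome (err a) i ≠ 0 ∧ C.syndrome (err a') i ≠ 0 := by
  classical
  obtain ⟨e, ⟨f, hf, rfl⟩, hne⟩ := hfail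
  have hfeas := actual_feasible p (Finset.subset_union_right (s₁ := C.lostAtoms l)) hf
  have hout := actual_outcome p (C.lostAtoms l ∪ r) f
  obtain ⟨a, ha, hopt, hpred⟩ := hDec _ r ⟨_, hfeas⟩
  -- The actual faults and the optimal solution have equal detectors but, because of the failure,
  -- different observables.
  have hsum : ∑ n ∈ Finset.univ,
      ((actual p (C.lostAtoms l ∪ r) f).nodeOutcome n + a.nodeOutcome n) = (0, 1) := by
    rw [Finset.sum_add_distrib, ← Assignment.outcome_eq_sum, ← Assignment.outcome_eq_sum]
    ext i
    · rw [Prod.fst_add, ha.2.2.2, hfeas.2.2.2]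
      exact zmod2_self_add _
    · rw [hpred] at hne
      rw [Prod.snd_add, hout]
      change C.observable _ + _ = 1
      revert hne
      generalize a.outcome.2 = x
      generalize C.observable _ = y
      revert x y
      decide
  obtain ⟨W, -, hW, hWne, hconn⟩ := exists_minimal_cluster Finset.univ _ hsum
  have hex : ∀ n, ∃ e, n ∈ W → e ∈ C.nodeErrors n ∧ C.outcome e =
      (actual p (C.lostAtoms l ∪ r) f).nodeOutcome n + a.nodeOutcome n := by
    intro n
    by_cases hn : n ∈ W
    · obtain ⟨e, he, heo⟩ := exists_nodeError hf ha (hWne n hn)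
      exact ⟨e, fun _ => ⟨he, heo⟩⟩
    · exact ⟨0, fun h => absurd h hn⟩
  choose err herr using hex
  refine ⟨W, err, fun n hn => (herr n hn).1, ?_, ?_, fun A hA hAne hAW => ?_⟩
  · rw [← outcomeHom_apply, map_sum, ← hW]
    exact Finset.sum_congr rfl fun n hn => (herr n hn).2
  · exact card_le_weight hw (hopt _ (Assignment.feasible_mix ha hfeas (by rw [hW]))) hWne
  · obtain ⟨x, hx, x', hx', i, h1, h2⟩ := hconn A hA hAne hAW
    refine ⟨x, hx, x', hx', i, ?_, ?_⟩
    · rw [← (herr x (hA hx)).2] at h1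
      exact h1
    · rw [← (herr x' (Finset.mem_sdiff.1 hx').1).2] at h2
      exact h2

end Experiment

end AtomLoss

/-! ### The failure condition -/

namespace AtomLoss

open Experiment

variable {d T : ℕ} {b : Basis}

/-- `pairing` as a homomorphism of configurations. -/
def pairingHom (d T : ℕ) (b : Basis) (w : Data d → ZMod 2) : Config (Site d) →+ ZMod 2 :=
  AddMonoidHom.mk' (pairing T b w) (pairing_add T b w)

theorem thin_of_mem_nodeErrors {n : (midSwap d T b).Node} {e : Config (Site d)}
    (he : e ∈ (midSwap d T b).nodeErrors n) : Thin T b e := by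
  rcases n with ℓ | m
  · obtain ⟨v, rfl⟩ := he
    exact thin_fault ℓ v
  · obtain ⟨e₁, he₁, e₂, he₂, rfl⟩ := he
    exact thin_atoms he₁ he₂

/-- An undetected logical flip takes at least `d` nodes. -/
theorem le_card_of_outcome (hd : 0 < d) (hT : 1 ≤ T) {W : Finset (midSwap d T b).Node}
    {err : (midSwap d T b).Node → Config (Site d)}
    (herr : ∀ n ∈ W, err n ∈ (midSwap d T b).nodeErrors n)
    (hout : (midSwap d T b).outcome (∑ n ∈ W, err n) = (0, 1)) : d ≤ W.card := by
  classical
  have hex : ∀ n, ∃ S : Data d → ZMod 2, n ∈ W → Narrow b S ∧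
      ∀ w, Commutes b w → pairing T b w (err n) = ∑ q, S q * w q := by
    intro n
    by_cases hn : n ∈ W
    · obtain ⟨S, hS⟩ := thin_of_mem_nodeErrors (herr n hn)
      exact ⟨S, fun _ => hS⟩
    · exact ⟨0, fun h => absurd h hn⟩
  choose S hS using hex
  -- Against commuting `w`, the combined error is the sum of the narrow operators of its nodes.
  have hpair : ∀ w, Commutes b w →
      ∑ q, (∑ n ∈ W, S n) q * w q = pairing T b w (∑ n ∈ W, err n) := by
    intro w hw
    have h1 : pairing T b w (∑ n ∈ W, err n) = ∑ n ∈ W, pairing T b w (err n) :=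
      map_sum (pairingHom d T b w) err W
    rw [h1, Finset.sum_congr rfl fun n hn => (hS n hn).2 w hw, Finset.sum_comm]
    refine Finset.sum_congr rfl fun q _ => ?_
    rw [Finset.sum_apply, Finset.sum_mul]
  refine distance b hd W S (fun n hn => (hS n hn).1) (fun P hP hPb => ?_) ?_
  · rw [hpair _ (hPb ▸ commutes_stab hP), ← sum_syndrome_eq_pairing hT hP hPb]
    exact Finset.sum_eq_zero fun t _ => congrFun (congrArg Prod.fst hout) (t, P)
  · rw [hpair _ (commutes_logical b), ← observable_eq_pairing]
    exact congrArg Prod.snd hout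

namespace Experiment

theorem sum_weight_le {S D : Type} [Fintype S] [DecidableEq S] (C : Experiment S D)
    (p : C.PauliLoc → Pauli × Pauli) (R r : Finset C.Meas) (W : Finset C.Node) :
    ∑ n ∈ W, C.weight p R r n ≤ 2 * C.numPauli p + r.card + 2 * (R \ r).card := by
  classical
  refine (Finset.sum_le_sum_of_subset (Finset.subset_univ W)).trans ?_
  rw [Fintype.sum_sum_type, add_assoc]
  refine add_le_add ?_ ?_
  · simp only [weight, numPauli]
    rw [← Finset.sum_filter, Finset.sum_const, smul_eq_mul, mul_comm]
  · have h1 : ∀ m : C.Meas, C.weight p R r (Sum.inr m) =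
        (if m ∈ r then 1 else 0) + if m ∈ R \ r then 2 else 0 := by
      intro m
      simp only [weight, Finset.mem_sdiff]
      by_cases hm : m ∈ r <;> simp [hm]
    simp only [h1]
    rw [Finset.sum_add_distrib, ← Finset.sum_filter, ← Finset.sum_filter]
    have h2 : ∀ A : Finset C.Meas, (Finset.univ.filter fun m => m ∈ A) = A := fun A => by
      ext; simp
    rw [h2, h2, Finset.sum_const, Finset.sum_const, smul_eq_mul, smul_eq_mul, mul_one, mul_comm 2]

end Experiment

/-- The failure condition. -/
theorem le_of_fails (hd : 0 < d) (hT : 1 ≤ T) {w : ℝ} (hw : 0 < w)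
    {Dec : (Fin (T + 1) × Plaq d → ZMod 2) → Finset (midSwap d T b).Meas → ZMod 2}
    (hDec : (midSwap d T b).IsEnvelopeMLE w Dec)
    {p : (midSwap d T b).PauliLoc → Pauli × Pauli} {l : Finset (midSwap d T b).LossLoc}
    {r : Finset (midSwap d T b).Meas} (hfail : (midSwap d T b).Fails Dec p l r) :
    d ≤ 2 * (midSwap d T b).numPauli p + r.card +
      2 * ((midSwap d T b).lostAtoms l \ r).card := by
  obtain ⟨W, err, herr, hout, hcard, -⟩ := exists_cluster hw hDec hfail
  exact (le_card_of_outcome hd hT herr hout).trans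
    (hcard.trans (sum_weight_le (midSwap d T b) p _ r W))

end AtomLoss

namespace AtomLoss

/-! ## Counting connected sets -/

/-- A set of which every two complementary nonempty parts contain related elements. -/
def Linked {V : Type*} [DecidableEq V] (adj : V → V → Prop) (W : Finset V) : Prop :=
  ∀ A ⊆ W, A.Nonempty → A ≠ W → ∃ a ∈ A, ∃ a' ∈ W \ A, adj a a'

section Walks

variable {V : Type*} [DecidableEq V] {Δ : ℕ}

/-- The vertices on the walk from `v` that takes the given steps. -/
def visited (nb : V → Fin Δ → V) : V → List (Fin Δ) → Finset V
  | v, [] => {v}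
  | v, i :: L => insert v (visited nb (nb v i) L)

/-- Where the walk passes `u`, a detour to `x` and back is inserted; it adds two steps and no vertex
other than `x`. -/
theorem exists_visited_insert {nb : V → Fin Δ → V} {adj : V → V → Prop}
    (hsymm : ∀ u v, adj u v → adj v u) (hnb : ∀ u v, adj u v → ∃ i, nb u i = v)
    (L : List (Fin Δ)) {v u x : V} (hu : u ∈ visited nb v L) (hx : adj u x) :
    ∃ L', L'.length = L.length + 2 ∧ visited nb v L' = insert x (visited nb v L) := by
  have hhead : ∀ (L : List (Fin Δ)) (v : V), adj v x →
      ∃ L', L'.length = L.length + 2 ∧ visited nb v L' = insert x (visited nb v L) := by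
    intro L v hv
    obtain ⟨i, hi⟩ := hnb v x hv
    obtain ⟨j, hj⟩ := hnb x v (hsymm _ _ hv)
    refine ⟨i :: j :: L, rfl, ?_⟩
    have hmem : v ∈ visited nb v L := by cases L <;> simp [visited]
    rw [visited, visited, hi, hj, Finset.insert_comm, Finset.insert_eq_of_mem hmem]
  induction L generalizing v with
  | nil =>
    rw [visited, Finset.mem_singleton] at hu
    exact hhead [] v (hu ▸ hx)
  | cons i L ih =>
    rw [visited, Finset.mem_insert] at hu
    rcases hu with rfl | hu
    · exact hhead _ _ hx
    · obtain ⟨L', h1, h2⟩ := ih hu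
      refine ⟨i :: L', by simp [h1], ?_⟩
      rw [visited, visited, h2, Finset.insert_comm]

/-- Grow a subset of `W` from `v` by detours: linkedness supplies a new vertex as long as the subset
is not all of `W`, and each vertex after the first costs two steps. -/
theorem Linked.exists_visited {nb : V → Fin Δ → V} {adj : V → V → Prop}
    (hsymm : ∀ u v, adj u v → adj v u) (hnb : ∀ u v, adj u v → ∃ i, nb u i = v)
    {W : Finset V} (hW : Linked adj W) {v : V} (hv : v ∈ W) :
    ∃ L, L.length + 2 = 2 * W.card ∧ visited nb v L = W := by
  have key : ∀ n < W.card, ∃ L, L.length = 2 * n ∧ (visited nb v L).card = n + 1 ∧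
      visited nb v L ⊆ W := by
    intro n
    induction n with
    | zero => exact fun _ => ⟨[], rfl, by simp [visited], by simpa [visited] using hv⟩
    | succ n ih =>
      intro hn
      obtain ⟨L, h1, h2, h3⟩ := ih (by omega)
      obtain ⟨u, hu, x, hx, hux⟩ := hW _ h3 (Finset.card_pos.1 (by omega))
        (fun h => by rw [h] at h2; omega)
      rw [Finset.mem_sdiff] at hx
      obtain ⟨L', h4, h5⟩ := exists_visited_insert hsymm hnb L hu hux
      refine ⟨L', by omega, ?_, ?_⟩
      · rw [h5, Finset.card_insert_of_notMem hx.2, h2]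
      · rw [h5]
        exact Finset.insert_subset hx.1 h3
  have hpos : 0 < W.card := Finset.card_pos.2 ⟨v, hv⟩
  obtain ⟨L, h1, h2, h3⟩ := key (W.card - 1) (by omega)
  exact ⟨L, by omega, Finset.eq_of_subset_of_card_le h3 (by omega)⟩

theorem exists_enumeration [Fintype V] (adj : V → V → Prop) [∀ v, DecidablePred (adj v)]
    (hΔ : ∀ v, (Finset.univ.filter (adj v)).card ≤ Δ) :
    ∃ nb : V → Fin Δ → V, ∀ u v, adj u v → ∃ i, nb u i = v := by
  have h : ∀ u, ∃ f : Fin Δ → V, ∀ v, adj u v → ∃ i, f i = v := by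
    intro u
    let e := (Finset.univ.filter (adj u)).equivFin
    refine ⟨fun i => if h : i.val < (Finset.univ.filter (adj u)).card then (e.symm ⟨i, h⟩).1
      else u, fun v hv => ?_⟩
    have hmem : v ∈ Finset.univ.filter (adj u) := by simpa using hv
    refine ⟨⟨e ⟨v, hmem⟩, (e ⟨v, hmem⟩).isLt.trans_le (hΔ u)⟩, ?_⟩
    simp
  choose nb hnb using h
  exact ⟨nb, hnb⟩

open Classical in
/-- The number of linked sets of a given size at a given vertex is at most exponential. -/
theorem card_linked_le [Fintype V] {adj : V → V → Prop}
    (hsymm : ∀ u v, adj u v → adj v u) (hΔ : ∀ v, (Finset.univ.filter (adj v)).card ≤ Δ)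
    (hpos : 0 < Δ) (v : V) (N : ℕ) :
    (Finset.univ.filter fun W : Finset V => Linked adj W ∧ v ∈ W ∧ W.card = N).card ≤
      Δ ^ (2 * N) := by
  obtain ⟨nb, hnb⟩ := exists_enumeration adj hΔ
  have hsub : (Finset.univ.filter fun W : Finset V => Linked adj W ∧ v ∈ W ∧ W.card = N) ⊆
      Finset.univ.image fun f : Fin (2 * N - 2) → Fin Δ => visited nb v (List.ofFn f) := by
    intro W hW
    obtain ⟨h1, h2, h3⟩ := (Finset.mem_filter.1 hW).2
    obtain ⟨L, h4, h5⟩ := h1.exists_visited hsymm hnb h2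
    have hlen : L.length = 2 * N - 2 := by omega
    rw [Finset.mem_image]
    refine ⟨fun i => L.get (i.cast hlen.symm), Finset.mem_univ _, ?_⟩
    rw [← h5]
    congr 1
    apply List.ext_get
    · simp [hlen]
    · intro n h h'
      simp
  calc _ ≤ _ := Finset.card_le_card hsub
    _ ≤ _ := Finset.card_image_le
    _ = Δ ^ (2 * N - 2) := by simp
    _ ≤ _ := Nat.pow_le_pow_right hpos (by omega)

open Classical in
/-- The generating function of large linked sets. -/
theorem sum_linked_le [Fintype V] {adj : V → V → Prop}
    (hsymm : ∀ u v, adj u v → adj v u) (hΔ : ∀ v, (Finset.univ.filter (adj v)).card ≤ Δ)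
    (hpos : 0 < Δ) {c : ℝ} (hc : 0 ≤ c) (hc' : (Δ : ℝ) ^ 2 * c ≤ 1 / 2) {n : ℕ} (hn : 0 < n) :
    ∑ W : Finset V with Linked adj W ∧ n ≤ W.card, c ^ W.card ≤
      2 * Fintype.card V * ((Δ : ℝ) ^ 2 * c) ^ n := by
  have hx : 0 ≤ (Δ : ℝ) ^ 2 * c := by positivity
  have hv : ∀ v : V, ∑ W : Finset V with (Linked adj W ∧ n ≤ W.card) ∧ v ∈ W, c ^ W.card ≤
      2 * ((Δ : ℝ) ^ 2 * c) ^ n := by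
    intro v
    calc ∑ W : Finset V with (Linked adj W ∧ n ≤ W.card) ∧ v ∈ W, c ^ W.card
        = ∑ N ∈ Finset.Ico n (Fintype.card V + 1),
          ∑ W : Finset V with ((Linked adj W ∧ n ≤ W.card) ∧ v ∈ W) ∧ W.card = N,
            c ^ W.card := by
          rw [← Finset.sum_fiberwise_of_maps_to (g := Finset.card)
            (t := Finset.Ico n (Fintype.card V + 1))]
          · simp only [Finset.filter_filter]
          · intro W hW
            rw [Finset.mem_Ico]
            exact ⟨(Finset.mem_filter.1 hW).2.1.2, Nat.lt_succ_of_le W.card_le_univ⟩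
      _ ≤ ∑ N ∈ Finset.Ico n (Fintype.card V + 1), ((Δ : ℝ) ^ 2 * c) ^ N := by
          refine Finset.sum_le_sum fun N _ => ?_
          calc ∑ W : Finset V with ((Linked adj W ∧ n ≤ W.card) ∧ v ∈ W) ∧ W.card = N, c ^ W.card
              ≤ ∑ W : Finset V with Linked adj W ∧ v ∈ W ∧ W.card = N, c ^ N := by
                refine (Finset.sum_congr rfl fun W hW => ?_).trans_le
                  (Finset.sum_le_sum_of_subset_of_nonneg ?_ fun _ _ _ => pow_nonneg hc N)
                · rw [(Finset.mem_filter.1 hW).2.2]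
                · intro W hW
                  simp only [Finset.mem_filter, Finset.mem_univ, true_and] at hW ⊢
                  exact ⟨hW.1.1.1, hW.1.2, hW.2⟩
            _ ≤ ((Δ ^ (2 * N) : ℕ) : ℝ) * c ^ N := by
                rw [Finset.sum_const, nsmul_eq_mul]
                exact mul_le_mul_of_nonneg_right
                  (by exact_mod_cast card_linked_le hsymm hΔ hpos v N) (pow_nonneg hc N)
            _ = ((Δ : ℝ) ^ 2 * c) ^ N := by
                push_cast
                rw [mul_pow, pow_mul]
      _ ≤ ((Δ : ℝ) ^ 2 * c) ^ n / (1 - (Δ : ℝ) ^ 2 * c) :=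
          geom_sum_Ico_le_of_lt_one hx (by linarith)
      _ ≤ 2 * ((Δ : ℝ) ^ 2 * c) ^ n := by
          rw [div_le_iff₀ (by linarith)]
          nlinarith [pow_nonneg hx n]
  -- Counting each set once for every vertex it contains only increases the sum, as `n > 0` makes
  -- the sets nonempty. This reduces to sets through a given vertex.
  calc ∑ W : Finset V with Linked adj W ∧ n ≤ W.card, c ^ W.card
      ≤ ∑ W : Finset V with Linked adj W ∧ n ≤ W.card, ∑ v ∈ W, c ^ W.card := by
        refine Finset.sum_le_sum fun W hW => ?_
        rw [Finset.sum_const, nsmul_eq_mul]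
        have h1 : (1 : ℝ) ≤ W.card := by
          exact_mod_cast hn.trans_le (Finset.mem_filter.1 hW).2.2
        nlinarith [pow_nonneg hc W.card]
    _ = ∑ v, ∑ W : Finset V with (Linked adj W ∧ n ≤ W.card) ∧ v ∈ W, c ^ W.card := by
        refine Finset.sum_comm' fun W v => ?_
        simp
    _ ≤ ∑ v : V, 2 * ((Δ : ℝ) ^ 2 * c) ^ n := Finset.sum_le_sum fun v _ => hv v
    _ = _ := by
        rw [Finset.sum_const, Finset.card_univ, nsmul_eq_mul]
        ring

end Walks

end AtomLoss

namespace AtomLoss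

open Experiment

variable {d T : ℕ} {b : Basis}

/-! ## Locality of the cluster -/

/-- The number of space-time locations in a region is bounded. -/
theorem card_region_le {N : ℕ} (a n τ₀ : ℕ) (s₀ : Site d) (A : Finset (Fin N × Site d))
    (h : ∀ x ∈ A, x.1.val ≤ τ₀ + a ∧ τ₀ ≤ x.1.val + a ∧ Near n x.2 s₀) :
    A.card ≤ (2 * a + 1) * ((2 * n + 1) * ((2 * n + 1) * 2)) := by
  have hinj := Finset.card_le_card_of_injOn (s := A)
    (t := Finset.range (2 * a + 1) ×ˢ Finset.range (2 * n + 1) ×ˢ Finset.range (2 * n + 1) ×ˢ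
      (Finset.univ : Finset Bool))
    -- A location is determined by its layer, row and column relative to the centre, and by whether
    -- it is a data or an ancilla site.
    (fun x => (x.1.val + a - τ₀, siteRow x.2 + n - siteRow s₀, siteCol x.2 + n - siteCol s₀,
      x.2.isLeft)) ?_ ?_
  · simpa using hinj
  · intro x hx
    obtain ⟨h1, h2, h3⟩ := h x hx
    unfold Near at h3
    simp only [Finset.coe_product, Set.mem_prod, Finset.mem_coe, Finset.mem_range,
      Finset.mem_univ, and_true]
    omega
  · intro x hx y hy hxy
    obtain ⟨h1, h2, h3⟩ := h x hx
    obtain ⟨h1', h2', h3'⟩ := h y hy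
    simp only [Prod.mk.injEq] at hxy
    obtain ⟨e1, e2, e3, e4⟩ := hxy
    unfold Near at h3 h3'
    have r1 : x.1 = y.1 := Fin.ext (by omega)
    have r2 : siteRow x.2 = siteRow y.2 := by omega
    have r3 : siteCol x.2 = siteCol y.2 := by omega
    refine Prod.ext r1 ?_
    clear * - r2 r3 e4
    rcases x with ⟨τ, q | P⟩ <;> rcases y with ⟨τ', q' | P'⟩
    · exact congrArg Sum.inl (Prod.ext (Fin.ext r2) (Fin.ext r3))
    · cases e4
    · cases e4
    · exact congrArg Sum.inr (Prod.ext (Fin.ext r2) (Fin.ext r3))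

/-- The layer and the site of a node. -/
def Experiment.Node.place {S D : Type} {C : Experiment S D} : C.Node → Fin C.depth × S
  | Sum.inl ℓ => ℓ.1
  | Sum.inr m => m.1

/-- Nodes that are close in space-time. -/
def Close (n n' : (midSwap d T b).Node) : Prop :=
  (Node.place n').1.val ≤ (Node.place n).1.val + 34 ∧
    (Node.place n).1.val ≤ (Node.place n').1.val + 34 ∧
      Near 20 (Node.place n').2 (Node.place n).2

theorem Close.symm {n n' : (midSwap d T b).Node} (h : Close n n') : Close n' n :=
  ⟨h.2.1, h.1, h.2.2.symm⟩

theorem near_of_op_ctrl {τ : ℕ} {s s' : Site d} (h : (midSwap d T b).op τ s = Op.ctrl s') :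
    Near 1 s' s := by
  obtain ⟨k, i, t, q, -, -, -, -, hq⟩ := midSwap_op_eq_ctrl h
  rcases hq with ⟨rfl, rfl⟩ | ⟨rfl, rfl⟩
  · exact (near_meet k t q).symm
  · exact near_meet k t q

theorem support_of_mem_nodeErrors (hd : 3 ≤ d) (hodd : Odd d) {n : (midSwap d T b).Node}
    {e : Config (Site d)} (he : e ∈ (midSwap d T b).nodeErrors n) {τ : ℕ} {s : Site d}
    (h : e τ s ≠ 0) : τ ≤ (Node.place n).1.val + 1 ∧ (Node.place n).1.val ≤ τ + 20 ∧
      Near 2 s (Node.place n).2 := by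
  rcases n with ℓ | m
  · obtain ⟨v, rfl⟩ := he
    change τ ≤ ℓ.1.1.val + 1 ∧ ℓ.1.1.val ≤ τ + 20 ∧ Near 2 s ℓ.1.2
    by_cases hc : ∃ t, (midSwap d T b).op ℓ.1.1 ℓ.1.2 = Op.ctrl t
    · obtain ⟨s', hs'⟩ := hc
      obtain ⟨h1, h2⟩ := (midSwap d T b).faultConfig_ctrl hs' h
      refine ⟨by omega, by omega, ?_⟩
      rcases h2 with rfl | rfl
      · exact near_self _ _
      · exact (near_of_op_ctrl hs').mono (by omega)
    · push Not at hc
      obtain ⟨τ₀, h1, h2⟩ := (midSwap d T b).faultConfig_not_ctrl ℓ hc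
      obtain ⟨h3, rfl⟩ := h2 v τ s h
      exact ⟨by omega, by omega, near_self _ _⟩
  · change τ ≤ m.1.1.val + 1 ∧ m.1.1.val ≤ τ + 20 ∧ Near 2 s m.1.2
    have hw : (midSwap d T b).OnWire τ s m.1.1 m.1.2 := by
      obtain ⟨e₁, he₁, e₂, he₂, rfl⟩ := he
      by_cases h1 : e₁ τ s = 0
      · exact onWire_of_ne_zero he₂ (fun h2 => h (by simp [h1, h2]))
      · exact onWire_of_ne_zero he₁ h1
    have := hw.1
    exact ⟨by omega, lifetime hd hodd hw, near_of_onWire hw⟩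

/-- Nodes that trigger a common detector are close. -/
theorem close_of_syndrome (hd : 3 ≤ d) (hodd : Odd d) (hT : 1 ≤ T) {n n' : (midSwap d T b).Node}
    {e e' : Config (Site d)} (he : e ∈ (midSwap d T b).nodeErrors n)
    (he' : e' ∈ (midSwap d T b).nodeErrors n') {i : Fin (T + 1) × Plaq d}
    (h : (midSwap d T b).syndrome e i ≠ 0) (h' : (midSwap d T b).syndrome e' i ≠ 0) :
    Close n n' := by
  obtain ⟨t, P⟩ := i
  obtain ⟨τ, s, h1, h2, h3, h4⟩ := exists_of_syndrome_ne_zero hT h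
  obtain ⟨τ', s', h1', h2', h3', h4'⟩ := exists_of_syndrome_ne_zero hT h'
  obtain ⟨h5, h6, h7⟩ := support_of_mem_nodeErrors hd hodd he h1
  obtain ⟨h5', h6', h7'⟩ := support_of_mem_nodeErrors hd hodd he' h1'
  -- In time, a node lies at most 27 layers after and 7 layers before `7 * t`, and 27 + 7 = 34. In
  -- space, 20 = 2 + 8 + 8 + 2.
  refine ⟨by omega, by omega, ?_⟩
  exact (h7'.symm.trans (h4'.trans (h4.symm.trans h7)))

/-- An upper bound for the number of nodes close to a given one. -/
def closeBound : ℕ := 2 * ((2 * 34 + 1) * ((2 * 20 + 1) * ((2 * 20 + 1) * 2)))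

open Classical in
theorem card_close_le (n : (midSwap d T b).Node) :
    (Finset.univ.filter (Close n)).card ≤ closeBound := by
  rw [closeBound, two_mul, ← Finset.card_toLeft_add_card_toRight]
  refine add_le_add ?_ ?_
  · rw [← Finset.card_map (Function.Embedding.subtype _)]
    refine card_region_le 34 20 (Node.place n).1.val (Node.place n).2 _ fun x hx => ?_
    simp only [Finset.mem_map, Finset.mem_toLeft, Finset.mem_filter, Finset.mem_univ,
      true_and] at hx
    obtain ⟨ℓ, hℓ, rfl⟩ := hx
    exact hℓ
  · rw [← Finset.card_map (Function.Embedding.subtype _)]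
    refine card_region_le 34 20 (Node.place n).1.val (Node.place n).2 _ fun x hx => ?_
    simp only [Finset.mem_map, Finset.mem_toRight, Finset.mem_filter, Finset.mem_univ,
      true_and] at hx
    obtain ⟨ℓ, hℓ, rfl⟩ := hx
    exact hℓ

/-- An upper bound for the number of operations on an atom. -/
def lifeBound : ℕ := (2 * 21 + 1) * ((2 * 2 + 1) * ((2 * 2 + 1) * 2))

open Classical in
theorem card_detects_le (hd : 3 ≤ d) (hodd : Odd d) (m : (midSwap d T b).Meas) :
    (Finset.univ.filter fun ℓ => (midSwap d T b).Detects ℓ m).card ≤ lifeBound := by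
  rw [← Finset.card_map (Function.Embedding.subtype _)]
  refine card_region_le 21 2 m.1.1.val m.1.2 _ fun x hx => ?_
  simp only [Finset.mem_map, Finset.mem_filter, Finset.mem_univ, true_and] at hx
  obtain ⟨ℓ, hℓ, rfl⟩ := hx
  have h1 := hℓ.1
  have h2 := lifetime hd hodd hℓ
  change ℓ.1.1.val ≤ m.1.1.val + 21 ∧ m.1.1.val ≤ ℓ.1.1.val + 21 ∧ Near 2 ℓ.1.2 m.1.2
  exact ⟨by omega, by omega, near_of_onWire hℓ⟩

/-- The number of sites is quadratic in `d`; the crude factor `4 ^ d` suffices because it can be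
absorbed into the threshold. -/
theorem card_node_le (hd : 3 ≤ d) (hT : 1 ≤ T) :
    Fintype.card (midSwap d T b).Node ≤ 90 * T * 4 ^ d := by
  have h1 : Fintype.card (midSwap d T b).PauliLoc ≤ (7 * T + 2) * (d * d + (d + 1) * (d + 1)) := by
    refine (Fintype.card_subtype_le _).trans (le_of_eq ?_)
    rw [Fintype.card_prod, Fintype.card_sum, Fintype.card_prod, Fintype.card_prod,
      Fintype.card_fin, Fintype.card_fin, Fintype.card_fin, midSwap_depth]
  have h2 : Fintype.card (midSwap d T b).Meas ≤ (7 * T + 2) * (d * d + (d + 1) * (d + 1)) := by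
    refine (Fintype.card_subtype_le _).trans (le_of_eq ?_)
    rw [Fintype.card_prod, Fintype.card_sum, Fintype.card_prod, Fintype.card_prod,
      Fintype.card_fin, Fintype.card_fin, Fintype.card_fin, midSwap_depth]
  have h3 : d * d ≤ 4 ^ d := by
    rw [show (4 : ℕ) = 2 * 2 from rfl, mul_pow]
    exact Nat.mul_le_mul Nat.lt_two_pow_self.le Nat.lt_two_pow_self.le
  have h4 : d * d + (d + 1) * (d + 1) ≤ 5 * 4 ^ d := by nlinarith
  have h5 : (7 * T + 2) * (d * d + (d + 1) * (d + 1)) ≤ 9 * T * (5 * 4 ^ d) :=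
    Nat.mul_le_mul (by omega) h4
  rw [Fintype.card_sum]
  calc _ ≤ 9 * T * (5 * 4 ^ d) + 9 * T * (5 * 4 ^ d) := add_le_add (h1.trans h5) (h2.trans h5)
    _ = _ := by ring

end AtomLoss

namespace AtomLoss

/-! ## Large deviations of the weight of a set of nodes -/

theorem sum_finset_prod_ite {ι : Type*} [Fintype ι] [DecidableEq ι] (f g : ι → ℝ) :
    ∑ l : Finset ι, ∏ i, (if i ∈ l then f i else g i) = ∏ i, (f i + g i) := by
  rw [Finset.prod_add, Finset.powerset_univ]
  refine Finset.sum_congr rfl fun l _ => ?_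
  rw [Finset.prod_ite]
  congr 1
  · exact Finset.prod_congr (by ext; simp) fun _ _ => rfl
  · exact Finset.prod_congr (by ext; simp) fun _ _ => rfl

theorem prod_ite_eq_pow_card {ι : Type*} [Fintype ι] (P : ι → Prop) [DecidablePred P] (y : ℝ) :
    (∏ i, if P i then y else 1) = y ^ (Finset.univ.filter P).card := by
  rw [← Finset.prod_filter, Finset.prod_const]

theorem Op.faultProb_zero {S : Type} (q : ℝ) (o : Op S) : o.faultProb q 0 = 1 - q := by
  cases o <;> simp [faultProb]

theorem Op.faultProb_nonneg {S : Type} {q : ℝ} (h0 : 0 ≤ q) (h1 : q ≤ 1) (o : Op S)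
    (v : Pauli × Pauli) : 0 ≤ o.faultProb q v := by
  have h2 : 0 ≤ 1 - q := by linarith
  cases o <;> simp only [faultProb] <;> split_ifs <;> positivity

theorem Op.sum_faultProb {S : Type} (q : ℝ) (o : Op S) : ∑ v, o.faultProb q v = 1 := by
  have h2 : ∀ f : ZMod 2 → ℝ, ∑ x, f x = f 0 + f 1 := fun f => Fin.sum_univ_two f
  cases o <;> simp only [faultProb, Fintype.sum_prod_type, h2] <;> simp <;> ring

/-- The expectation is `1 - q + q * y ^ 2`. -/
theorem Op.sum_faultProb_mul_le {S : Type} {q y : ℝ} (hq : q * y ^ 2 ≤ 1) (h0 : 0 ≤ q)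
    (o : Op S) : ∑ v, o.faultProb q v * (if v ≠ 0 then y ^ 2 else 1) ≤ 2 := by
  have h1 := o.sum_faultProb q
  have h2 : ∑ v, o.faultProb q v * (if v ≠ 0 then y ^ 2 else 1) =
      y ^ 2 * ∑ v, o.faultProb q v + (1 - y ^ 2) * o.faultProb q 0 := by
    rw [← Finset.add_sum_erase _ _ (Finset.mem_univ (0 : Pauli × Pauli)),
      ← Finset.add_sum_erase _ (o.faultProb q) (Finset.mem_univ (0 : Pauli × Pauli)),
      mul_add, Finset.mul_sum,
      Finset.sum_congr (rfl : Finset.univ.erase (0 : Pauli × Pauli) = _) fun v hv => by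
        rw [if_pos (Finset.ne_of_mem_erase hv), mul_comm]]
    simp
    ring
  rw [h2, h1, o.faultProb_zero]
  nlinarith

namespace Experiment

variable {S D : Type} [Fintype S] [DecidableEq S] {C : Experiment S D}

/-- A lost atom is detected by one measurement only. -/
theorem Detects.unique {ℓ : C.LossLoc} {m m' : C.Meas} (h : C.Detects ℓ m) (h' : C.Detects ℓ m') :
    m = m' := by
  have h1 := OnWire.le_meas h h' m'.2
  have h2 := OnWire.le_meas h' h m.2
  have h3 := h.2
  have h4 := h'.2
  rw [le_antisymm h1 h2] at h3
  refine Subtype.ext (Prod.ext (Fin.ext (le_antisymm h1 h2)) ?_)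
  exact Option.some_injective _ (h3.symm.trans h4)

variable (C)

theorem pauliProb_nonneg {q : ℝ} (h0 : 0 ≤ q) (h1 : q ≤ 1) (p : C.PauliLoc → Pauli × Pauli) :
    0 ≤ C.pauliProb q p :=
  Finset.prod_nonneg fun _ _ => Op.faultProb_nonneg h0 h1 _ _

theorem lossProb_nonneg {q : ℝ} (h0 : 0 ≤ q) (h1 : q ≤ 1) (l : Finset C.LossLoc) :
    0 ≤ C.lossProb q l :=
  Finset.prod_nonneg fun _ _ => by split_ifs <;> linarith

theorem readoutProb_nonneg {q : ℝ} (h0 : 0 ≤ q) (h1 : q ≤ 1) (R r : Finset C.Meas) :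
    0 ≤ C.readoutProb q R r :=
  Finset.prod_nonneg fun _ _ => by split_ifs <;> linarith

open Classical in
theorem pow_sum_weight (y : ℝ) (p : C.PauliLoc → Pauli × Pauli) (R r : Finset C.Meas)
    (W : Finset C.Node) : y ^ (∑ n ∈ W, C.weight p R r n) =
      (∏ ℓ, if Sum.inl ℓ ∈ W then (if p ℓ ≠ 0 then y ^ 2 else 1) else 1) *
      ∏ m, if Sum.inr m ∈ W then (if m ∈ r then y else if m ∈ R then y ^ 2 else 1) else 1 := by
  rw [← Finset.prod_pow_eq_pow_sum,
    ← Fintype.prod_ite_mem W fun n => y ^ C.weight p R r n, Fintype.prod_sum_type]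
  congr 1
  · refine Finset.prod_congr rfl fun ℓ _ => ?_
    by_cases h : p ℓ ≠ 0 <;> simp [weight, h]
  · refine Finset.prod_congr rfl fun m _ => ?_
    by_cases h : m ∈ r <;> by_cases h' : m ∈ R <;> simp [weight, h, h']

open Classical in
theorem sum_pauliProb_mul_le {q y : ℝ} (h0 : 0 ≤ q) (h1 : q ≤ 1) (hq : q * y ^ 2 ≤ 1)
    (W : Finset C.Node) :
    ∑ p, C.pauliProb q p *
      (∏ ℓ, if Sum.inl ℓ ∈ W then (if p ℓ ≠ 0 then y ^ 2 else 1) else 1) ≤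
      ∏ ℓ : C.PauliLoc, if Sum.inl ℓ ∈ W then 2 else 1 := by
  have h2 : ∑ p, C.pauliProb q p *
      (∏ ℓ, if Sum.inl ℓ ∈ W then (if p ℓ ≠ 0 then y ^ 2 else 1) else 1) =
      ∏ ℓ : C.PauliLoc, ∑ v, (C.op ℓ.1.1 ℓ.1.2).faultProb q v *
        (if Sum.inl ℓ ∈ W then (if v ≠ 0 then y ^ 2 else 1) else 1) := by
    rw [Finset.prod_univ_sum, Fintype.piFinset_univ]
    refine Finset.sum_congr rfl fun p _ => ?_
    rw [pauliProb, ← Finset.prod_mul_distrib]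
  rw [h2]
  refine Finset.prod_le_prod (fun ℓ _ => Finset.sum_nonneg fun v _ =>
    mul_nonneg (Op.faultProb_nonneg h0 h1 _ _) ?_) fun ℓ _ => ?_
  · split_ifs <;> positivity
  · split_ifs with h
    · exact Op.sum_faultProb_mul_le hq h0 _
    · simp only [mul_one]
      exact (Op.sum_faultProb q _).le

open Classical in
-- At an atom of `W` that is present the expectation is `(1 - q) + q * y ≤ 2`; at a lost one it is
-- `(1 - q) * y + q * y ^ 2 ≤ 2 * y`. The remaining factor `y` for each lost atom is left to the sum
-- over losses.
theorem sum_readoutProb_mul_le {q y : ℝ} (h0 : 0 ≤ q) (h1 : q ≤ 1) (hy : 1 ≤ y) (hq : q * y ≤ 1)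
    (R : Finset C.Meas) (W : Finset C.Node) :
    ∑ r, C.readoutProb q R r *
      (∏ m, if Sum.inr m ∈ W then (if m ∈ r then y else if m ∈ R then y ^ 2 else 1) else 1) ≤
      (∏ m : C.Meas, if Sum.inr m ∈ W then 2 else 1) *
        ∏ m, if Sum.inr m ∈ W ∧ m ∈ R then y else 1 := by
  have h2 : ∀ r, C.readoutProb q R r *
      (∏ m, if Sum.inr m ∈ W then (if m ∈ r then y else if m ∈ R then y ^ 2 else 1) else 1) =
      ∏ m, if m ∈ r then (if m ∈ R then 1 - q else q) * (if Sum.inr m ∈ W then y else 1) else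
        (if m ∈ R then q else 1 - q) *
          (if Sum.inr m ∈ W then (if m ∈ R then y ^ 2 else 1) else 1) := by
    intro r
    rw [readoutProb, ← Finset.prod_mul_distrib]
    refine Finset.prod_congr rfl fun m _ => ?_
    by_cases hr : m ∈ r <;> by_cases hR : m ∈ R <;> simp [hr, hR]
  simp only [h2]
  rw [sum_finset_prod_ite, ← Finset.prod_mul_distrib]
  have h3 : 0 ≤ 1 - q := by linarith
  refine Finset.prod_le_prod (fun m _ => ?_) fun m _ => ?_
  · split_ifs <;> positivity
  · by_cases hW : Sum.inr m ∈ W <;> by_cases hR : m ∈ R <;> simp only [hW, hR, if_true, if_false,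
      and_true, and_false, and_self] <;> nlinarith

/-- The loss `ℓ` is a loss of an atom in `W`. -/
def Watched (W : Finset C.Node) (ℓ : C.LossLoc) : Prop :=
  ∃ m, Sum.inr m ∈ W ∧ C.Detects ℓ m

open Classical in
-- Each lost atom has a loss of its own, since a loss is detected by one measurement only. This
-- passes from lost atoms to the independent loss events.
theorem prod_lostAtoms_le {y : ℝ} (hy : 1 ≤ y) (l : Finset C.LossLoc) (W : Finset C.Node) :
    (∏ m, if Sum.inr m ∈ W ∧ m ∈ C.lostAtoms l then y else 1) ≤
      ∏ ℓ : C.LossLoc, if ℓ ∈ l ∧ C.Watched W ℓ then y else 1 := by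
  rw [prod_ite_eq_pow_card fun m : C.Meas => Sum.inr m ∈ W ∧ m ∈ C.lostAtoms l,
    prod_ite_eq_pow_card fun ℓ : C.LossLoc => ℓ ∈ l ∧ C.Watched W ℓ]
  refine pow_le_pow_right₀ hy ?_
  refine Finset.card_le_card_of_forall_subsingleton (fun m ℓ => C.Detects ℓ m) (fun m hm => ?_)
    fun ℓ _ m hm m' hm' => hm.2.unique hm'.2
  have h1 := (Finset.mem_filter.1 hm).2
  have h2 := h1.2
  rw [lostAtoms, Finset.mem_filter] at h2
  obtain ⟨-, ℓ, hℓ, hd⟩ := h2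
  exact ⟨ℓ, Finset.mem_filter.2 ⟨Finset.mem_univ _, hℓ, m, h1.1, hd⟩, hd⟩

open Classical in
-- Each watched location contributes `q * y + (1 - q) ≤ 2`, and there are at most `κ` of them for
-- each node of `W`.
theorem sum_lossProb_mul_le {q y : ℝ} (h0 : 0 ≤ q) (h1 : q ≤ 1) (hy : 1 ≤ y) (hq : q * y ≤ 1)
    {κ : ℕ} (hκ : ∀ m, (Finset.univ.filter fun ℓ => C.Detects ℓ m).card ≤ κ) (W : Finset C.Node) :
    ∑ l, C.lossProb q l *
      (∏ ℓ : C.LossLoc, if ℓ ∈ l ∧ C.Watched W ℓ then y else 1) ≤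
      2 ^ (κ * W.card) := by
  have h2 : ∀ l, C.lossProb q l *
      (∏ ℓ : C.LossLoc, if ℓ ∈ l ∧ C.Watched W ℓ then y else 1) =
      ∏ ℓ, if ℓ ∈ l then q * (if C.Watched W ℓ then y else 1) else 1 - q := by
    intro l
    rw [lossProb, ← Finset.prod_mul_distrib]
    refine Finset.prod_congr rfl fun ℓ _ => ?_
    by_cases hl : ℓ ∈ l <;> simp [hl]
  simp only [h2]
  rw [sum_finset_prod_ite]
  have h3 : 0 ≤ 1 - q := by linarith
  calc _ ≤ ∏ ℓ : C.LossLoc, (if C.Watched W ℓ then (2 : ℝ) else 1) := by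
        refine Finset.prod_le_prod (fun m _ => ?_) fun m _ => ?_
        · split_ifs <;> positivity
        · split_ifs <;> linarith
    _ = 2 ^ (Finset.univ.filter fun ℓ : C.LossLoc =>
          C.Watched W ℓ).card :=
        prod_ite_eq_pow_card (fun ℓ : C.LossLoc => C.Watched W ℓ) 2
    _ ≤ 2 ^ (κ * W.card) := by
        refine pow_le_pow_right₀ one_le_two ?_
        have hsub : (Finset.univ.filter fun ℓ : C.LossLoc =>
            C.Watched W ℓ) ⊆
            W.toRight.biUnion fun m => Finset.univ.filter fun ℓ => C.Detects ℓ m := by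
          intro ℓ
          simp [Watched]
        refine (Finset.card_le_card hsub).trans (Finset.card_biUnion_le.trans ?_)
        refine (Finset.sum_le_card_nsmul _ _ κ fun m _ => hκ m).trans ?_
        rw [smul_eq_mul, mul_comm]
        refine Nat.mul_le_mul_left κ ?_
        rw [← W.card_toLeft_add_card_toRight]
        omega

open Classical in
/-- An exponential moment of the weight of a set of nodes. -/
theorem sum_pow_weight_le {q p₀ y : ℝ} (h0 : 0 ≤ q) (h1 : q ≤ 1) (h0' : 0 ≤ p₀) (h1' : p₀ ≤ 1)
    (hy : 1 ≤ y) (hq : q * y ≤ 1) (hp : p₀ * y ^ 2 ≤ 1) {κ : ℕ}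
    (hκ : ∀ m, (Finset.univ.filter fun ℓ => C.Detects ℓ m).card ≤ κ) (W : Finset C.Node) :
    ∑ p, ∑ l, ∑ r, C.pauliProb p₀ p * C.lossProb q l * C.readoutProb q (C.lostAtoms l) r *
      y ^ (∑ n ∈ W, C.weight p (C.lostAtoms l) r n) ≤ (2 ^ (κ + 1)) ^ W.card := by
  set G : (C.PauliLoc → Pauli × Pauli) → ℝ := fun p =>
    ∏ ℓ, if Sum.inl ℓ ∈ W then (if p ℓ ≠ 0 then y ^ 2 else 1) else 1 with hG
  set H : Finset C.Meas → Finset C.Meas → ℝ := fun R r =>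
    ∏ m, if Sum.inr m ∈ W then (if m ∈ r then y else if m ∈ R then y ^ 2 else 1) else 1 with hH
  have hy0 : 0 ≤ y := by linarith
  have hW : (∏ ℓ : C.PauliLoc, if Sum.inl ℓ ∈ W then (2 : ℝ) else 1) *
      (∏ m : C.Meas, if Sum.inr m ∈ W then (2 : ℝ) else 1) = 2 ^ W.card := by
    rw [← Fintype.prod_sum_type (f := fun n : C.Node => if n ∈ W then (2 : ℝ) else 1),
      prod_ite_eq_pow_card fun n : C.Node => n ∈ W]
    simp
  set A : ℝ := ∏ ℓ : C.PauliLoc, if Sum.inl ℓ ∈ W then (2 : ℝ) else 1 with hA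
  set B : ℝ := ∏ m : C.Meas, if Sum.inr m ∈ W then (2 : ℝ) else 1 with hB
  have hB0 : 0 ≤ B := Finset.prod_nonneg fun m _ => by split_ifs <;> norm_num
  have hA0 : 0 ≤ A := Finset.prod_nonneg fun m _ => by split_ifs <;> norm_num
  calc _ = (∑ p, C.pauliProb p₀ p * G p) *
        ∑ l, C.lossProb q l * ∑ r, C.readoutProb q (C.lostAtoms l) r * H (C.lostAtoms l) r := by
        rw [Finset.sum_mul]
        refine Finset.sum_congr rfl fun p _ => ?_
        rw [Finset.mul_sum]
        refine Finset.sum_congr rfl fun l _ => ?_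
        rw [Finset.mul_sum, Finset.mul_sum]
        refine Finset.sum_congr rfl fun r _ => ?_
        rw [pow_sum_weight]
        ring
    _ ≤ A * (B * 2 ^ (κ * W.card)) := by
        refine mul_le_mul (C.sum_pauliProb_mul_le h0' h1' hp W) ?_ ?_ hA0
        -- The readout depends on the losses, so it is summed first, for a fixed set of lost atoms.
        · calc _ ≤ ∑ l, C.lossProb q l * (B * ∏ ℓ : C.LossLoc,
                if ℓ ∈ l ∧ C.Watched W ℓ then y else 1) := by
                refine Finset.sum_le_sum fun l _ => mul_le_mul_of_nonneg_left ?_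
                  (C.lossProb_nonneg h0 h1 l)
                exact (C.sum_readoutProb_mul_le h0 h1 hy hq _ W).trans
                  (mul_le_mul_of_nonneg_left (C.prod_lostAtoms_le hy l W) hB0)
            _ = B * ∑ l, C.lossProb q l * ∏ ℓ : C.LossLoc,
                if ℓ ∈ l ∧ C.Watched W ℓ then y else 1 := by
                rw [Finset.mul_sum]
                exact Finset.sum_congr rfl fun l _ => by ring
            _ ≤ _ := mul_le_mul_of_nonneg_left (C.sum_lossProb_mul_le h0 h1 hy hq hκ W) hB0
        · refine Finset.sum_nonneg fun l _ => mul_nonneg (C.lossProb_nonneg h0 h1 l)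
            (Finset.sum_nonneg fun r _ => mul_nonneg (C.readoutProb_nonneg h0 h1 _ r)
              (Finset.prod_nonneg fun m _ => ?_))
          split_ifs <;> positivity
    _ = (2 ^ (κ + 1)) ^ W.card := by
        rw [← mul_assoc, hW, ← pow_add, ← pow_mul]
        congr 1
        ring

end Experiment

end AtomLoss

/-! ### The union bound and the failure probability -/

namespace AtomLoss

namespace Experiment

variable {S D : Type} [Fintype S] [DecidableEq S] (C : Experiment S D)

/-- A union bound for the failure probability. -/
theorem failProb_le_sum {Dec : (D → ZMod 2) → Finset C.Meas → ZMod 2} {q p₀ y : ℝ}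
    (h0 : 0 ≤ q) (h1 : q ≤ 1) (h0' : 0 ≤ p₀) (h1' : p₀ ≤ 1)
    (hy : 1 ≤ y) (hq : q * y ≤ 1) (hp : p₀ * y ^ 2 ≤ 1) {κ : ℕ}
    (hκ : ∀ m : C.Meas, ∀ A : Finset C.LossLoc, (∀ ℓ ∈ A, C.Detects ℓ m) → A.card ≤ κ)
    (𝒲 : Finset (Finset C.Node))
    (hfail : ∀ p l r, C.Fails Dec p l r →
      ∃ W ∈ 𝒲, W.card ≤ ∑ n ∈ W, C.weight p (C.lostAtoms l) r n) :
    C.failProb Dec q p₀ ≤ ∑ W ∈ 𝒲, (2 ^ (κ + 1) / y) ^ W.card := by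
  classical
  have hy0 : 0 < y := by linarith
  -- Markov's inequality pointwise: the set `W` responsible for a failure has weight at least
  -- `W.card`, so its own term is at least 1.
  have hpt : ∀ p l r, (if C.Fails Dec p l r then (1 : ℝ) else 0) ≤
      ∑ W ∈ 𝒲, y ^ (∑ n ∈ W, C.weight p (C.lostAtoms l) r n) / y ^ W.card := by
    intro p l r
    have hnn : ∀ W ∈ 𝒲, 0 ≤ y ^ (∑ n ∈ W, C.weight p (C.lostAtoms l) r n) / y ^ W.card :=
      fun W _ => by positivity
    split_ifs with hf
    · obtain ⟨W, hW, hle⟩ := hfail p l r hf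
      refine le_trans ?_ (Finset.single_le_sum hnn hW)
      rw [one_le_div (by positivity)]
      exact pow_le_pow_right₀ hy hle
    · exact Finset.sum_nonneg hnn
  calc C.failProb Dec q p₀
      ≤ ∑ p, ∑ l, ∑ r, C.pauliProb p₀ p * C.lossProb q l * C.readoutProb q (C.lostAtoms l) r *
          ∑ W ∈ 𝒲, y ^ (∑ n ∈ W, C.weight p (C.lostAtoms l) r n) / y ^ W.card := by
        unfold failProb
        refine Finset.sum_le_sum fun p _ => Finset.sum_le_sum fun l _ =>
          Finset.sum_le_sum fun r _ => mul_le_mul_of_nonneg_left ?_ ?_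
        · convert hpt p l r
        · exact mul_nonneg (mul_nonneg (C.pauliProb_nonneg h0' h1' p) (C.lossProb_nonneg h0 h1 l))
            (C.readoutProb_nonneg h0 h1 _ r)
    _ = ∑ W ∈ 𝒲, (∑ p, ∑ l, ∑ r, C.pauliProb p₀ p * C.lossProb q l *
          C.readoutProb q (C.lostAtoms l) r *
            y ^ (∑ n ∈ W, C.weight p (C.lostAtoms l) r n)) / y ^ W.card := by
        simp only [Finset.mul_sum, Finset.sum_div, mul_div_assoc]
        symm
        rw [Finset.sum_comm]
        refine Finset.sum_congr rfl fun p _ => ?_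
        rw [Finset.sum_comm]
        exact Finset.sum_congr rfl fun l _ => Finset.sum_comm
    _ ≤ ∑ W ∈ 𝒲, (2 ^ (κ + 1) / y) ^ W.card := by
        refine Finset.sum_le_sum fun W _ => ?_
        rw [div_pow]
        refine div_le_div_of_nonneg_right ?_ (by positivity)
        refine C.sum_pow_weight_le h0 h1 h0' h1' hy hq hp (fun m => hκ m _ fun ℓ hℓ => ?_) W
        exact (Finset.mem_filter.1 hℓ).2

/-- The union bound with `y = 1` and the empty set as only cluster, whose single term is 1. -/
theorem failProb_le_one (Dec : (D → ZMod 2) → Finset C.Meas → ZMod 2) {q p₀ : ℝ}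
    (h0 : 0 ≤ q) (h1 : q ≤ 1) (h0' : 0 ≤ p₀) (h1' : p₀ ≤ 1) : C.failProb Dec q p₀ ≤ 1 := by
  have := C.failProb_le_sum (Dec := Dec) h0 h1 h0' h1' le_rfl (by simpa) (by simpa)
    (fun _ A _ => A.card_le_univ) {∅} fun p l r _ => ⟨∅, by simp, by simp⟩
  simpa using this

end Experiment

open Experiment

variable {d T : ℕ} {b : Basis}

/-- An upper bound for the inverse threshold. -/
noncomputable def thresholdBound : ℝ := 4 * ((closeBound : ℝ) ^ 2 * 2 ^ (lifeBound + 1))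

theorem closeBound_pos : 0 < closeBound := by
  unfold closeBound
  norm_num

theorem thresholdBound_pos : 0 < thresholdBound := by
  have : (0 : ℝ) < closeBound := by exact_mod_cast closeBound_pos
  unfold thresholdBound
  positivity

/-- The failure probability in terms of a common upper bound for the loss rate and the square root
of the Pauli error rate. -/
theorem failProb_le (hd : 3 ≤ d) (hodd : Odd d) (hT : 1 ≤ T) {w : ℝ} (hw : 0 < w)
    {Dec : (Fin (T + 1) × Plaq d → ZMod 2) → Finset (midSwap d T b).Meas → ZMod 2}
    (hDec : (midSwap d T b).IsEnvelopeMLE w Dec) {q p₀ z : ℝ}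
    (h0 : 0 ≤ q) (h0' : 0 ≤ p₀) (hz : 0 < z) (hz1 : z ≤ 1) (hq : q ≤ z) (hp : p₀ ≤ z ^ 2) :
    (midSwap d T b).failProb Dec q p₀ ≤ 180 * T * (thresholdBound * z) ^ d := by
  classical
  have hT' : (1 : ℝ) ≤ T := by exact_mod_cast hT
  have h1 : q ≤ 1 := hq.trans hz1
  have h1' : p₀ ≤ 1 := hp.trans (pow_le_one₀ hz.le hz1)
  have hB := thresholdBound_pos
  -- The base of the moment is `y = z⁻¹`, which makes both `q * y ≤ 1` and `p₀ * y ^ 2 ≤ 1`.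
  set c : ℝ := 2 ^ (lifeBound + 1) / z⁻¹ with hc
  have hc0 : 0 ≤ c := by positivity
  have hx : (closeBound : ℝ) ^ 2 * c = thresholdBound * z / 4 := by
    rw [hc, thresholdBound, div_inv_eq_mul]
    ring
  by_cases hsmall : (closeBound : ℝ) ^ 2 * c ≤ 1 / 2
  · have hfail : ∀ p l r, (midSwap d T b).Fails Dec p l r →
        ∃ W ∈ Finset.univ.filter fun W : Finset (midSwap d T b).Node =>
          Linked Close W ∧ d ≤ W.card,
          W.card ≤ ∑ n ∈ W, (midSwap d T b).weight p ((midSwap d T b).lostAtoms l) r n := by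
      intro p l r hf
      obtain ⟨W, err, herr, hout, hcard, hconn⟩ := exists_cluster hw hDec hf
      refine ⟨W, Finset.mem_filter.2 ⟨Finset.mem_univ _, ?_,
        le_card_of_outcome (by omega) hT herr hout⟩, hcard⟩
      intro A hA hne hAW
      obtain ⟨a, ha, a', ha', i, hi, hi'⟩ := hconn A hA hne hAW
      refine ⟨a, ha, a', ?_, close_of_syndrome hd hodd hT (herr a (hA ha))
        (herr a' (Finset.mem_sdiff.1 ha').1) hi hi'⟩
      convert ha'
    calc (midSwap d T b).failProb Dec q p₀
        ≤ ∑ W : Finset (midSwap d T b).Node with Linked Close W ∧ d ≤ W.card, c ^ W.card := by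
          refine failProb_le_sum _ h0 h1 h0' h1' (one_le_inv_iff₀.2 ⟨hz, hz1⟩) ?_ ?_ ?_ _ hfail
          · rw [← div_eq_mul_inv]
            exact (div_le_one hz).2 hq
          · rw [inv_pow, ← div_eq_mul_inv]
            exact (div_le_one (by positivity)).2 hp
          · intro m A hA
            refine le_trans (Finset.card_le_card fun ℓ hℓ => ?_) (card_detects_le hd hodd m)
            simpa using hA ℓ hℓ
      _ ≤ 2 * Fintype.card (midSwap d T b).Node * ((closeBound : ℝ) ^ 2 * c) ^ d := by
          convert sum_linked_le (fun _ _ h => Close.symm h) card_close_le closeBound_pos hc0 hsmall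
            (by omega : 0 < d)
      _ ≤ 2 * (90 * T * 4 ^ d) * ((closeBound : ℝ) ^ 2 * c) ^ d := by
          have := card_node_le (b := b) hd hT
          have h2 : (Fintype.card (midSwap d T b).Node : ℝ) ≤ 90 * T * 4 ^ d := by
            exact_mod_cast this
          gcongr
      _ = 180 * T * (thresholdBound * z) ^ d := by
          -- The factor `4` in `thresholdBound` cancels the `4 ^ d` from the number of nodes.
          rw [hx, div_pow]
          field_simp
          ring
  -- Otherwise `thresholdBound * z > 2`, and the claimed bound exceeds 1.
  · refine (failProb_le_one _ Dec h0 h1 h0' h1').trans ?_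
    rw [hx] at hsmall
    have h2 : 1 ≤ (thresholdBound * z) ^ d := one_le_pow₀ (by linarith)
    nlinarith

/-- Take `z` to be the maximum of the loss rate and the square root of the Pauli rate; `z ^ d` is
then at most the sum of the two powers. -/
theorem failProb_le_rates (hd : 3 ≤ d) (hodd : Odd d) (hT : 1 ≤ T) {w : ℝ} (hw : 0 < w)
    {Dec : (Fin (T + 1) × Plaq d → ZMod 2) → Finset (midSwap d T b).Meas → ZMod 2}
    (hDec : (midSwap d T b).IsEnvelopeMLE w Dec) {q p₀ : ℝ}
    (h0 : 0 ≤ q) (h1 : q ≤ 1) (h0' : 0 ≤ p₀) (h1' : p₀ ≤ 1) :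
    (midSwap d T b).failProb Dec q p₀ ≤
      180 * T * ((thresholdBound⁻¹ ^ d)⁻¹ * (q ^ d + p₀ ^ ((d : ℝ) / 2))) := by
  have hB := thresholdBound_pos
  have hs : p₀ ^ ((d : ℝ) / 2) = √p₀ ^ d := by
    rw [Real.sqrt_eq_rpow, ← Real.rpow_natCast, ← Real.rpow_mul h0']
    congr 1
    ring
  rw [hs, inv_pow, inv_inv]
  set z := max q √p₀ with hz
  have hz0 : 0 ≤ z := h0.trans (le_max_left _ _)
  have hz1 : z ≤ 1 := max_le h1 (Real.sqrt_le_one.2 h1')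
  have hpz : p₀ ≤ z ^ 2 := by
    rw [← Real.sq_sqrt h0']
    exact pow_le_pow_left₀ (Real.sqrt_nonneg _) (le_max_right _ _) 2
  have hzd : z ^ d ≤ q ^ d + √p₀ ^ d := by
    have h2 := pow_nonneg h0 d
    have h3 := pow_nonneg (Real.sqrt_nonneg p₀) d
    rcases max_choice q √p₀ with h | h <;> rw [hz, h] <;> linarith
  have key : (midSwap d T b).failProb Dec q p₀ ≤ 180 * T * (thresholdBound * z) ^ d := by
    rcases hz0.eq_or_lt with h | h
    -- For `z = 0` the base `z⁻¹` is not available; the bound holds for every small positive `x` and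
    -- passes to the limit.
    · have hlim : Filter.Tendsto (fun z : ℝ => 180 * T * (thresholdBound * z) ^ d)
          (nhdsWithin 0 (Set.Ioi 0)) (nhds (180 * T * (thresholdBound * 0) ^ d)) :=
        (Continuous.tendsto (by fun_prop) 0).mono_left nhdsWithin_le_nhds
      rw [← h]
      refine ge_of_tendsto hlim ?_
      filter_upwards [Ioc_mem_nhdsGT (zero_lt_one' ℝ)] with x hx
      refine failProb_le hd hodd hT hw hDec h0 h0' hx.1 hx.2
        ((le_max_left _ _).trans (by rw [← hz, ← h]; exact hx.1.le)) (hpz.trans ?_)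
      rw [← h]
      nlinarith [hx.1]
    · exact failProb_le hd hodd hT hw hDec h0 h0' h hz1 (le_max_left _ _) hpz
  refine key.trans (mul_le_mul_of_nonneg_left ?_ (by positivity))
  rw [mul_pow]
  exact mul_le_mul_of_nonneg_left hzd (by positivity)

end AtomLoss

theorem mainTheorem9 :
    (∀ (d T : ℕ) (b : AtomLoss.Basis) (w : ℝ), 3 ≤ d → Odd d → 1 ≤ T → 0 < w →
      ∀ Dec, (AtomLoss.midSwap d T b).IsEnvelopeMLE w Dec →
        ∀ p l r, (AtomLoss.midSwap d T b).Fails Dec p l r →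
          d ≤ 2 * (AtomLoss.midSwap d T b).numPauli p + r.card +
            2 * ((AtomLoss.midSwap d T b).lostAtoms l \ r).card) ∧
    ∃ pth : ℝ, 0 < pth ∧ ∃ K : ℝ, 0 < K ∧
      ∀ (d T : ℕ) (b : AtomLoss.Basis) (w : ℝ), 3 ≤ d → Odd d → 1 ≤ T → 0 < w →
        ∀ Dec, (AtomLoss.midSwap d T b).IsEnvelopeMLE w Dec →
          ∀ ploss ppauli : ℝ, 0 ≤ ploss → ploss ≤ 1 → 0 ≤ ppauli → ppauli ≤ 1 →
            (AtomLoss.midSwap d T b).failProb Dec ploss ppauli ≤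
              K * T * ((pth ^ d)⁻¹ * (ploss ^ d + ppauli ^ ((d : ℝ) / 2))) := by
  refine ⟨fun d T b w hd _ hT hw Dec hDec p l r hfail =>
    AtomLoss.le_of_fails (by omega) hT hw hDec hfail,
    AtomLoss.thresholdBound⁻¹, inv_pos.2 AtomLoss.thresholdBound_pos, 180, by norm_num,
    fun d T b w hd hodd hT hw Dec hDec q p h0 h1 h0' h1' =>
      AtomLoss.failProb_le_rates hd hodd hT hw hDec h0 h1 h0' h1'⟩
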